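/- **Lemma (Preservation).** For all terms $M, M'$, contexts $\Gamma$ and types $A$ of the calculus $\mathrm{Links}^T$ defined below: if $\Gamma \vdash M : A$ and $M \leadsto M'$, then $\Gamma \vdash M' : A$. **The calculus.** Terms, types and constructors are taken up to renaming of bound variables, and bound variables are chosen fresh for the context. *Syntax.* Kinds $K ::= \mathit{Type} \mid \mathit{BaseType} \mid \mathit{Row} \mid \mathit{BaseRow} \mid K_1 \to K_2$, where $\mathit{BaseType} \le \mathit{Type}$ and $\mathit{BaseRow} \le \mathit{Row}$. Write $(\kappa,\varrho)$ for either of the pairs $(\mathit{Type},\mathit{Row})$, $(\mathit{BaseType},\mathit{BaseRow})$. Constructors $C, D$ and row constructors $S$ (a single syntactic category, sorted by kinding; row variables $\rho$ are type variables of a row kind): $$\mathtt{Bool}^* \mid \mathtt{Int}^* \mid \mathtt{String}^* \mid \alpha \mid \lambda\alpha{:}K.C \mid C\,D \mid \mathtt{List}^*\,C \mid \mathtt{Record}^*\,S \mid \mathtt{Trace}^*\,C \mid \mathrm{Typerec}\;C\,(C_B,C_I,C_S,C_L,C_R,C_T) \mid \cdot \mid l{:}C;S \mid \mathrm{Rmap}\;C\,S.$$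 Types $A,B$ and row types $R$: $$\mathtt T(C) \mid \mathtt{Bool} \mid \mathtt{Int} \mid \mathtt{String} \mid A\to B \mid \mathtt{List}\,A \mid \mathtt{Record}\,R \mid \mathtt{Trace}\,A \mid \forall\alpha{:}K.A \mid \cdot \mid l{:}A;R.$$ Write $\langle R\rangle$ for $\mathtt{Record}\,R$. Terms: $$c \mid x \mid \lambda x{:}A.M \mid M\,N \mid \Lambda\alpha{:}K.M \mid M\,C \mid \mathrm{fix}\,f{:}A.M \mid \mathrm{if}\,L\,\mathrm{then}\,M\,\mathrm{else}\,N \mid M+N \mid M{=}{=}N \mid \langle\rangle \mid \langle l=M;N\rangle \mid M.l \mid \mathrm{rmap}^S M\,N \mid \mathrm{rfold}^S L\,M\,N$$ $$\mid [\,] \mid [M] \mid M \mathbin{+\!\!+} N \mid \mathrm{for}\,(x\leftarrow M)\,N \mid \mathrm{table}\,n\,\langle R\rangle \mid \mathtt{Lit}\,M \mid \mathtt{If}\,M \mid \mathtt{For}\,C\,M \mid \mathtt{Cell}\,M \mid \mathtt{OpEq}\,C\,M \mid \mathtt{OpPlus}\,M$$ $$\mid \mathrm{tracecase}\,M\,\mathrm{of}\,(x.M_L,x.M_I,\alpha.x.M_F,x.M_C,\alpha.x.M_E,x.M_P)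 \mid \mathrm{typecase}\,C\,\mathrm{of}\,(M_B,M_I,M_S,\beta.M_L,\rho.M_R,\gamma.M_T),$$ where constants $c$ are Boolean, integer and string literals, with the evident types $\Sigma(c) \in \{\mathtt{Bool},\mathtt{Int},\mathtt{String}\}$. A context $\Gamma$ is a list of entries $\alpha{:}K$ and $x{:}A$; it is well-formed if each $x{:}A$ in it satisfies $\Gamma'\vdash A:\mathit{Type}$ for the part $\Gamma'$ of $\Gamma$ to its left. All judgements below presuppose that $\Gamma$ is well-formed. *Kinding of constructors* ($\Gamma\vdash C:K$). $\mathtt{Bool}^*,\mathtt{Int}^*,\mathtt{String}^*:\mathit{BaseType}$; $\alpha:\Gamma(\alpha)$; $\lambda$ and application as in the simply typed $\lambda$-calculus; $\mathtt{List}^*\,C:\mathit{Type}$ if $C:\mathit{Type}$; $\mathtt{Record}^*\,S:\mathit{Type}$ if $S:\mathit{Row}$; $\mathtt{Trace}^*\,C:\mathit{Type}$ if $C:\mathit{BaseType}$; for $K\in\{\mathit{Type},\mathit{BaseType}\}$, $\mathrm{Typerec}\;C\,(C_B,C_I,C_S,C_L,C_R,C_T):K$ if $C:\mathit{Type}$,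 $C_B,C_I,C_S:K$, $C_L:\mathit{Type}\to K\to K$, $C_R:\mathit{Row}\to\mathit{Row}\to K$, $C_T:\mathit{BaseType}\to K\to K$; $\cdot:\varrho$; $(l{:}C;S):\varrho$ if $C:\kappa$ and $S:\varrho$; $\mathrm{Rmap}\;C\,S:\mathit{Row}$ if $C:\mathit{Type}\to\mathit{Type}$ and $S:\mathit{Row}$; and subsumption along $\le$. *Kinding of types* ($\Gamma\vdash A:K$). $\mathtt T(C):K$ if $C:K$ and $K$ is not an arrow kind; $\mathtt{Bool},\mathtt{Int},\mathtt{String}:\mathit{BaseType}$; $A\to B$, $\mathtt{List}\,A$, $\forall\alpha{:}K.A$ have kind $\mathit{Type}$ if their immediate subtypes have (for $\forall$, in $\Gamma,\alpha{:}K$); $\langle R\rangle:\mathit{Type}$ if $R:\mathit{Row}$; $\mathtt{Trace}\,A:\mathit{Type}$ if $A:\mathit{BaseType}$; $\cdot:\varrho$; $(l{:}A;R):\varrho$ if $A:\kappa$ and $R:\varrho$; subsumption along $\le$. *Constructor computation* $C\leadsto C'$ is the closure under all constructor formers of $(\lambda\alpha{:}K.C)\,D\leadsto C[\alpha:=D]$;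 $\mathrm{Rmap}\;C\,\cdot\leadsto\cdot$; $\mathrm{Rmap}\;C\,(l{:}D;S)\leadsto(l{:}C\,D;\mathrm{Rmap}\;C\,S)$; and, writing $\mathrm{TR}(C)$ for $\mathrm{Typerec}\;C\,(C_B,C_I,C_S,C_L,C_R,C_T)$: $\mathrm{TR}(\mathtt{Bool}^*)\leadsto C_B$, $\mathrm{TR}(\mathtt{Int}^*)\leadsto C_I$, $\mathrm{TR}(\mathtt{String}^*)\leadsto C_S$, $\mathrm{TR}(\mathtt{List}^*D)\leadsto C_L\,D\,\mathrm{TR}(D)$, $\mathrm{TR}(\mathtt{Record}^*S)\leadsto C_R\,S\,(\mathrm{Rmap}\,(\lambda\alpha{:}\mathit{Type}.\mathrm{TR}(\alpha))\,S)$, $\mathrm{TR}(\mathtt{Trace}^*D)\leadsto C_T\,D\,\mathrm{TR}(D)$. *Equivalence.* $\Gamma\vdash C=D:K$ is the least kinded equivalence relation that is closed under all constructor formers and subsumption and contains $\eta$ ($\lambda\alpha{:}K.C\,\alpha=C:K\to K'$ if $C:K\to K'$ and $\alpha$ is not free in $C$), $C=D:K$ whenever $C\leadsto D$ and both have kind $K$,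 and $(l{:}C;l'{:}D;S)=(l'{:}D;l{:}C;S):\varrho$ for well-kinded rows with $l\ne l'$. $\Gamma\vdash A=B:K$ is the least kinded equivalence relation that is closed under all type formers and subsumption and contains the same exchange of adjacent fields with different labels, $\mathtt T(C)=\mathtt T(D):K$ for $C=D:K$ ($K$ not an arrow), and (for well-kinded arguments) $\mathtt T(\mathtt{Bool}^*)=\mathtt{Bool}$, $\mathtt T(\mathtt{Int}^*)=\mathtt{Int}$, $\mathtt T(\mathtt{String}^*)=\mathtt{String}$ (at $\mathit{BaseType}$), $\mathtt T(\mathtt{List}^*C)=\mathtt{List}\,\mathtt T(C)$, $\mathtt T(\mathtt{Record}^*S)=\langle\mathtt T(S)\rangle$, $\mathtt T(\mathtt{Trace}^*C)=\mathtt{Trace}\,\mathtt T(C)$ (at $\mathit{Type}$), $\mathtt T(\cdot)=\cdot$ and $\mathtt T(l{:}C;S)=(l{:}\mathtt T(C);\mathtt T(S))$ (at $\varrho$). *Typing* ($\Gamma\vdash M:A$). The standard rules for constants, variables, $\lambda$, application, $\Lambda$, constructor application ($M\,C:A[\alpha:=C]$ if $M:\forall\alpha{:}K.A$ and $\Gamma\vdash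 C:K$), $\mathrm{fix}$ ($\mathrm{fix}\,f{:}A.M:A$ if $\Gamma\vdash A:\mathit{Type}$ and $\Gamma,f{:}A\vdash M:A$), conditionals, $+$ on $\mathtt{Int}$, and lists; here $[\,]:\mathtt{List}\,A$ if $A:\mathit{Type}$, and $\mathrm{for}\,(x\leftarrow M)\,N:\mathtt{List}\,B$ if $M:\mathtt{List}\,A$ and $\Gamma,x{:}A\vdash N:\mathtt{List}\,B$. Further: - $M{=}{=}N:\mathtt{Bool}$ if $M,N:A$ and $A:\mathit{BaseType}$; $M:A$ if $M:B$ and $\Gamma\vdash A=B:\mathit{Type}$. - $\mathrm{table}\,n\,\langle\mathsf{oid}{:}\mathtt{Int};R\rangle:\mathtt{List}\,\langle\mathsf{oid}{:}\mathtt{Int};R\rangle$ if $\cdot\vdash R:\mathit{BaseRow}$. - $\langle\rangle:\langle\cdot\rangle$; $\langle l=M;N\rangle:\langle l{:}A;R\rangle$ if $M:A$ and $N:\langle R\rangle$; $M.l:A$ if $M:\langle l{:}A;R\rangle$. - $\mathrm{rmap}^SM\,N:\mathtt T(\mathtt{Record}^*(\mathrm{Rmap}\;C\,S))$ if $C:\mathit{Type}\to\mathit{Type}$,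 $M:\forall\alpha{:}\mathit{Type}.\mathtt T(\alpha)\to\mathtt T(C\,\alpha)$ and $N:\mathtt T(\mathtt{Record}^*S)$. - $\mathrm{rfold}^SL\,M\,N:\mathtt T(C)$ if $L:\mathtt T(C)\to\mathtt T(C)\to\mathtt T(C)$, $M:\mathtt T(C)$ and $N:\mathtt T(\mathtt{Record}^*(\mathrm{Rmap}\,(\lambda\alpha{:}\mathit{Type}.C)\,S))$, with $\alpha$ not free in $C$. - $\mathrm{typecase}\,C\,\mathrm{of}\,(M_B,M_I,M_S,\beta.M_L,\rho.M_R,\gamma.M_T):B[\alpha:=C]$ if $C:\mathit{Type}$; $\Gamma,\alpha{:}\mathit{Type}\vdash B:\mathit{Type}$; $M_B:B[\alpha:=\mathtt{Bool}^*]$; $M_I:B[\alpha:=\mathtt{Int}^*]$; $M_S:B[\alpha:=\mathtt{String}^*]$; $\Gamma,\beta{:}\mathit{Type}\vdash M_L:B[\alpha:=\mathtt{List}^*\beta]$; $\Gamma,\rho{:}\mathit{Row}\vdash M_R:B[\alpha:=\mathtt{Record}^*\rho]$; $\Gamma,\gamma{:}\mathit{BaseType}\vdash M_T:B[\alpha:=\mathtt{Trace}^*\gamma]$.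 - Let $\mathtt{TRACE}=\lambda\alpha{:}\mathit{Type}.\mathrm{Typerec}\;\alpha\,(\mathtt{Trace}^*\mathtt{Bool}^*,\mathtt{Trace}^*\mathtt{Int}^*,\mathtt{Trace}^*\mathtt{String}^*,\lambda\_{:}\mathit{Type}.\lambda b{:}\mathit{Type}.\mathtt{List}^*b,\lambda\_{:}\mathit{Row}.\lambda r{:}\mathit{Row}.\mathtt{Record}^*r,\lambda\_{:}\mathit{BaseType}.\lambda b{:}\mathit{Type}.b)$, and let $I_A=\langle\mathsf{cond}{:}\mathtt{Trace\,Bool};\mathsf{out}{:}\mathtt{Trace}\,A\rangle$, $F_{C,A}=\langle\mathsf{in}{:}\mathtt T(\mathtt{TRACE}\,C);\mathsf{out}{:}\mathtt{Trace}\,A\rangle$, $L_A=\langle\mathsf{table}{:}\mathtt{String};\mathsf{column}{:}\mathtt{String};\mathsf{row}{:}\mathtt{Int};\mathsf{data}{:}A\rangle$, $E_C=\langle\mathsf{left}{:}\mathtt T(\mathtt{TRACE}\,C);\mathsf{right}{:}\mathtt T(\mathtt{TRACE}\,C)\rangle$, $P=\langle\mathsf{left}{:}\mathtt{Trace\,Int};\mathsf{right}{:}\mathtt{Trace\,Int}\rangle$.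 Then $\mathtt{Lit}\,c:\mathtt{Trace}\,O$ if $c$ is a constant, $c:O$ and $O\in\{\mathtt{Bool},\mathtt{Int},\mathtt{String}\}$; $\mathtt{If}\,M:\mathtt{Trace}\,A$ if $M:I_A$; $\mathtt{For}\,C\,M:\mathtt{Trace}\,A$ if $C:\mathit{Type}$ and $M:F_{C,A}$; $\mathtt{Cell}\,M:\mathtt{Trace}\,A$ if $A:\mathit{BaseType}$ and $M:L_A$; $\mathtt{OpEq}\,C\,M:\mathtt{Trace\,Bool}$ if $C:\mathit{BaseType}$ and $M:E_C$; $\mathtt{OpPlus}\,M:\mathtt{Trace\,Int}$ if $M:P$; and $\mathrm{tracecase}\,M\,\mathrm{of}\,(x.M_L,x.M_I,\alpha.x.M_F,x.M_C,\alpha.x.M_E,x.M_P):B$ if $M:\mathtt{Trace}\,A$ and $M_L,M_I,M_F,M_C,M_E,M_P$ all have type $B$ in $\Gamma$ extended by, respectively, $x{:}A$; $x{:}I_A$; $\alpha{:}\mathit{Type},x{:}F_{\alpha,A}$; $x{:}L_A$; $\alpha{:}\mathit{BaseType},x{:}E_\alpha$; $x{:}P$ ($\alpha$ not free in $A,B$).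 *Reduction* $M\leadsto M'$ of terms is generated by the following rules. ($\beta$-rules) $(\lambda x{:}A.M)\,N\leadsto M[x:=N]$; $\mathrm{fix}\,f{:}A.M\leadsto M[f:=\mathrm{fix}\,f{:}A.M]$; $(\Lambda\alpha{:}K.M)\,C\leadsto M[\alpha:=C]$; $\mathrm{if}\,\mathrm{true}\,\mathrm{then}\,M\,\mathrm{else}\,N\leadsto M$; $\mathrm{if}\,\mathrm{false}\,\mathrm{then}\,M\,\mathrm{else}\,N\leadsto N$; $P.l\leadsto M$ if $P$ is a record literal $\langle l_1=M_1;\dots\langle l_k=M_k;N\rangle\dots\rangle$ with $l_k=l$, $M_k=M$ and $l_i\neq l$ for $i<k$; for pairwise distinct labels $l_1,\dots,l_n$ ($n\ge0$) and $S=(l_1{:}C_1;\dots;l_n{:}C_n;\cdot)$, $\mathrm{rmap}^SM\,N\leadsto\langle l_1=(M\,C_1)\,N.l_1;\dots;l_n=(M\,C_n)\,N.l_n\rangle$ and $\mathrm{rfold}^SL\,M\,N\leadsto L\,N.l_1\,(L\,N.l_2\cdots(L\,N.l_n\,M)\cdots)$; $\mathrm{for}\,(x\leftarrow[\,])\,N\leadsto[\,]$;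 $\mathrm{for}\,(x\leftarrow[M])\,N\leadsto N[x:=M]$; $\mathrm{tracecase}$ of $\mathtt{Lit}\,M$, $\mathtt{If}\,M$, $\mathtt{For}\,C\,M$, $\mathtt{Cell}\,M$, $\mathtt{OpEq}\,C\,M$, $\mathtt{OpPlus}\,M$ reduces to $M_L[x:=M]$, $M_I[x:=M]$, $M_F[\alpha:=C,x:=M]$, $M_C[x:=M]$, $M_E[\alpha:=C,x:=M]$, $M_P[x:=M]$ respectively; $\mathrm{typecase}$ of $\mathtt{Bool}^*$, $\mathtt{Int}^*$, $\mathtt{String}^*$, $\mathtt{List}^*C$, $\mathtt{Record}^*S$, $\mathtt{Trace}^*C$ reduces to $M_B$, $M_I$, $M_S$, $M_L[\beta:=C]$, $M_R[\rho:=S]$, $M_T[\gamma:=C]$ respectively. (Commuting conversions) A conditional is moved outwards: $\mathcal E[\mathrm{if}\,L\,\mathrm{then}\,M_1\,\mathrm{else}\,M_2]\leadsto\mathrm{if}\,L\,\mathrm{then}\,\mathcal E[M_1]\,\mathrm{else}\,\mathcal E[M_2]$ for $\mathcal E$ one of $[\cdot]\,N$; $[\cdot]\,C$; $[\cdot].l$;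 $\mathrm{if}\,[\cdot]\,\mathrm{then}\,N_1\,\mathrm{else}\,N_2$; $\mathrm{for}\,(x\leftarrow[\cdot])\,N$; $\mathrm{tracecase}\,[\cdot]\,\mathrm{of}\,(\dots)$. Moreover $\mathrm{for}\,(x\leftarrow M_1\mathbin{+\!\!+}M_2)\,N\leadsto(\mathrm{for}\,(x\leftarrow M_1)\,N)\mathbin{+\!\!+}(\mathrm{for}\,(x\leftarrow M_2)\,N)$ and $\mathrm{for}\,(x\leftarrow\mathrm{for}\,(y\leftarrow L)\,M)\,N\leadsto\mathrm{for}\,(y\leftarrow L)\,\mathrm{for}\,(x\leftarrow M)\,N$ ($y$ not free in $N$). (Congruence rules) A step in any immediate subterm, including subterms under binders, and a step $C\leadsto C'$ or $S\leadsto S'$ of constructor computation in any immediate constructor or row constructor argument, is a step of the whole term, except that there is no reduction inside the body of $\mathrm{fix}$ and none inside type annotations (those of $\lambda$, $\mathrm{fix}$ and $\mathrm{table}$). -/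

import Mathlib

/-!
A core calculus with type-level computation (`Typerec`, `Rmap`), run-time type analysis
(`typecase`), generic record operations (`rmap`, `rfold`) and a built-in type of traces.

Binders are represented by de Bruijn indices. Type variables and term variables are numbered
separately. In a unified context, type variable `n` is the `n`-th type-variable entry, and term
variable `n` is the `n`-th term-variable entry, both counted from the right, starting at 0.
-/

namespace LinksT

/-! ### Kinds, constructors, types, terms -/

/-- Record labels: the distinguished labels of tables and traces, and a further label for each
string. All of them are pairwise distinct. -/
inductive Label : Type
  | oid
  | cond
  | out
  | input
  | table
  | column
  | row
  | data
  | left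
  | right
  | other (s : String)

inductive Kind : Type
  | type
  | baseType
  | row
  | baseRow
  | arrow (K₁ K₂ : Kind)

/-- `BaseType` is a subkind of `Type`, and `BaseRow` is a subkind of `Row`. -/
inductive SubKind : Kind → Kind → Prop
  | base : SubKind Kind.baseType Kind.type
  | baseRow : SubKind Kind.baseRow Kind.row

/-- `RowOf κ ρ`: rows of kind `ρ` have fields of kind `κ`. -/
inductive RowOf : Kind → Kind → Prop
  | row : RowOf Kind.type Kind.row
  | baseRow : RowOf Kind.baseType Kind.baseRow

/-- The kinds `Type` and `BaseType`. -/
inductive TypeLike : Kind → Prop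
  | type : TypeLike Kind.type
  | baseType : TypeLike Kind.baseType

/-- The kinds that are not arrows: those of types and of row types. -/
inductive Ground : Kind → Prop
  | type : Ground Kind.type
  | baseType : Ground Kind.baseType
  | row : Ground Kind.row
  | baseRow : Ground Kind.baseRow

/-- Constructors and row constructors. They form one syntactic category that is sorted by kinding,
so that row variables are the type variables of a row kind, and rows can be passed as arguments. -/
inductive Con : Type
  | bool
  | int
  | string
  | var (n : ℕ)
  | lam (K : Kind) (C : Con)
  | app (C D : Con)
  | list (C : Con)
  | record (S : Con)
  | trace (C : Con)
  | typerec (C CB CI CS CL CR CT : Con)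
  | rnil
  | rcons (l : Label) (C S : Con)
  | rmap (C S : Con)

/-- Types and row types; `T C` embeds constructors into types and row constructors into row
types. -/
inductive Ty : Type
  | T (C : Con)
  | bool
  | int
  | string
  | fn (A B : Ty)
  | list (A : Ty)
  | record (R : Ty)
  | trace (A : Ty)
  | all (K : Kind) (A : Ty)
  | rnil
  | rcons (l : Label) (A R : Ty)

inductive Const : Type
  | bool (b : Bool)
  | int (i : ℤ)
  | string (s : String)

/-- The signature: the types of the constants. -/
def Const.ty : Const → Ty
  | .bool _ => .bool
  | .int _ => .int
  | .string _ => .string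

inductive Term : Type
  | const (c : Const)
  | var (n : ℕ)
  /-- `λ x : A. M`, binds a term variable -/
  | lam (A : Ty) (M : Term)
  | app (M N : Term)
  /-- `Λ α : K. M`, binds a type variable -/
  | tlam (K : Kind) (M : Term)
  | tapp (M : Term) (C : Con)
  /-- `fix f : A. M`, binds a term variable -/
  | fix (A : Ty) (M : Term)
  | ite (L M N : Term)
  | plus (M N : Term)
  | eq (M N : Term)
  | rnil
  | rcons (l : Label) (M N : Term)
  | proj (M : Term) (l : Label)
  | rmap (S : Con) (M N : Term)
  | rfold (S : Con) (L M N : Term)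
  | nil
  | single (M : Term)
  | append (M N : Term)
  /-- `for (x ← M) N`, binds a term variable in `N` -/
  | comp (M N : Term)
  | table (n : String) (R : Ty)
  | trLit (M : Term)
  | trIf (M : Term)
  | trFor (C : Con) (M : Term)
  | trCell (M : Term)
  | trOpEq (C : Con) (M : Term)
  | trOpPlus (M : Term)
  /-- `tracecase M of (x.ML, x.MI, α.x.MF, x.MC, α.x.ME, x.MP)` -/
  | tracecase (M ML MI MF MC ME MP : Term)
  /-- `typecase C of (MB, MI, MS, β.ML, ρ.MR, γ.MT)` -/
  | typecase (C : Con) (MB MI MS ML MR MT : Term)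

/-! ### Renaming and substitution -/

/-- Extend a map on indices by a value for index `0`. -/
def scons {X : Type} (a : X) (f : ℕ → X) : ℕ → X
  | 0 => a
  | n + 1 => f n

/-- Lift a renaming under one binder. -/
def upRen (ξ : ℕ → ℕ) : ℕ → ℕ := scons 0 (fun n => ξ n + 1)

def Con.rename (ξ : ℕ → ℕ) : Con → Con
  | .bool => .bool
  | .int => .int
  | .string => .string
  | .var n => .var (ξ n)
  | .lam K C => .lam K (C.rename (upRen ξ))
  | .app C D => .app (C.rename ξ) (D.rename ξ)
  | .list C => .list (C.rename ξ)
  | .record S => .record (S.rename ξ)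
  | .trace C => .trace (C.rename ξ)
  | .typerec C CB CI CS CL CR CT =>
      .typerec (C.rename ξ) (CB.rename ξ) (CI.rename ξ) (CS.rename ξ) (CL.rename ξ)
        (CR.rename ξ) (CT.rename ξ)
  | .rnil => .rnil
  | .rcons l C S => .rcons l (C.rename ξ) (S.rename ξ)
  | .rmap C S => .rmap (C.rename ξ) (S.rename ξ)

/-- Weakening by one type variable. -/
def Con.shift (C : Con) : Con := C.rename Nat.succ

/-- Lift a constructor substitution under one type binder. -/
def upCon (σ : ℕ → Con) : ℕ → Con := scons (.var 0) (fun n => (σ n).shift)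

def Con.subst (σ : ℕ → Con) : Con → Con
  | .bool => .bool
  | .int => .int
  | .string => .string
  | .var n => σ n
  | .lam K C => .lam K (C.subst (upCon σ))
  | .app C D => .app (C.subst σ) (D.subst σ)
  | .list C => .list (C.subst σ)
  | .record S => .record (S.subst σ)
  | .trace C => .trace (C.subst σ)
  | .typerec C CB CI CS CL CR CT =>
      .typerec (C.subst σ) (CB.subst σ) (CI.subst σ) (CS.subst σ) (CL.subst σ)
        (CR.subst σ) (CT.subst σ)
  | .rnil => .rnil
  | .rcons l C S => .rcons l (C.subst σ) (S.subst σ)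
  | .rmap C S => .rmap (C.subst σ) (S.subst σ)

/-- `C[α := D]` for the outermost type variable `α` of `C`. -/
def Con.inst (C D : Con) : Con := C.subst (scons D Con.var)

def Ty.rename (ξ : ℕ → ℕ) : Ty → Ty
  | .T C => .T (C.rename ξ)
  | .bool => .bool
  | .int => .int
  | .string => .string
  | .fn A B => .fn (A.rename ξ) (B.rename ξ)
  | .list A => .list (A.rename ξ)
  | .record R => .record (R.rename ξ)
  | .trace A => .trace (A.rename ξ)
  | .all K A => .all K (A.rename (upRen ξ))
  | .rnil => .rnil
  | .rcons l A R => .rcons l (A.rename ξ) (R.rename ξ)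

/-- Weakening by one type variable. -/
def Ty.shift (A : Ty) : Ty := A.rename Nat.succ

def Ty.subst (σ : ℕ → Con) : Ty → Ty
  | .T C => .T (C.subst σ)
  | .bool => .bool
  | .int => .int
  | .string => .string
  | .fn A B => .fn (A.subst σ) (B.subst σ)
  | .list A => .list (A.subst σ)
  | .record R => .record (R.subst σ)
  | .trace A => .trace (A.subst σ)
  | .all K A => .all K (A.subst (upCon σ))
  | .rnil => .rnil
  | .rcons l A R => .rcons l (A.subst σ) (R.subst σ)

/-- `A[α := C]` for the outermost type variable `α` of `A`. -/
def Ty.inst (A : Ty) (C : Con) : Ty := A.subst (scons C Con.var)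

/-- `B[α := C]`, where `C` lives under a new type variable that replaces `α` in the context. -/
def Ty.instUnder (B : Ty) (C : Con) : Ty := B.subst (scons C (fun n => Con.var (n + 1)))

/-- Rename type variables by `ξ` and term variables by `ζ`. -/
def Term.rename (ξ ζ : ℕ → ℕ) : Term → Term
  | .const c => .const c
  | .var n => .var (ζ n)
  | .lam A M => .lam (A.rename ξ) (M.rename ξ (upRen ζ))
  | .app M N => .app (M.rename ξ ζ) (N.rename ξ ζ)
  | .tlam K M => .tlam K (M.rename (upRen ξ) ζ)
  | .tapp M C => .tapp (M.rename ξ ζ) (C.rename ξ)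
  | .fix A M => .fix (A.rename ξ) (M.rename ξ (upRen ζ))
  | .ite L M N => .ite (L.rename ξ ζ) (M.rename ξ ζ) (N.rename ξ ζ)
  | .plus M N => .plus (M.rename ξ ζ) (N.rename ξ ζ)
  | .eq M N => .eq (M.rename ξ ζ) (N.rename ξ ζ)
  | .rnil => .rnil
  | .rcons l M N => .rcons l (M.rename ξ ζ) (N.rename ξ ζ)
  | .proj M l => .proj (M.rename ξ ζ) l
  | .rmap S M N => .rmap (S.rename ξ) (M.rename ξ ζ) (N.rename ξ ζ)
  | .rfold S L M N => .rfold (S.rename ξ) (L.rename ξ ζ) (M.rename ξ ζ) (N.rename ξ ζ)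
  | .nil => .nil
  | .single M => .single (M.rename ξ ζ)
  | .append M N => .append (M.rename ξ ζ) (N.rename ξ ζ)
  | .comp M N => .comp (M.rename ξ ζ) (N.rename ξ (upRen ζ))
  | .table n R => .table n (R.rename ξ)
  | .trLit M => .trLit (M.rename ξ ζ)
  | .trIf M => .trIf (M.rename ξ ζ)
  | .trFor C M => .trFor (C.rename ξ) (M.rename ξ ζ)
  | .trCell M => .trCell (M.rename ξ ζ)
  | .trOpEq C M => .trOpEq (C.rename ξ) (M.rename ξ ζ)
  | .trOpPlus M => .trOpPlus (M.rename ξ ζ)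
  | .tracecase M ML MI MF MC ME MP =>
      .tracecase (M.rename ξ ζ) (ML.rename ξ (upRen ζ)) (MI.rename ξ (upRen ζ))
        (MF.rename (upRen ξ) (upRen ζ)) (MC.rename ξ (upRen ζ))
        (ME.rename (upRen ξ) (upRen ζ)) (MP.rename ξ (upRen ζ))
  | .typecase C MB MI MS ML MR MT =>
      .typecase (C.rename ξ) (MB.rename ξ ζ) (MI.rename ξ ζ) (MS.rename ξ ζ)
        (ML.rename (upRen ξ) ζ) (MR.rename (upRen ξ) ζ) (MT.rename (upRen ξ) ζ)

/-- Lift a term substitution under one term binder. -/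
def upTm (τ : ℕ → Term) : ℕ → Term := scons (.var 0) (fun n => (τ n).rename id Nat.succ)

/-- Lift a term substitution under one type binder. -/
def wkTm (τ : ℕ → Term) : ℕ → Term := fun n => (τ n).rename Nat.succ id

/-- Substitute type variables by `σ` and term variables by `τ`, simultaneously. -/
def Term.subst (σ : ℕ → Con) (τ : ℕ → Term) : Term → Term
  | .const c => .const c
  | .var n => τ n
  | .lam A M => .lam (A.subst σ) (M.subst σ (upTm τ))
  | .app M N => .app (M.subst σ τ) (N.subst σ τ)
  | .tlam K M => .tlam K (M.subst (upCon σ) (wkTm τ))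
  | .tapp M C => .tapp (M.subst σ τ) (C.subst σ)
  | .fix A M => .fix (A.subst σ) (M.subst σ (upTm τ))
  | .ite L M N => .ite (L.subst σ τ) (M.subst σ τ) (N.subst σ τ)
  | .plus M N => .plus (M.subst σ τ) (N.subst σ τ)
  | .eq M N => .eq (M.subst σ τ) (N.subst σ τ)
  | .rnil => .rnil
  | .rcons l M N => .rcons l (M.subst σ τ) (N.subst σ τ)
  | .proj M l => .proj (M.subst σ τ) l
  | .rmap S M N => .rmap (S.subst σ) (M.subst σ τ) (N.subst σ τ)
  | .rfold S L M N => .rfold (S.subst σ) (L.subst σ τ) (M.subst σ τ) (N.subst σ τ)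
  | .nil => .nil
  | .single M => .single (M.subst σ τ)
  | .append M N => .append (M.subst σ τ) (N.subst σ τ)
  | .comp M N => .comp (M.subst σ τ) (N.subst σ (upTm τ))
  | .table n R => .table n (R.subst σ)
  | .trLit M => .trLit (M.subst σ τ)
  | .trIf M => .trIf (M.subst σ τ)
  | .trFor C M => .trFor (C.subst σ) (M.subst σ τ)
  | .trCell M => .trCell (M.subst σ τ)
  | .trOpEq C M => .trOpEq (C.subst σ) (M.subst σ τ)
  | .trOpPlus M => .trOpPlus (M.subst σ τ)
  | .tracecase M ML MI MF MC ME MP =>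
      .tracecase (M.subst σ τ) (ML.subst σ (upTm τ)) (MI.subst σ (upTm τ))
        (MF.subst (upCon σ) (upTm (wkTm τ))) (MC.subst σ (upTm τ))
        (ME.subst (upCon σ) (upTm (wkTm τ))) (MP.subst σ (upTm τ))
  | .typecase C MB MI MS ML MR MT =>
      .typecase (C.subst σ) (MB.subst σ τ) (MI.subst σ τ) (MS.subst σ τ)
        (ML.subst (upCon σ) (wkTm τ)) (MR.subst (upCon σ) (wkTm τ))
        (MT.subst (upCon σ) (wkTm τ))

/-- `M[x := N]` for the outermost term variable `x` of `M`. -/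
def Term.instTm (M N : Term) : Term := M.subst Con.var (scons N Term.var)

/-- `M[α := C]` for the outermost type variable `α` of `M`. -/
def Term.instTy (M : Term) (C : Con) : Term := M.subst (scons C Con.var) Term.var

/-- `M[α := C, x := N]` for the outermost type variable `α` and term variable `x` of `M`. -/
def Term.instBoth (M : Term) (C : Con) (N : Term) : Term :=
  M.subst (scons C Con.var) (scons N Term.var)

/-- Weaken a term that lives under one term binder by a new term variable just outside of that
binder. -/
def Term.shiftUnder (M : Term) : Term := M.rename id (upRen Nat.succ)

/-! ### Contexts -/

inductive Ctx : Type
  | nil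
  | tvar (Γ : Ctx) (K : Kind)
  | var (Γ : Ctx) (A : Ty)

/-- `Γ(α) = K`. -/
inductive Ctx.TVarAt : Ctx → ℕ → Kind → Prop
  | here {Γ : Ctx} {K : Kind} : TVarAt (.tvar Γ K) 0 K
  | tvar {Γ : Ctx} {n : ℕ} {K K' : Kind} : TVarAt Γ n K → TVarAt (.tvar Γ K') (n + 1) K
  | var {Γ : Ctx} {n : ℕ} {K : Kind} {A : Ty} : TVarAt Γ n K → TVarAt (.var Γ A) n K

/-- `Γ(x) = A`. -/
inductive Ctx.VarAt : Ctx → ℕ → Ty → Prop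
  | here {Γ : Ctx} {A : Ty} : VarAt (.var Γ A) 0 A
  | var {Γ : Ctx} {n : ℕ} {A B : Ty} : VarAt Γ n A → VarAt (.var Γ B) (n + 1) A
  | tvar {Γ : Ctx} {n : ℕ} {A : Ty} {K : Kind} : VarAt Γ n A → VarAt (.tvar Γ K) n A.shift

/-! ### Well-formed contexts, kinding of constructors, kinding of types -/

mutual

inductive WfCtx : Ctx → Prop
  | nil : WfCtx .nil
  | var {Γ : Ctx} {A : Ty} : TyKind Γ A .type → WfCtx (.var Γ A)
  | tvar {Γ : Ctx} {K : Kind} : WfCtx Γ → WfCtx (.tvar Γ K)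

/-- `Γ ⊢ C : K` for constructors and row constructors. -/
inductive ConKind : Ctx → Con → Kind → Prop
  | bool {Γ : Ctx} : WfCtx Γ → ConKind Γ .bool .baseType
  | int {Γ : Ctx} : WfCtx Γ → ConKind Γ .int .baseType
  | string {Γ : Ctx} : WfCtx Γ → ConKind Γ .string .baseType
  | var {Γ : Ctx} {n : ℕ} {K : Kind} : WfCtx Γ → Γ.TVarAt n K → ConKind Γ (.var n) K
  | lam {Γ : Ctx} {K₁ K₂ : Kind} {C : Con} :
      ConKind (.tvar Γ K₁) C K₂ → ConKind Γ (.lam K₁ C) (.arrow K₁ K₂)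
  | app {Γ : Ctx} {K₁ K₂ : Kind} {C D : Con} :
      ConKind Γ C (.arrow K₁ K₂) → ConKind Γ D K₁ → ConKind Γ (.app C D) K₂
  | list {Γ : Ctx} {C : Con} : ConKind Γ C .type → ConKind Γ (.list C) .type
  | record {Γ : Ctx} {S : Con} : ConKind Γ S .row → ConKind Γ (.record S) .type
  | trace {Γ : Ctx} {C : Con} : ConKind Γ C .baseType → ConKind Γ (.trace C) .type
  | typerec {Γ : Ctx} {K : Kind} {C CB CI CS CL CR CT : Con} :
      TypeLike K →
      ConKind Γ C .type →
      ConKind Γ CB K →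
      ConKind Γ CI K →
      ConKind Γ CS K →
      ConKind Γ CL (.arrow .type (.arrow K K)) →
      ConKind Γ CR (.arrow .row (.arrow .row K)) →
      ConKind Γ CT (.arrow .baseType (.arrow K K)) →
      ConKind Γ (.typerec C CB CI CS CL CR CT) K
  | rnil {Γ : Ctx} {κ ρ : Kind} : RowOf κ ρ → WfCtx Γ → ConKind Γ .rnil ρ
  | rcons {Γ : Ctx} {κ ρ : Kind} {l : Label} {C S : Con} :
      RowOf κ ρ → ConKind Γ C κ → ConKind Γ S ρ → ConKind Γ (.rcons l C S) ρ
  | rmap {Γ : Ctx} {C S : Con} :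
      ConKind Γ C (.arrow .type .type) → ConKind Γ S .row → ConKind Γ (.rmap C S) .row
  | sub {Γ : Ctx} {C : Con} {K K' : Kind} : ConKind Γ C K → SubKind K K' → ConKind Γ C K'

/-- `Γ ⊢ A : K` for types and row types. -/
inductive TyKind : Ctx → Ty → Kind → Prop
  | T {Γ : Ctx} {C : Con} {K : Kind} : Ground K → ConKind Γ C K → TyKind Γ (.T C) K
  | bool {Γ : Ctx} : WfCtx Γ → TyKind Γ .bool .baseType
  | int {Γ : Ctx} : WfCtx Γ → TyKind Γ .int .baseType
  | string {Γ : Ctx} : WfCtx Γ → TyKind Γ .string .baseType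
  | sub {Γ : Ctx} {A : Ty} {K K' : Kind} : TyKind Γ A K → SubKind K K' → TyKind Γ A K'
  | all {Γ : Ctx} {K : Kind} {A : Ty} : TyKind (.tvar Γ K) A .type → TyKind Γ (.all K A) .type
  | fn {Γ : Ctx} {A B : Ty} : TyKind Γ A .type → TyKind Γ B .type → TyKind Γ (.fn A B) .type
  | list {Γ : Ctx} {A : Ty} : TyKind Γ A .type → TyKind Γ (.list A) .type
  | record {Γ : Ctx} {R : Ty} : TyKind Γ R .row → TyKind Γ (.record R) .type
  | trace {Γ : Ctx} {A : Ty} : TyKind Γ A .baseType → TyKind Γ (.trace A) .type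
  | rnil {Γ : Ctx} {κ ρ : Kind} : RowOf κ ρ → WfCtx Γ → TyKind Γ .rnil ρ
  | rcons {Γ : Ctx} {κ ρ : Kind} {l : Label} {A R : Ty} :
      RowOf κ ρ → TyKind Γ A κ → TyKind Γ R ρ → TyKind Γ (.rcons l A R) ρ

end

/-! ### Constructor computation and equivalence -/

/-- `C ⤳ C'` for constructors and row constructors. -/
inductive ConStep : Con → Con → Prop
  | rcons_tail {l : Label} {C S S' : Con} : ConStep S S' → ConStep (.rcons l C S) (.rcons l C S')
  | rcons_head {l : Label} {C C' S : Con} : ConStep C C' → ConStep (.rcons l C S) (.rcons l C' S)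
  | app_fun {C C' D : Con} : ConStep C C' → ConStep (.app C D) (.app C' D)
  | app_arg {C D D' : Con} : ConStep D D' → ConStep (.app C D) (.app C D')
  | beta {K : Kind} {C D : Con} : ConStep (.app (.lam K C) D) (C.inst D)
  | lam {K : Kind} {C C' : Con} : ConStep C C' → ConStep (.lam K C) (.lam K C')
  | list {C C' : Con} : ConStep C C' → ConStep (.list C) (.list C')
  | trace {C C' : Con} : ConStep C C' → ConStep (.trace C) (.trace C')
  | record {S S' : Con} : ConStep S S' → ConStep (.record S) (.record S')
  | rmap_rnil {C : Con} : ConStep (.rmap C .rnil) .rnil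
  | rmap_rcons {C D S : Con} {l : Label} :
      ConStep (.rmap C (.rcons l D S)) (.rcons l (.app C D) (.rmap C S))
  | rmap_row {C S S' : Con} : ConStep S S' → ConStep (.rmap C S) (.rmap C S')
  | rmap_fun {C C' S : Con} : ConStep C C' → ConStep (.rmap C S) (.rmap C' S)
  | typerec_scrut {C C' CB CI CS CL CR CT : Con} : ConStep C C' →
      ConStep (.typerec C CB CI CS CL CR CT) (.typerec C' CB CI CS CL CR CT)
  | typerec_B {C CB CB' CI CS CL CR CT : Con} : ConStep CB CB' →
      ConStep (.typerec C CB CI CS CL CR CT) (.typerec C CB' CI CS CL CR CT)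
  | typerec_I {C CB CI CI' CS CL CR CT : Con} : ConStep CI CI' →
      ConStep (.typerec C CB CI CS CL CR CT) (.typerec C CB CI' CS CL CR CT)
  | typerec_S {C CB CI CS CS' CL CR CT : Con} : ConStep CS CS' →
      ConStep (.typerec C CB CI CS CL CR CT) (.typerec C CB CI CS' CL CR CT)
  | typerec_L {C CB CI CS CL CL' CR CT : Con} : ConStep CL CL' →
      ConStep (.typerec C CB CI CS CL CR CT) (.typerec C CB CI CS CL' CR CT)
  | typerec_R {C CB CI CS CL CR CR' CT : Con} : ConStep CR CR' →
      ConStep (.typerec C CB CI CS CL CR CT) (.typerec C CB CI CS CL CR' CT)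
  | typerec_T {C CB CI CS CL CR CT CT' : Con} : ConStep CT CT' →
      ConStep (.typerec C CB CI CS CL CR CT) (.typerec C CB CI CS CL CR CT')
  | typerec_bool {CB CI CS CL CR CT : Con} :
      ConStep (.typerec .bool CB CI CS CL CR CT) CB
  | typerec_int {CB CI CS CL CR CT : Con} :
      ConStep (.typerec .int CB CI CS CL CR CT) CI
  | typerec_string {CB CI CS CL CR CT : Con} :
      ConStep (.typerec .string CB CI CS CL CR CT) CS
  | typerec_list {D CB CI CS CL CR CT : Con} :
      ConStep (.typerec (.list D) CB CI CS CL CR CT)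
        (.app (.app CL D) (.typerec D CB CI CS CL CR CT))
  | typerec_record {S CB CI CS CL CR CT : Con} :
      ConStep (.typerec (.record S) CB CI CS CL CR CT)
        (.app (.app CR S)
          (.rmap (.lam .type (.typerec (.var 0) CB.shift CI.shift CS.shift CL.shift
            CR.shift CT.shift)) S))
  | typerec_trace {D CB CI CS CL CR CT : Con} :
      ConStep (.typerec (.trace D) CB CI CS CL CR CT)
        (.app (.app CT D) (.typerec D CB CI CS CL CR CT))

/-- `Γ ⊢ C = D : K` for constructors and row constructors. Rows are identified up to the order of
fields with different labels. -/
inductive ConEq : Ctx → Con → Con → Kind → Prop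
  | refl {Γ : Ctx} {C : Con} {K : Kind} : ConKind Γ C K → ConEq Γ C C K
  | symm {Γ : Ctx} {C D : Con} {K : Kind} : ConEq Γ D C K → ConEq Γ C D K
  | trans {Γ : Ctx} {C C' C'' : Con} {K : Kind} :
      ConEq Γ C C' K → ConEq Γ C' C'' K → ConEq Γ C C'' K
  | sub {Γ : Ctx} {C D : Con} {K K' : Kind} : ConEq Γ C D K → SubKind K K' → ConEq Γ C D K'
  | eta {Γ : Ctx} {C : Con} {K K' : Kind} : ConKind Γ C (.arrow K K') →
      ConEq Γ (.lam K (.app C.shift (.var 0))) C (.arrow K K')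
  | lam {Γ : Ctx} {C D : Con} {K K' : Kind} : ConEq (.tvar Γ K) C D K' →
      ConEq Γ (.lam K C) (.lam K D) (.arrow K K')
  | app {Γ : Ctx} {C C' D D' : Con} {K K' : Kind} :
      ConEq Γ C C' (.arrow K' K) → ConEq Γ D D' K' → ConEq Γ (.app C D) (.app C' D') K
  | list {Γ : Ctx} {C D : Con} : ConEq Γ C D .type → ConEq Γ (.list C) (.list D) .type
  | record {Γ : Ctx} {S S' : Con} : ConEq Γ S S' .row → ConEq Γ (.record S) (.record S') .type
  | trace {Γ : Ctx} {C D : Con} : ConEq Γ C D .baseType → ConEq Γ (.trace C) (.trace D) .type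
  | step {Γ : Ctx} {C D : Con} {K : Kind} :
      ConKind Γ C K → ConKind Γ D K → ConStep C D → ConEq Γ C D K
  | rnil {Γ : Ctx} {κ ρ : Kind} : RowOf κ ρ → WfCtx Γ → ConEq Γ .rnil .rnil ρ
  | rcons {Γ : Ctx} {κ ρ : Kind} {l : Label} {C D S S' : Con} :
      RowOf κ ρ → ConEq Γ C D κ → ConEq Γ S S' ρ → ConEq Γ (.rcons l C S) (.rcons l D S') ρ
  | swap {Γ : Ctx} {κ ρ : Kind} {l l' : Label} {C D S : Con} :
      RowOf κ ρ → l ≠ l' → ConKind Γ C κ → ConKind Γ D κ → ConKind Γ S ρ →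
      ConEq Γ (.rcons l C (.rcons l' D S)) (.rcons l' D (.rcons l C S)) ρ
  | rmap {Γ : Ctx} {C D S S' : Con} :
      ConEq Γ C D (.arrow .type .type) → ConEq Γ S S' .row →
      ConEq Γ (.rmap C S) (.rmap D S') .row
  | typerec {Γ : Ctx} {K : Kind} {C C' CB CB' CI CI' CS CS' CL CL' CR CR' CT CT' : Con} :
      TypeLike K →
      ConEq Γ C C' .type →
      ConEq Γ CB CB' K →
      ConEq Γ CI CI' K →
      ConEq Γ CS CS' K →
      ConEq Γ CL CL' (.arrow .type (.arrow K K)) →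
      ConEq Γ CR CR' (.arrow .row (.arrow .row K)) →
      ConEq Γ CT CT' (.arrow .baseType (.arrow K K)) →
      ConEq Γ (.typerec C CB CI CS CL CR CT) (.typerec C' CB' CI' CS' CL' CR' CT') K

/-! ### Type equivalence -/

/-- `Γ ⊢ A = B : K` for types and row types. Rows are identified up to the order of fields with
different labels. -/
inductive TyEq : Ctx → Ty → Ty → Kind → Prop
  | refl {Γ : Ctx} {A : Ty} {K : Kind} : TyKind Γ A K → TyEq Γ A A K
  | symm {Γ : Ctx} {A B : Ty} {K : Kind} : TyEq Γ B A K → TyEq Γ A B K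
  | trans {Γ : Ctx} {A B C : Ty} {K : Kind} : TyEq Γ A B K → TyEq Γ B C K → TyEq Γ A C K
  | sub {Γ : Ctx} {A B : Ty} {K K' : Kind} : TyEq Γ A B K → SubKind K K' → TyEq Γ A B K'
  | T_bool {Γ : Ctx} : WfCtx Γ → TyEq Γ (.T .bool) .bool .baseType
  | T_int {Γ : Ctx} : WfCtx Γ → TyEq Γ (.T .int) .int .baseType
  | T_string {Γ : Ctx} : WfCtx Γ → TyEq Γ (.T .string) .string .baseType
  | T_list {Γ : Ctx} {C : Con} : ConKind Γ C .type →
      TyEq Γ (.T (.list C)) (.list (.T C)) .type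
  | T_record {Γ : Ctx} {S : Con} : ConKind Γ S .row →
      TyEq Γ (.T (.record S)) (.record (.T S)) .type
  | T_trace {Γ : Ctx} {C : Con} : ConKind Γ C .baseType →
      TyEq Γ (.T (.trace C)) (.trace (.T C)) .type
  | T_rnil {Γ : Ctx} {κ ρ : Kind} : RowOf κ ρ → WfCtx Γ → TyEq Γ (.T .rnil) .rnil ρ
  | T_rcons {Γ : Ctx} {κ ρ : Kind} {l : Label} {C S : Con} :
      RowOf κ ρ → ConKind Γ C κ → ConKind Γ S ρ →
      TyEq Γ (.T (.rcons l C S)) (.rcons l (.T C) (.T S)) ρ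
  | T_congr {Γ : Ctx} {C D : Con} {K : Kind} : Ground K → ConEq Γ C D K →
      TyEq Γ (.T C) (.T D) K
  | list {Γ : Ctx} {A B : Ty} : TyEq Γ A B .type → TyEq Γ (.list A) (.list B) .type
  | record {Γ : Ctx} {R R' : Ty} : TyEq Γ R R' .row → TyEq Γ (.record R) (.record R') .type
  | trace {Γ : Ctx} {A B : Ty} : TyEq Γ A B .baseType → TyEq Γ (.trace A) (.trace B) .type
  | fn {Γ : Ctx} {A A' B B' : Ty} : TyEq Γ A A' .type → TyEq Γ B B' .type →
      TyEq Γ (.fn A B) (.fn A' B') .type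
  | all {Γ : Ctx} {K : Kind} {A B : Ty} : TyEq (.tvar Γ K) A B .type →
      TyEq Γ (.all K A) (.all K B) .type
  | rnil {Γ : Ctx} {κ ρ : Kind} : RowOf κ ρ → WfCtx Γ → TyEq Γ .rnil .rnil ρ
  | rcons {Γ : Ctx} {κ ρ : Kind} {l : Label} {A B R R' : Ty} :
      RowOf κ ρ → TyEq Γ A B κ → TyEq Γ R R' ρ → TyEq Γ (.rcons l A R) (.rcons l B R') ρ
  | swap {Γ : Ctx} {κ ρ : Kind} {l l' : Label} {A B R : Ty} :
      RowOf κ ρ → l ≠ l' → TyKind Γ A κ → TyKind Γ B κ → TyKind Γ R ρ →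
      TyEq Γ (.rcons l A (.rcons l' B R)) (.rcons l' B (.rcons l A R)) ρ

/-! ### Typing -/

/-- The type-level function
`TRACE = λα. Typerec α (Trace Bool, Trace Int, Trace String, λ_ b. List b, λ_ r. Record r, λ_ b. b)`
that replaces the base types in a query type by their traced versions. -/
def TRACE : Con :=
  .lam .type (.typerec (.var 0) (.trace .bool) (.trace .int) (.trace .string)
    (.lam .type (.lam .type (.list (.var 0))))
    (.lam .row (.lam .row (.record (.var 0))))
    (.lam .baseType (.lam .type (.var 0))))

/-- `T(TRACE C)` -/
def traced (C : Con) : Ty := .T (.app TRACE C)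

/-- `⟨cond : Trace Bool, out : Trace A⟩`, the contents of an `If` trace. -/
def ifTy (A : Ty) : Ty :=
  .record (.rcons .cond (.trace .bool) (.rcons .out (.trace A) .rnil))

/-- `⟨in : T(TRACE C), out : Trace A⟩`, the contents of a `For C` trace. -/
def forTy (C : Con) (A : Ty) : Ty :=
  .record (.rcons .input (traced C) (.rcons .out (.trace A) .rnil))

/-- `⟨table : String, column : String, row : Int, data : A⟩`, the contents of a `Cell` trace. -/
def cellTy (A : Ty) : Ty :=
  .record (.rcons .table .string (.rcons .column .string (.rcons .row .int
    (.rcons .data A .rnil))))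

/-- `⟨left : T(TRACE C), right : T(TRACE C)⟩`, the contents of an `OpEq C` trace. -/
def opEqTy (C : Con) : Ty :=
  .record (.rcons .left (traced C) (.rcons .right (traced C) .rnil))

/-- `⟨left : Trace Int, right : Trace Int⟩`, the contents of an `OpPlus` trace. -/
def opPlusTy : Ty :=
  .record (.rcons .left (.trace .int) (.rcons .right (.trace .int) .rnil))

/-- `Γ ⊢ M : A`. -/
inductive Typed : Ctx → Term → Ty → Prop
  | const {Γ : Ctx} {c : Const} : WfCtx Γ → Typed Γ (.const c) c.ty
  | var {Γ : Ctx} {n : ℕ} {A : Ty} : WfCtx Γ → Γ.VarAt n A → Typed Γ (.var n) A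
  | lam {Γ : Ctx} {A B : Ty} {M : Term} :
      TyKind Γ A .type → Typed (.var Γ A) M B → Typed Γ (.lam A M) (.fn A B)
  | app {Γ : Ctx} {A B : Ty} {M N : Term} :
      Typed Γ M (.fn A B) → Typed Γ N A → Typed Γ (.app M N) B
  | tlam {Γ : Ctx} {K : Kind} {A : Ty} {M : Term} :
      Typed (.tvar Γ K) M A → Typed Γ (.tlam K M) (.all K A)
  | tapp {Γ : Ctx} {K : Kind} {A : Ty} {M : Term} {C : Con} :
      Typed Γ M (.all K A) → ConKind Γ C K → Typed Γ (.tapp M C) (A.inst C)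
  | fix {Γ : Ctx} {A : Ty} {M : Term} :
      TyKind Γ A .type → Typed (.var Γ A) M A → Typed Γ (.fix A M) A
  | ite {Γ : Ctx} {A : Ty} {L M N : Term} :
      Typed Γ L .bool → Typed Γ M A → Typed Γ N A → Typed Γ (.ite L M N) A
  | plus {Γ : Ctx} {M N : Term} :
      Typed Γ M .int → Typed Γ N .int → Typed Γ (.plus M N) .int
  | eq {Γ : Ctx} {A : Ty} {M N : Term} :
      Typed Γ M A → Typed Γ N A → TyKind Γ A .baseType → Typed Γ (.eq M N) .bool
  | table {Γ : Ctx} {n : String} {R : Ty} :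
      WfCtx Γ → TyKind .nil R .baseRow →
      Typed Γ (.table n (.rcons .oid .int R)) (.list (.record (.rcons .oid .int R)))
  | nil {Γ : Ctx} {A : Ty} : TyKind Γ A .type → Typed Γ .nil (.list A)
  | single {Γ : Ctx} {A : Ty} {M : Term} : Typed Γ M A → Typed Γ (.single M) (.list A)
  | append {Γ : Ctx} {A : Ty} {M N : Term} :
      Typed Γ M (.list A) → Typed Γ N (.list A) → Typed Γ (.append M N) (.list A)
  | comp {Γ : Ctx} {A B : Ty} {M N : Term} :
      Typed Γ M (.list A) → Typed (.var Γ A) N (.list B) → Typed Γ (.comp M N) (.list B)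
  | rnil {Γ : Ctx} : WfCtx Γ → Typed Γ .rnil (.record .rnil)
  | rcons {Γ : Ctx} {l : Label} {A R : Ty} {M N : Term} :
      Typed Γ M A → Typed Γ N (.record R) → Typed Γ (.rcons l M N) (.record (.rcons l A R))
  | proj {Γ : Ctx} {l : Label} {A R : Ty} {M : Term} :
      Typed Γ M (.record (.rcons l A R)) → Typed Γ (.proj M l) A
  | conv {Γ : Ctx} {A B : Ty} {M : Term} :
      Typed Γ M B → TyEq Γ A B .type → Typed Γ M A
  | rmap {Γ : Ctx} {C S : Con} {M N : Term} :
      ConKind Γ C (.arrow .type .type) →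
      Typed Γ M (.all .type (.fn (.T (.var 0)) (.T (.app C.shift (.var 0))))) →
      Typed Γ N (.T (.record S)) →
      Typed Γ (.rmap S M N) (.T (.record (.rmap C S)))
  | rfold {Γ : Ctx} {C S : Con} {L M N : Term} :
      Typed Γ L (.fn (.T C) (.fn (.T C) (.T C))) →
      Typed Γ M (.T C) →
      Typed Γ N (.T (.record (.rmap (.lam .type C.shift) S))) →
      Typed Γ (.rfold S L M N) (.T C)
  | typecase {Γ : Ctx} {C : Con} {B : Ty} {MB MI MS ML MR MT : Term} :
      ConKind Γ C .type →
      TyKind (.tvar Γ .type) B .type →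
      Typed Γ MB (B.inst .bool) →
      Typed Γ MI (B.inst .int) →
      Typed Γ MS (B.inst .string) →
      Typed (.tvar Γ .type) ML (B.instUnder (.list (.var 0))) →
      Typed (.tvar Γ .row) MR (B.instUnder (.record (.var 0))) →
      Typed (.tvar Γ .baseType) MT (B.instUnder (.trace (.var 0))) →
      Typed Γ (.typecase C MB MI MS ML MR MT) (B.inst C)
  | trLit_bool {Γ : Ctx} {c : Const} :
      Typed Γ (.const c) .bool → Typed Γ (.trLit (.const c)) (.trace .bool)
  | trLit_int {Γ : Ctx} {c : Const} :
      Typed Γ (.const c) .int → Typed Γ (.trLit (.const c)) (.trace .int)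
  | trLit_string {Γ : Ctx} {c : Const} :
      Typed Γ (.const c) .string → Typed Γ (.trLit (.const c)) (.trace .string)
  | trIf {Γ : Ctx} {A : Ty} {M : Term} :
      Typed Γ M (ifTy A) → Typed Γ (.trIf M) (.trace A)
  | trFor {Γ : Ctx} {A : Ty} {C : Con} {M : Term} :
      ConKind Γ C .type → Typed Γ M (forTy C A) → Typed Γ (.trFor C M) (.trace A)
  | trCell {Γ : Ctx} {A : Ty} {M : Term} :
      TyKind Γ A .baseType → Typed Γ M (cellTy A) → Typed Γ (.trCell M) (.trace A)
  | trOpEq {Γ : Ctx} {C : Con} {M : Term} :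
      ConKind Γ C .baseType → Typed Γ M (opEqTy C) → Typed Γ (.trOpEq C M) (.trace .bool)
  | trOpPlus {Γ : Ctx} {M : Term} :
      Typed Γ M opPlusTy → Typed Γ (.trOpPlus M) (.trace .int)
  | tracecase {Γ : Ctx} {A B : Ty} {M ML MI MF MC ME MP : Term} :
      Typed Γ M (.trace A) →
      Typed (.var Γ A) ML B →
      Typed (.var Γ (ifTy A)) MI B →
      Typed (.var (.tvar Γ .type) (forTy (.var 0) A.shift)) MF B.shift →
      Typed (.var Γ (cellTy A)) MC B →
      Typed (.var (.tvar Γ .baseType) (opEqTy (.var 0))) ME B.shift →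
      Typed (.var Γ opPlusTy) MP B →
      Typed Γ (.tracecase M ML MI MF MC ME MP) B

/-! ### Reduction of terms -/

/-- The closed row constructor `l₁ : C₁; …; lₙ : Cₙ; ·`. -/
def Con.ofFields : List (Label × Con) → Con
  | [] => .rnil
  | (l, C) :: fs => .rcons l C (Con.ofFields fs)

/-- `⟨l₁ = (M C₁) N.l₁; …; lₙ = (M Cₙ) N.lₙ⟩` -/
def unrollMap (M N : Term) : List (Label × Con) → Term
  | [] => .rnil
  | (l, C) :: fs => .rcons l (.app (.tapp M C) (.proj N l)) (unrollMap M N fs)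

/-- `L N.l₁ (L N.l₂ … (L N.lₙ M) …)` -/
def unrollFold (L M N : Term) : List (Label × Con) → Term
  | [] => M
  | (l, _) :: fs => .app (.app L (.proj N l)) (unrollFold L M N fs)

/-- `FieldOf l P M`: the record term `P` is a record literal whose (first) `l`-field is `M`. -/
inductive FieldOf (l : Label) : Term → Term → Prop
  | here {M N : Term} : FieldOf l (.rcons l M N) M
  | there {l' : Label} {M M' N : Term} : l' ≠ l → FieldOf l N M → FieldOf l (.rcons l' M' N) M

/-- `M ⤳ M'` for terms. -/
inductive Step : Term → Term → Prop
  -- β-rules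
  | beta {A : Ty} {M N : Term} : Step (.app (.lam A M) N) (M.instTm N)
  | fix {A : Ty} {M : Term} : Step (.fix A M) (M.instTm (.fix A M))
  | tbeta {K : Kind} {M : Term} {C : Con} : Step (.tapp (.tlam K M) C) (M.instTy C)
  | ite_true {M N : Term} : Step (.ite (.const (.bool true)) M N) M
  | ite_false {M N : Term} : Step (.ite (.const (.bool false)) M N) N
  | proj_record {l : Label} {P M : Term} : FieldOf l P M → Step (.proj P l) M
  | rmap_unroll {fs : List (Label × Con)} {M N : Term} : (fs.map Prod.fst).Nodup →
      Step (.rmap (Con.ofFields fs) M N) (unrollMap M N fs)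
  | rfold_unroll {fs : List (Label × Con)} {L M N : Term} : (fs.map Prod.fst).Nodup →
      Step (.rfold (Con.ofFields fs) L M N) (unrollFold L M N fs)
  | comp_nil {N : Term} : Step (.comp .nil N) .nil
  | comp_single {M N : Term} : Step (.comp (.single M) N) (N.instTm M)
  | tracecase_lit {M ML MI MF MC ME MP : Term} :
      Step (.tracecase (.trLit M) ML MI MF MC ME MP) (ML.instTm M)
  | tracecase_if {M ML MI MF MC ME MP : Term} :
      Step (.tracecase (.trIf M) ML MI MF MC ME MP) (MI.instTm M)
  | tracecase_for {C : Con} {M ML MI MF MC ME MP : Term} :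
      Step (.tracecase (.trFor C M) ML MI MF MC ME MP) (MF.instBoth C M)
  | tracecase_cell {M ML MI MF MC ME MP : Term} :
      Step (.tracecase (.trCell M) ML MI MF MC ME MP) (MC.instTm M)
  | tracecase_opEq {C : Con} {M ML MI MF MC ME MP : Term} :
      Step (.tracecase (.trOpEq C M) ML MI MF MC ME MP) (ME.instBoth C M)
  | tracecase_opPlus {M ML MI MF MC ME MP : Term} :
      Step (.tracecase (.trOpPlus M) ML MI MF MC ME MP) (MP.instTm M)
  | typecase_bool {MB MI MS ML MR MT : Term} :
      Step (.typecase .bool MB MI MS ML MR MT) MB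
  | typecase_int {MB MI MS ML MR MT : Term} :
      Step (.typecase .int MB MI MS ML MR MT) MI
  | typecase_string {MB MI MS ML MR MT : Term} :
      Step (.typecase .string MB MI MS ML MR MT) MS
  | typecase_list {C : Con} {MB MI MS ML MR MT : Term} :
      Step (.typecase (.list C) MB MI MS ML MR MT) (ML.instTy C)
  | typecase_record {S : Con} {MB MI MS ML MR MT : Term} :
      Step (.typecase (.record S) MB MI MS ML MR MT) (MR.instTy S)
  | typecase_trace {C : Con} {MB MI MS ML MR MT : Term} :
      Step (.typecase (.trace C) MB MI MS ML MR MT) (MT.instTy C)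
  -- commuting conversions
  | app_ite {L M₁ M₂ N : Term} :
      Step (.app (.ite L M₁ M₂) N) (.ite L (.app M₁ N) (.app M₂ N))
  | tapp_ite {L M₁ M₂ : Term} {C : Con} :
      Step (.tapp (.ite L M₁ M₂) C) (.ite L (.tapp M₁ C) (.tapp M₂ C))
  | proj_ite {L M N : Term} {l : Label} :
      Step (.proj (.ite L M N) l) (.ite L (.proj M l) (.proj N l))
  | comp_append {M₁ M₂ N : Term} :
      Step (.comp (.append M₁ M₂) N) (.append (.comp M₁ N) (.comp M₂ N))
  | comp_comp {L M N : Term} :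
      Step (.comp (.comp L M) N) (.comp L (.comp M N.shiftUnder))
  | ite_ite {L M₁ M₂ N₁ N₂ : Term} :
      Step (.ite (.ite L M₁ M₂) N₁ N₂) (.ite L (.ite M₁ N₁ N₂) (.ite M₂ N₁ N₂))
  | comp_ite {L M₁ M₂ N : Term} :
      Step (.comp (.ite L M₁ M₂) N) (.ite L (.comp M₁ N) (.comp M₂ N))
  | tracecase_ite {L M₁ M₂ ML MI MF MC ME MP : Term} :
      Step (.tracecase (.ite L M₁ M₂) ML MI MF MC ME MP)
        (.ite L (.tracecase M₁ ML MI MF MC ME MP) (.tracecase M₂ ML MI MF MC ME MP))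
  -- congruence rules
  | lam {A : Ty} {M M' : Term} : Step M M' → Step (.lam A M) (.lam A M')
  | app_fun {M M' N : Term} : Step M M' → Step (.app M N) (.app M' N)
  | app_arg {M N N' : Term} : Step N N' → Step (.app M N) (.app M N')
  | tlam {K : Kind} {M M' : Term} : Step M M' → Step (.tlam K M) (.tlam K M')
  | tapp_fun {M M' : Term} {C : Con} : Step M M' → Step (.tapp M C) (.tapp M' C)
  | tapp_arg {M : Term} {C C' : Con} : ConStep C C' → Step (.tapp M C) (.tapp M C')
  | ite_cond {L L' M N : Term} : Step L L' → Step (.ite L M N) (.ite L' M N)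
  | ite_then {L M M' N : Term} : Step M M' → Step (.ite L M N) (.ite L M' N)
  | ite_else {L M N N' : Term} : Step N N' → Step (.ite L M N) (.ite L M N')
  | rcons_head {l : Label} {M M' N : Term} : Step M M' → Step (.rcons l M N) (.rcons l M' N)
  | rcons_tail {l : Label} {M N N' : Term} : Step N N' → Step (.rcons l M N) (.rcons l M N')
  | proj {M M' : Term} {l : Label} : Step M M' → Step (.proj M l) (.proj M' l)
  | rmap_row {S S' : Con} {M N : Term} : ConStep S S' → Step (.rmap S M N) (.rmap S' M N)
  | rmap_fun {S : Con} {M M' N : Term} : Step M M' → Step (.rmap S M N) (.rmap S M' N)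
  | rmap_arg {S : Con} {M N N' : Term} : Step N N' → Step (.rmap S M N) (.rmap S M N')
  | rfold_row {S S' : Con} {L M N : Term} :
      ConStep S S' → Step (.rfold S L M N) (.rfold S' L M N)
  | rfold_fun {S : Con} {L L' M N : Term} : Step L L' → Step (.rfold S L M N) (.rfold S L' M N)
  | rfold_init {S : Con} {L M M' N : Term} : Step M M' → Step (.rfold S L M N) (.rfold S L M' N)
  | rfold_arg {S : Con} {L M N N' : Term} : Step N N' → Step (.rfold S L M N) (.rfold S L M N')
  | single {M M' : Term} : Step M M' → Step (.single M) (.single M')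
  | append_left {M M' N : Term} : Step M M' → Step (.append M N) (.append M' N)
  | append_right {M N N' : Term} : Step N N' → Step (.append M N) (.append M N')
  | eq_left {M M' N : Term} : Step M M' → Step (.eq M N) (.eq M' N)
  | eq_right {M N N' : Term} : Step N N' → Step (.eq M N) (.eq M N')
  | plus_left {M M' N : Term} : Step M M' → Step (.plus M N) (.plus M' N)
  | plus_right {M N N' : Term} : Step N N' → Step (.plus M N) (.plus M N')
  | comp_src {M M' N : Term} : Step M M' → Step (.comp M N) (.comp M' N)
  | comp_body {M N N' : Term} : Step N N' → Step (.comp M N) (.comp M N')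
  | trLit {M M' : Term} : Step M M' → Step (.trLit M) (.trLit M')
  | trIf {M M' : Term} : Step M M' → Step (.trIf M) (.trIf M')
  | trFor_con {C C' : Con} {M : Term} : ConStep C C' → Step (.trFor C M) (.trFor C' M)
  | trFor {C : Con} {M M' : Term} : Step M M' → Step (.trFor C M) (.trFor C M')
  | trCell {M M' : Term} : Step M M' → Step (.trCell M) (.trCell M')
  | trOpEq_con {C C' : Con} {M : Term} : ConStep C C' → Step (.trOpEq C M) (.trOpEq C' M)
  | trOpEq {C : Con} {M M' : Term} : Step M M' → Step (.trOpEq C M) (.trOpEq C M')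
  | trOpPlus {M M' : Term} : Step M M' → Step (.trOpPlus M) (.trOpPlus M')
  | tracecase_scrut {M M' ML MI MF MC ME MP : Term} : Step M M' →
      Step (.tracecase M ML MI MF MC ME MP) (.tracecase M' ML MI MF MC ME MP)
  | tracecase_L {M ML ML' MI MF MC ME MP : Term} : Step ML ML' →
      Step (.tracecase M ML MI MF MC ME MP) (.tracecase M ML' MI MF MC ME MP)
  | tracecase_I {M ML MI MI' MF MC ME MP : Term} : Step MI MI' →
      Step (.tracecase M ML MI MF MC ME MP) (.tracecase M ML MI' MF MC ME MP)
  | tracecase_F {M ML MI MF MF' MC ME MP : Term} : Step MF MF' →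
      Step (.tracecase M ML MI MF MC ME MP) (.tracecase M ML MI MF' MC ME MP)
  | tracecase_C {M ML MI MF MC MC' ME MP : Term} : Step MC MC' →
      Step (.tracecase M ML MI MF MC ME MP) (.tracecase M ML MI MF MC' ME MP)
  | tracecase_E {M ML MI MF MC ME ME' MP : Term} : Step ME ME' →
      Step (.tracecase M ML MI MF MC ME MP) (.tracecase M ML MI MF MC ME' MP)
  | tracecase_P {M ML MI MF MC ME MP MP' : Term} : Step MP MP' →
      Step (.tracecase M ML MI MF MC ME MP) (.tracecase M ML MI MF MC ME MP')
  | typecase_scrut {C C' : Con} {MB MI MS ML MR MT : Term} : ConStep C C' →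
      Step (.typecase C MB MI MS ML MR MT) (.typecase C' MB MI MS ML MR MT)
  | typecase_B {C : Con} {MB MB' MI MS ML MR MT : Term} : Step MB MB' →
      Step (.typecase C MB MI MS ML MR MT) (.typecase C MB' MI MS ML MR MT)
  | typecase_I {C : Con} {MB MI MI' MS ML MR MT : Term} : Step MI MI' →
      Step (.typecase C MB MI MS ML MR MT) (.typecase C MB MI' MS ML MR MT)
  | typecase_S {C : Con} {MB MI MS MS' ML MR MT : Term} : Step MS MS' →
      Step (.typecase C MB MI MS ML MR MT) (.typecase C MB MI MS' ML MR MT)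
  | typecase_L {C : Con} {MB MI MS ML ML' MR MT : Term} : Step ML ML' →
      Step (.typecase C MB MI MS ML MR MT) (.typecase C MB MI MS ML' MR MT)
  | typecase_R {C : Con} {MB MI MS ML MR MR' MT : Term} : Step MR MR' →
      Step (.typecase C MB MI MS ML MR MT) (.typecase C MB MI MS ML MR' MT)
  | typecase_T {C : Con} {MB MI MS ML MR MT MT' : Term} : Step MT MT' →
      Step (.typecase C MB MI MS ML MR MT) (.typecase C MB MI MS ML MR MT')

end LinksT

/-!
Reduction contracts a former of terms against the matching eliminator, and the premises of the two
typing rules have to be brought together across an equivalence of their types. This calls for the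
injectivity of the type formers, for instance that `TyEq Γ (.fn A B) (.fn A' B') .type` implies
`TyEq Γ A A' .type` and `TyEq Γ B B' .type`. Injectivity cannot be read off a derivation: `T` of
a constructor is itself equal to a type built by a former, transitivity passes through arbitrary
constructors, and rows are equal only up to the order of their fields.

So equivalence is interpreted by a Kripke logical relation on constructors. At the kinds of types,
two related constructors have weak head normal forms with the same head and related arguments. At
the kinds of rows, the partial functions from labels to fields that the two rows evaluate to are
related pointwise, which makes exchanging two fields with different labels invisible. At arrow
kinds, related arguments have related results under every renaming into another context. Since
equivalent constructors are related, equivalent types have the same head and equal arguments, and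
equivalent row types have equal fields at every label. Along with stability of typing under
substitution this makes each reduction rule preserve types.
-/

namespace LinksT

/-! ### Substitution in constructors and types -/

section Substitution

variable (A : Ty) (C D E : Con) (ξ ξ' : ℕ → ℕ) (σ σ' : ℕ → Con)

theorem upCon_var_comp : upCon (Con.var ∘ ξ) = Con.var ∘ upRen ξ := by
  funext n; cases n <;> rfl

theorem upCon_var : upCon Con.var = Con.var := by
  funext n; cases n <;> rfl

theorem upCon_comp_upRen : upCon σ ∘ upRen ξ = upCon (σ ∘ ξ) := by
  funext n; cases n <;> rfl

theorem Con.rename_eq_subst : C.rename ξ = C.subst (Con.var ∘ ξ) := by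
  induction C generalizing ξ <;> simp_all [Con.rename, Con.subst, upCon_var_comp]

theorem Con.subst_var : C.subst Con.var = C := by
  induction C <;> simp_all [Con.subst, upCon_var]

theorem Con.rename_subst : (C.rename ξ).subst σ = C.subst (σ ∘ ξ) := by
  induction C generalizing ξ σ <;> simp_all [Con.rename, Con.subst, upCon_comp_upRen]

theorem Con.rename_id : C.rename id = C := by
  rw [Con.rename_eq_subst]; exact C.subst_var

theorem Con.rename_rename : (C.rename ξ).rename ξ' = C.rename (ξ' ∘ ξ) := by
  rw [Con.rename_eq_subst, Con.rename_subst, Con.rename_eq_subst]; rfl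

theorem Con.shift_rename_upRen : C.shift.rename (upRen ξ) = (C.rename ξ).shift := by
  simp only [Con.shift, Con.rename_rename]; rfl

theorem Con.rename_comp_upCon :
    Con.rename (upRen ξ) ∘ upCon σ = upCon (Con.rename ξ ∘ σ) := by
  funext n
  cases n with
  | zero => rfl
  | succ n => exact Con.shift_rename_upRen _ _

theorem Con.subst_rename : (C.subst σ).rename ξ = C.subst (Con.rename ξ ∘ σ) := by
  induction C generalizing ξ σ <;> simp_all [Con.rename, Con.subst, Con.rename_comp_upCon]

theorem Con.shift_subst_upCon : C.shift.subst (upCon σ) = (C.subst σ).shift := by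
  simp only [Con.shift, Con.rename_subst, Con.subst_rename]; rfl

theorem Con.subst_comp_upCon :
    Con.subst (upCon σ') ∘ upCon σ = upCon (Con.subst σ' ∘ σ) := by
  funext n
  cases n with
  | zero => rfl
  | succ n => exact Con.shift_subst_upCon _ _

theorem Con.subst_subst : (C.subst σ).subst σ' = C.subst (Con.subst σ' ∘ σ) := by
  induction C generalizing σ σ' <;> simp_all [Con.subst, Con.subst_comp_upCon]

theorem Con.shift_eq_subst : C.shift = C.subst (Con.var ∘ Nat.succ) :=
  C.rename_eq_subst _

theorem Con.shift_subst_scons : C.shift.subst (scons D σ) = C.subst σ :=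
  C.rename_subst _ _

theorem Con.shift_inst : C.shift.inst D = C := by
  rw [Con.inst, Con.shift_subst_scons, Con.subst_var]

theorem Con.subst_comp_scons_var :
    Con.subst σ ∘ scons D Con.var = scons (D.subst σ) σ := by
  funext n; cases n <;> rfl

theorem Con.subst_scons_comp_upCon :
    Con.subst (scons D σ') ∘ upCon σ = scons D (Con.subst σ' ∘ σ) := by
  funext n
  cases n with
  | zero => rfl
  | succ n => exact Con.shift_subst_scons _ _ _

theorem Con.subst_var_comp : Con.subst Con.var ∘ σ = σ :=
  funext fun n => (σ n).subst_var

theorem Con.subst_upCon_inst : (C.subst (upCon σ)).inst D = C.subst (scons D σ) := by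
  rw [Con.inst, Con.subst_subst, Con.subst_scons_comp_upCon, Con.subst_var_comp]

theorem Con.inst_subst : (C.inst D).subst σ = (C.subst (upCon σ)).inst (D.subst σ) := by
  rw [Con.subst_upCon_inst, Con.inst, Con.subst_subst, Con.subst_comp_scons_var]

theorem Ty.rename_eq_subst : A.rename ξ = A.subst (Con.var ∘ ξ) := by
  induction A generalizing ξ <;>
    simp_all [Ty.rename, Ty.subst, upCon_var_comp, Con.rename_eq_subst]

theorem Ty.subst_var : A.subst Con.var = A := by
  induction A <;> simp_all [Ty.subst, upCon_var, Con.subst_var]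

theorem Ty.rename_id : A.rename id = A := by
  rw [Ty.rename_eq_subst]; exact A.subst_var

theorem Ty.subst_subst : (A.subst σ).subst σ' = A.subst (Con.subst σ' ∘ σ) := by
  induction A generalizing σ σ' <;>
    simp_all [Ty.subst, Con.subst_comp_upCon, Con.subst_subst]

theorem Ty.rename_subst : (A.rename ξ).subst σ = A.subst (σ ∘ ξ) := by
  rw [Ty.rename_eq_subst, Ty.subst_subst]; rfl

theorem Ty.shift_eq_subst : A.shift = A.subst (Con.var ∘ Nat.succ) :=
  A.rename_eq_subst _

theorem Ty.shift_subst_scons : A.shift.subst (scons D σ) = A.subst σ :=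
  A.rename_subst _ _

theorem Ty.shift_inst : A.shift.inst D = A := by
  rw [Ty.inst, Ty.shift_subst_scons, Ty.subst_var]

theorem Ty.shift_subst_upCon : A.shift.subst (upCon σ) = (A.subst σ).shift := by
  simp only [Ty.shift_eq_subst, Ty.subst_subst]
  congr 1
  funext n
  exact Con.shift_eq_subst _

theorem Ty.inst_subst : (A.inst D).subst σ = (A.subst (upCon σ)).inst (D.subst σ) := by
  simp only [Ty.inst, Ty.subst_subst, Con.subst_comp_scons_var, Con.subst_scons_comp_upCon,
    Con.subst_var_comp]

theorem Ty.instUnder_subst : (A.instUnder D).subst (upCon σ) =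
    (A.subst (upCon σ)).instUnder (D.subst (upCon σ)) := by
  simp only [Ty.instUnder, Ty.subst_subst]
  congr 1
  funext n
  cases n with
  | zero => rfl
  | succ n => exact (Con.shift_eq_subst _).trans (Con.shift_subst_scons _ _ _).symm

theorem Ty.instUnder_inst : (A.instUnder D).inst E = A.inst (D.inst E) := by
  simp only [Ty.instUnder, Ty.inst, Ty.subst_subst]
  congr 1
  funext n
  cases n <;> rfl

end Substitution

/-! ### Kinding of constructors -/

section Kinding

variable {Γ Γ' Γ'' : Ctx} {A : Ty} {C D : Con} {K K' K'' : Kind} {ξ ξ' : ℕ → ℕ} {σ : ℕ → Con}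

theorem ConKind.wf {Γ C K} : ConKind Γ C K → WfCtx Γ
  | .bool w | .int w | .string w | .var w _ | .rnil _ w => w
  | .lam h => by cases h.wf; assumption
  | .app h _ | .list h | .record h | .trace h | .typerec _ h _ _ _ _ _ _ | .rcons _ h _
  | .rmap h _ | .sub h _ => h.wf

theorem TyKind.wf {Γ A K} : TyKind Γ A K → WfCtx Γ
  | .bool w | .int w | .string w | .rnil _ w => w
  | .T _ h => h.wf
  | .all h => by cases h.wf; assumption
  | .fn h _ | .list h | .record h | .trace h | .rcons _ h _ | .sub h _ => h.wf

theorem WfCtx.of_var (h : WfCtx (.var Γ A)) : TyKind Γ A .type := by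
  cases h; assumption

/-- Type variables of `Γ` are renamed by `ξ` to type variables of `Γ'` of the same kind. -/
structure Ren (Γ Γ' : Ctx) (ξ : ℕ → ℕ) : Prop where
  wf : WfCtx Γ'
  tvar : ∀ {n K}, Γ.TVarAt n K → Γ'.TVarAt (ξ n) K

theorem Ren.up (h : Ren Γ Γ' ξ) : Ren (.tvar Γ K) (.tvar Γ' K) (upRen ξ) where
  wf := .tvar h.wf
  tvar
    | .here => .here
    | .tvar hn => .tvar (h.tvar hn)

theorem Ren.id (h : WfCtx Γ) : Ren Γ Γ id := ⟨h, fun h => h⟩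

theorem Ren.comp (h : Ren Γ Γ' ξ) (h' : Ren Γ' Γ'' ξ') : Ren Γ Γ'' (ξ' ∘ ξ) :=
  ⟨h'.wf, fun hn => h'.tvar (h.tvar hn)⟩

theorem Ren.succ (h : WfCtx Γ) : Ren Γ (.tvar Γ K) Nat.succ := ⟨.tvar h, .tvar⟩

theorem Ren.addVar (h : WfCtx (.var Γ A)) : Ren Γ (.var Γ A) _root_.id := ⟨h, .var⟩

theorem Ren.dropVar (h : WfCtx (.var Γ A)) : Ren (.var Γ A) Γ _root_.id :=
  ⟨h.of_var.wf, fun | .var hn => hn⟩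

theorem ConKind.rename {Γ C K} : ConKind Γ C K →
    ∀ {Γ' ξ}, Ren Γ Γ' ξ → ConKind Γ' (C.rename ξ) K
  | .bool _, _, _, hξ => .bool hξ.wf
  | .int _, _, _, hξ => .int hξ.wf
  | .string _, _, _, hξ => .string hξ.wf
  | .var _ h, _, _, hξ => .var hξ.wf (hξ.tvar h)
  | .lam h, _, _, hξ => .lam (h.rename hξ.up)
  | .app h h', _, _, hξ => .app (h.rename hξ) (h'.rename hξ)
  | .list h, _, _, hξ => .list (h.rename hξ)
  | .record h, _, _, hξ => .record (h.rename hξ)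
  | .trace h, _, _, hξ => .trace (h.rename hξ)
  | .typerec hK h hB hI hS hL hR hT, _, _, hξ =>
      .typerec hK (h.rename hξ) (hB.rename hξ) (hI.rename hξ) (hS.rename hξ) (hL.rename hξ)
        (hR.rename hξ) (hT.rename hξ)
  | .rnil r _, _, _, hξ => .rnil r hξ.wf
  | .rcons r h h', _, _, hξ => .rcons r (h.rename hξ) (h'.rename hξ)
  | .rmap h h', _, _, hξ => .rmap (h.rename hξ) (h'.rename hξ)
  | .sub h s, _, _, hξ => .sub (h.rename hξ) s

theorem ConKind.shift (h : ConKind Γ C K) : ConKind (.tvar Γ K') C.shift K :=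
  h.rename (.succ h.wf)

/-- `σ` maps the type variables of `Γ` to constructors of the same kind over `Γ'`. -/
structure ConSub (Γ Γ' : Ctx) (σ : ℕ → Con) : Prop where
  wf : WfCtx Γ'
  tvar : ∀ {n K}, Γ.TVarAt n K → ConKind Γ' (σ n) K

theorem ConSub.up (h : ConSub Γ Γ' σ) : ConSub (.tvar Γ K) (.tvar Γ' K) (upCon σ) where
  wf := .tvar h.wf
  tvar
    | .here => .var (.tvar h.wf) .here
    | .tvar hn => (h.tvar hn).shift

theorem ConSub.scons (h : ConSub Γ Γ' σ) (hD : ConKind Γ' D K) :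
    ConSub (.tvar Γ K) Γ' (LinksT.scons D σ) where
  wf := h.wf
  tvar
    | .here => hD
    | .tvar hn => h.tvar hn

theorem Ren.conSub (h : Ren Γ Γ' ξ) : ConSub Γ Γ' (Con.var ∘ ξ) :=
  ⟨h.wf, fun hn => .var h.wf (h.tvar hn)⟩

theorem ConSub.id (h : WfCtx Γ) : ConSub Γ Γ Con.var := (Ren.id h).conSub

theorem ConKind.subst {Γ C K} : ConKind Γ C K →
    ∀ {Γ' σ}, ConSub Γ Γ' σ → ConKind Γ' (C.subst σ) K
  | .bool _, _, _, hσ => .bool hσ.wf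
  | .int _, _, _, hσ => .int hσ.wf
  | .string _, _, _, hσ => .string hσ.wf
  | .var _ h, _, _, hσ => hσ.tvar h
  | .lam h, _, _, hσ => .lam (h.subst hσ.up)
  | .app h h', _, _, hσ => .app (h.subst hσ) (h'.subst hσ)
  | .list h, _, _, hσ => .list (h.subst hσ)
  | .record h, _, _, hσ => .record (h.subst hσ)
  | .trace h, _, _, hσ => .trace (h.subst hσ)
  | .typerec hK h hB hI hS hL hR hT, _, _, hσ =>
      .typerec hK (h.subst hσ) (hB.subst hσ) (hI.subst hσ) (hS.subst hσ) (hL.subst hσ)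
        (hR.subst hσ) (hT.subst hσ)
  | .rnil r _, _, _, hσ => .rnil r hσ.wf
  | .rcons r h h', _, _, hσ => .rcons r (h.subst hσ) (h'.subst hσ)
  | .rmap h h', _, _, hσ => .rmap (h.subst hσ) (h'.subst hσ)
  | .sub h s, _, _, hσ => .sub (h.subst hσ) s

theorem ConKind.inst (h : ConKind (.tvar Γ K') C K) (hD : ConKind Γ D K') :
    ConKind Γ (C.inst D) K :=
  h.subst ((ConSub.id hD.wf).scons hD)

/-- The reflexive closure of subkinding. It is transitive, since no chain of subkindings has more
than one step. -/
abbrev KindLe : Kind → Kind → Prop := Relation.ReflGen SubKind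

theorem KindLe.trans_sub (h : KindLe K K') (s : SubKind K' K'') : KindLe K K'' := by
  cases h with
  | refl => exact .single s
  | single h => cases h <;> cases s

theorem ConKind.le (h : ConKind Γ C K) (le : KindLe K K') : ConKind Γ C K' := by
  cases le with
  | refl => exact h
  | single s => exact .sub h s

theorem ConEq.le (h : ConEq Γ C D K) (le : KindLe K K') : ConEq Γ C D K' := by
  cases le with
  | refl => exact h
  | single s => exact .sub h s

theorem TypeLike.le : TypeLike K → KindLe K .type
  | .type => .refl
  | .baseType => .single .base

theorem RowOf.field_le : RowOf K K' → KindLe K .type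
  | .row => .refl
  | .baseRow => .single .base

theorem RowOf.row_le : RowOf K K' → KindLe K' .row
  | .row => .refl
  | .baseRow => .single .baseRow

/-- The premises of the kinding rule for the head former of a constructor, when the rule yields the
given kind. -/
def ConKind.Premises (Γ : Ctx) : Con → Kind → Prop
  | .bool, K | .int, K | .string, K => K = .baseType
  | .var n, K => Γ.TVarAt n K
  | .lam K₁ C, K => ∃ K₂, K = .arrow K₁ K₂ ∧ ConKind (.tvar Γ K₁) C K₂
  | .app C D, K => ∃ K', ConKind Γ C (.arrow K' K) ∧ ConKind Γ D K'
  | .list C, K => K = .type ∧ ConKind Γ C .type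
  | .record S, K => K = .type ∧ ConKind Γ S .row
  | .trace C, K => K = .type ∧ ConKind Γ C .baseType
  | .typerec C CB CI CS CL CR CT, K =>
      TypeLike K ∧ ConKind Γ C .type ∧ ConKind Γ CB K ∧ ConKind Γ CI K ∧ ConKind Γ CS K ∧
        ConKind Γ CL (.arrow .type (.arrow K K)) ∧ ConKind Γ CR (.arrow .row (.arrow .row K)) ∧
        ConKind Γ CT (.arrow .baseType (.arrow K K))
  | .rnil, K => ∃ κ, RowOf κ K
  | .rcons _ C S, K => ∃ κ, RowOf κ K ∧ ConKind Γ C κ ∧ ConKind Γ S K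
  | .rmap C S, K => K = .row ∧ ConKind Γ C (.arrow .type .type) ∧ ConKind Γ S .row

theorem ConKind.generation {Γ C K} : ConKind Γ C K → ∃ K₀, KindLe K₀ K ∧ Premises Γ C K₀
  | .bool _ | .int _ | .string _ => ⟨_, .refl, rfl⟩
  | .var _ h => ⟨_, .refl, h⟩
  | .lam h => ⟨_, .refl, _, rfl, h⟩
  | .app h h' => ⟨_, .refl, _, h, h'⟩
  | .list h | .record h | .trace h => ⟨_, .refl, rfl, h⟩
  | .typerec hK h hB hI hS hL hR hT => ⟨_, .refl, hK, h, hB, hI, hS, hL, hR, hT⟩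
  | .rnil r _ => ⟨_, .refl, _, r⟩
  | .rcons r h h' => ⟨_, .refl, _, r, h, h'⟩
  | .rmap h h' => ⟨_, .refl, rfl, h, h'⟩
  | .sub h s => let ⟨_, le, p⟩ := h.generation; ⟨_, le.trans_sub s, p⟩

end Kinding

/-! ### Equivalence of constructors under renaming -/

section

variable {Γ Γ' : Ctx} {C D : Con} {K K' : Kind} {ξ : ℕ → ℕ}

theorem ConEq.regular (h : ConEq Γ C D K) : ConKind Γ C K ∧ ConKind Γ D K := by
  induction h with
  | refl h => exact ⟨h, h⟩
  | symm _ ih => exact ih.symm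
  | trans _ _ ih ih' => exact ⟨ih.1, ih'.2⟩
  | sub _ s ih => exact ⟨.sub ih.1 s, .sub ih.2 s⟩
  | eta h => exact ⟨.lam (.app h.shift (.var (.tvar h.wf) .here)), h⟩
  | lam _ ih => exact ⟨.lam ih.1, .lam ih.2⟩
  | app _ _ ih ih' => exact ⟨.app ih.1 ih'.1, .app ih.2 ih'.2⟩
  | list _ ih => exact ⟨.list ih.1, .list ih.2⟩
  | record _ ih => exact ⟨.record ih.1, .record ih.2⟩
  | trace _ ih => exact ⟨.trace ih.1, .trace ih.2⟩
  | step h h' _ => exact ⟨h, h'⟩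
  | rnil r w => exact ⟨.rnil r w, .rnil r w⟩
  | rcons r _ _ ih ih' => exact ⟨.rcons r ih.1 ih'.1, .rcons r ih.2 ih'.2⟩
  | swap r _ h h' hS => exact ⟨.rcons r h (.rcons r h' hS), .rcons r h' (.rcons r h hS)⟩
  | rmap _ _ ih ih' => exact ⟨.rmap ih.1 ih'.1, .rmap ih.2 ih'.2⟩
  | typerec t _ _ _ _ _ _ _ h hB hI hS hL hR hT =>
    exact ⟨.typerec t h.1 hB.1 hI.1 hS.1 hL.1 hR.1 hT.1,
      .typerec t h.2 hB.2 hI.2 hS.2 hL.2 hR.2 hT.2⟩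

theorem ConEq.wf (h : ConEq Γ C D K) : WfCtx Γ := h.regular.1.wf

theorem ConStep.subst (h : ConStep C D) (σ : ℕ → Con) : ConStep (C.subst σ) (D.subst σ) := by
  induction h generalizing σ with
  | beta => rw [Con.inst_subst]; exact .beta
  | typerec_record => simp only [Con.subst, Con.shift_subst_upCon]; exact .typerec_record
  | lam _ ih => exact .lam (ih _)
  | _ => simp only [Con.subst]; constructor <;> apply_assumption

theorem ConStep.rename (h : ConStep C D) (ξ : ℕ → ℕ) : ConStep (C.rename ξ) (D.rename ξ) := by
  simp only [Con.rename_eq_subst]; exact h.subst _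

theorem ConEq.rename (h : ConEq Γ C D K) (hξ : Ren Γ Γ' ξ) :
    ConEq Γ' (C.rename ξ) (D.rename ξ) K := by
  induction h generalizing Γ' ξ with
  | refl h => exact .refl (h.rename hξ)
  | symm _ ih => exact .symm (ih hξ)
  | trans _ _ ih ih' => exact .trans (ih hξ) (ih' hξ)
  | sub _ s ih => exact .sub (ih hξ) s
  | eta h =>
    simp only [Con.rename, Con.shift_rename_upRen]
    exact .eta (h.rename hξ)
  | lam _ ih => exact .lam (ih hξ.up)
  | app _ _ ih ih' => exact .app (ih hξ) (ih' hξ)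
  | list _ ih => exact .list (ih hξ)
  | record _ ih => exact .record (ih hξ)
  | trace _ ih => exact .trace (ih hξ)
  | step h h' s => exact .step (h.rename hξ) (h'.rename hξ) (s.rename ξ)
  | rnil r _ => exact .rnil r hξ.wf
  | rcons r _ _ ih ih' => exact .rcons r (ih hξ) (ih' hξ)
  | swap r n h h' hS => exact .swap r n (h.rename hξ) (h'.rename hξ) (hS.rename hξ)
  | rmap _ _ ih ih' => exact .rmap (ih hξ) (ih' hξ)
  | typerec t _ _ _ _ _ _ _ h hB hI hS hL hR hT =>
    exact .typerec t (h hξ) (hB hξ) (hI hξ) (hS hξ) (hL hξ) (hR hξ) (hT hξ)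

theorem ConEq.shift (h : ConEq Γ C D K) : ConEq (.tvar Γ K') C.shift D.shift K :=
  h.rename (.succ h.wf)

end

/-! ### Weak head reduction of constructors -/

/-- Weak head reduction: constructor computation at the head position only. -/
inductive Whr : Con → Con → Prop
  | app {C C' D : Con} : Whr C C' → Whr (.app C D) (.app C' D)
  | beta {K : Kind} {C D : Con} : Whr (.app (.lam K C) D) (C.inst D)
  | rmap {C S S' : Con} : Whr S S' → Whr (.rmap C S) (.rmap C S')
  | rmap_rnil {C : Con} : Whr (.rmap C .rnil) .rnil
  | rmap_rcons {C D S : Con} {l : Label} :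
      Whr (.rmap C (.rcons l D S)) (.rcons l (.app C D) (.rmap C S))
  | typerec {C C' CB CI CS CL CR CT : Con} : Whr C C' →
      Whr (.typerec C CB CI CS CL CR CT) (.typerec C' CB CI CS CL CR CT)
  | typerec_bool {CB CI CS CL CR CT : Con} : Whr (.typerec .bool CB CI CS CL CR CT) CB
  | typerec_int {CB CI CS CL CR CT : Con} : Whr (.typerec .int CB CI CS CL CR CT) CI
  | typerec_string {CB CI CS CL CR CT : Con} : Whr (.typerec .string CB CI CS CL CR CT) CS
  | typerec_list {D CB CI CS CL CR CT : Con} :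
      Whr (.typerec (.list D) CB CI CS CL CR CT)
        (.app (.app CL D) (.typerec D CB CI CS CL CR CT))
  | typerec_record {S CB CI CS CL CR CT : Con} :
      Whr (.typerec (.record S) CB CI CS CL CR CT)
        (.app (.app CR S)
          (.rmap (.lam .type (.typerec (.var 0) CB.shift CI.shift CS.shift CL.shift
            CR.shift CT.shift)) S))
  | typerec_trace {D CB CI CS CL CR CT : Con} :
      Whr (.typerec (.trace D) CB CI CS CL CR CT)
        (.app (.app CT D) (.typerec D CB CI CS CL CR CT))

/-- Weak head reduction in any number of steps. -/
abbrev Whrs : Con → Con → Prop := Relation.ReflTransGen Whr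

/-- Constructors whose computation is blocked by a variable in head position. -/
inductive Neutral : Con → Prop
  | var {n : ℕ} : Neutral (.var n)
  | app {C D : Con} : Neutral C → Neutral (.app C D)
  | rmap {C S : Con} : Neutral S → Neutral (.rmap C S)
  | typerec {C CB CI CS CL CR CT : Con} : Neutral C → Neutral (.typerec C CB CI CS CL CR CT)

section

variable {Γ : Ctx} {C D D' : Con} {K : Kind}

theorem Whr.conStep (h : Whr C D) : ConStep C D := by
  induction h <;> constructor <;> assumption

theorem Whr.conEq (w : Whr C D) (h : ConKind Γ C K) (h' : ConKind Γ D K) : ConEq Γ C D K :=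
  .step h h' w.conStep

theorem Whr.subst (h : Whr C D) (σ : ℕ → Con) : Whr (C.subst σ) (D.subst σ) := by
  induction h with
  | beta => rw [Con.inst_subst]; exact .beta
  | typerec_record =>
    simp only [Con.subst, Con.shift_subst_upCon]; exact .typerec_record
  | _ => simp only [Con.subst]; constructor <;> assumption

theorem Whr.rename (h : Whr C D) (ξ : ℕ → ℕ) : Whr (C.rename ξ) (D.rename ξ) := by
  simp only [Con.rename_eq_subst]; exact h.subst _

theorem Neutral.rename (h : Neutral C) (ξ : ℕ → ℕ) : Neutral (C.rename ξ) := by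
  induction h <;> constructor <;> assumption

theorem Neutral.not_whr (h : Neutral C) : ¬ Whr C D := by
  intro w
  induction h generalizing D with
  | var => cases w
  | app h ih => cases w with
    | app w => exact ih w
    | beta => cases h
  | rmap h ih => cases w with
    | rmap w => exact ih w
    | _ => cases h
  | typerec h ih => cases w with
    | typerec w => exact ih w
    | _ => cases h

theorem Whr.deterministic (h : Whr C D) (h' : Whr C D') : D = D' := by
  induction h generalizing D' with
  | app h ih => cases h' with
    | app h' => rw [ih h']
    | beta => cases h
  | rmap h ih => cases h' with
    | rmap h' => rw [ih h']
    | _ => cases h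
  | typerec h ih => cases h' with
    | typerec h' => rw [ih h']
    | _ => cases h
  | _ => cases h' <;> first | rfl | (rename_i w; cases w)

theorem Whrs.deterministic (h : Whrs C D) (h' : Whrs C D') (hD : ∀ E, ¬ Whr D E)
    (hD' : ∀ E, ¬ Whr D' E) : D = D' := by
  have normal_eq {V W : Con} (hV : ∀ E, ¬ Whr V E) (r : Whrs V W) : V = W :=
    (Relation.reflTransGen_iff_eq hV).mp r |>.symm
  have unique : Relator.RightUnique Whr := fun _ _ _ => Whr.deterministic
  obtain r | r := Relation.ReflTransGen.total_of_right_unique unique h h'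
  · exact normal_eq hD r
  · exact (normal_eq hD' r).symm

end

/-! ### Field maps of row constructors -/

open Classical in
/-- `RowView S f`: the row constructor `S` evaluates to fields followed by `·` or a neutral row;
`f` assigns to each label its first field. -/
inductive RowView : Con → (Label → Option Con) → Prop
  | rnil : RowView .rnil (fun _ => none)
  | ne {S : Con} : Neutral S → RowView S (fun _ => none)
  | rcons {l : Label} {C S : Con} {f : Label → Option Con} : RowView S f →
      RowView (.rcons l C S) (Function.update f l (some C))
  | whr {S S' : Con} {f : Label → Option Con} : Whr S S' → RowView S' f → RowView S f

section

variable {S : Con} {f g : Label → Option Con}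

theorem RowView.deterministic (h : RowView S f) (h' : RowView S g) : f = g := by
  induction h generalizing g with
  | rnil => cases h' with
    | whr w => cases w
    | _ => rfl
  | ne n => cases h' with
    | whr w => exact (n.not_whr w).elim
    | rcons => cases n
    | _ => rfl
  | rcons _ ih => cases h' with
    | rcons h' => rw [ih h']
    | ne n => cases n
    | whr w => cases w
  | whr w _ ih => cases h' with
    | whr w' h' => cases w.deterministic w'; exact ih h'
    | ne n => exact (n.not_whr w).elim
    | _ => cases w

open Classical in
theorem update_rel {ι X Y : Type*} {r : X → Y → Prop} {f : ι → X} {g : ι → Y} {c : X} {d : Y}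
    (h : ∀ i, r (f i) (g i)) (hcd : r c d) (i j : ι) :
    r (Function.update f i c j) (Function.update g i d j) := by
  by_cases e : j = i
  · subst e; simpa only [Function.update_self] using hcd
  · simpa only [Function.update_of_ne e] using h j

theorem RowView.rename (h : RowView S f) (ξ : ℕ → ℕ) :
    RowView (S.rename ξ) (Option.map (Con.rename ξ) ∘ f) := by
  induction h with
  | rnil => exact .rnil
  | ne n => exact .ne (n.rename ξ)
  | rcons _ ih => rw [@Function.comp_update]; exact .rcons ih
  | whr w _ ih => exact .whr (w.rename ξ) ih

theorem RowView.rmap (h : RowView S f) (F : Con) :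
    RowView (.rmap F S) (Option.map (Con.app F) ∘ f) := by
  induction h with
  | rnil => exact .whr .rmap_rnil .rnil
  | ne n => exact .ne (.rmap n)
  | rcons _ ih => rw [@Function.comp_update]; exact .whr .rmap_rcons (.rcons ih)
  | whr w _ ih => exact .whr (.rmap w) ih

end

/-! ### The logical relation at the kinds of types and rows -/

mutual

/-- The logical relation for types: both sides evaluate to related weak head normal forms. -/
inductive TypeRel (Γ : Ctx) : Con → Con → Prop
  | mk {C D V W : Con} : Whrs C V → Whrs D W → ValueRel Γ V W → TypeRel Γ C D

/-- The logical relation for weak head normal forms: the same head constructor with related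
arguments, or two neutral constructors. -/
inductive ValueRel (Γ : Ctx) : Con → Con → Prop
  | bool : ValueRel Γ .bool .bool
  | int : ValueRel Γ .int .int
  | string : ValueRel Γ .string .string
  | list {C D : Con} : ConEq Γ C D .type → TypeRel Γ C D → ValueRel Γ (.list C) (.list D)
  | trace {C D : Con} : ConEq Γ C D .baseType → TypeRel Γ C D → ValueRel Γ (.trace C) (.trace D)
  | record {S S' : Con} : ConEq Γ S S' .row → RowRel Γ S S' → ValueRel Γ (.record S) (.record S')
  | ne {C D : Con} : Neutral C → Neutral D → ConEq Γ C D .type → ValueRel Γ C D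

/-- The logical relation for rows. It compares field maps, so it ignores the order of fields with
different labels. -/
inductive RowRel (Γ : Ctx) : Con → Con → Prop
  | mk {S S' : Con} {f g : Label → Option Con} : RowView S f → RowView S' g →
      (∀ l, FieldRel Γ (f l) (g l)) → RowRel Γ S S'

/-- The logical relation for the values of the field maps of two rows at a label. -/
inductive FieldRel (Γ : Ctx) : Option Con → Option Con → Prop
  | none : FieldRel Γ none none
  | some {C D : Con} : ConEq Γ C D .type → TypeRel Γ C D → FieldRel Γ (some C) (some D)

end

section

variable {Γ Γ' : Ctx} {ξ : ℕ → ℕ}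

mutual

theorem TypeRel.symm {C D : Con} : TypeRel Γ C D → TypeRel Γ D C
  | .mk v w r => .mk w v r.symm

theorem ValueRel.symm {V W : Con} : ValueRel Γ V W → ValueRel Γ W V
  | .bool => .bool
  | .int => .int
  | .string => .string
  | .list e r => .list e.symm r.symm
  | .trace e r => .trace e.symm r.symm
  | .record e r => .record e.symm r.symm
  | .ne n n' e => .ne n' n e.symm

theorem RowRel.symm {S S' : Con} : RowRel Γ S S' → RowRel Γ S' S
  | .mk v w r => .mk w v fun l => (r l).symm

theorem FieldRel.symm {c d : Option Con} : FieldRel Γ c d → FieldRel Γ d c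
  | .none => .none
  | .some e r => .some e.symm r.symm

end

theorem ValueRel.not_whr {V W E : Con} (h : ValueRel Γ V W) : ¬ Whr V E := by
  cases h with
  | ne n => exact n.not_whr
  | _ => intro w; cases w

mutual

theorem TypeRel.trans {C D E : Con} : TypeRel Γ C D → TypeRel Γ D E → TypeRel Γ C E
  | .mk v w r, .mk (V := W') w' u r' => by
    obtain rfl : _ = W' := w.deterministic w' (fun _ => r.symm.not_whr) (fun _ => r'.not_whr)
    exact .mk v u (r.trans r')
termination_by structural h => h

theorem ValueRel.trans {V W U : Con} : ValueRel Γ V W → ValueRel Γ W U → ValueRel Γ V U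
  | .bool, h => h
  | .int, h => h
  | .string, h => h
  | .list e r, .list e' r' => .list (e.trans e') (r.trans r')
  | .trace e r, .trace e' r' => .trace (e.trans e') (r.trans r')
  | .record e r, .record e' r' => .record (e.trans e') (r.trans r')
  | .ne n _ e, .ne _ n' e' => .ne n n' (e.trans e')
termination_by structural h => h

theorem RowRel.trans {S S' S'' : Con} : RowRel Γ S S' → RowRel Γ S' S'' → RowRel Γ S S''
  | .mk (g := g) v w r, .mk (f := f) w' u r' => by
    obtain rfl : g = f := w.deterministic w'
    exact .mk v u fun l => (r l).trans (r' l)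
termination_by structural h => h

theorem FieldRel.trans {c d e : Option Con} : FieldRel Γ c d → FieldRel Γ d e → FieldRel Γ c e
  | .none, .none => .none
  | .some e r, .some e' r' => .some (e.trans e') (r.trans r')
termination_by structural h => h

end

mutual

theorem TypeRel.rename {C D : Con} (hξ : Ren Γ Γ' ξ) :
    TypeRel Γ C D → TypeRel Γ' (C.rename ξ) (D.rename ξ)
  | .mk v w r =>
    .mk (v.lift _ fun _ _ s => s.rename ξ) (w.lift _ fun _ _ s => s.rename ξ) (r.rename hξ)

theorem ValueRel.rename {V W : Con} (hξ : Ren Γ Γ' ξ) :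
    ValueRel Γ V W → ValueRel Γ' (V.rename ξ) (W.rename ξ)
  | .bool => .bool
  | .int => .int
  | .string => .string
  | .list e r => .list (e.rename hξ) (r.rename hξ)
  | .trace e r => .trace (e.rename hξ) (r.rename hξ)
  | .record e r => .record (e.rename hξ) (r.rename hξ)
  | .ne n n' e => .ne (n.rename ξ) (n'.rename ξ) (e.rename hξ)

theorem RowRel.rename {S S' : Con} (hξ : Ren Γ Γ' ξ) :
    RowRel Γ S S' → RowRel Γ' (S.rename ξ) (S'.rename ξ)
  | .mk v w r => .mk (v.rename ξ) (w.rename ξ) fun l => (r l).rename hξ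

theorem FieldRel.rename {c d : Option Con} (hξ : Ren Γ Γ' ξ) :
    FieldRel Γ c d → FieldRel Γ' (c.map (Con.rename ξ)) (d.map (Con.rename ξ))
  | .none => .none
  | .some e r => .some (e.rename hξ) (r.rename hξ)

end

theorem TypeRel.expand {C C' D D' : Con} (v : Whrs C C') (w : Whrs D D') :
    TypeRel Γ C' D' → TypeRel Γ C D
  | .mk v' w' r => .mk (v.trans v') (w.trans w') r

theorem RowRel.expand {S S' T : Con} (w : Whr S S') : RowRel Γ S' T → RowRel Γ S T
  | .mk v v' r => .mk (.whr w v) v' r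

theorem FieldRel.map {u v : Con → Con} {c d : Option Con} (h : FieldRel Γ c d)
    (huv : ∀ {C D}, ConEq Γ C D .type → TypeRel Γ C D →
      ConEq Γ (u C) (v D) .type ∧ TypeRel Γ (u C) (v D)) :
    FieldRel Γ (c.map u) (d.map v) := by
  cases h with
  | none => exact .none
  | some e r => exact .some (huv e r).1 (huv e r).2

end

/-! ### The logical relation at all kinds -/

/-- The Kripke logical relation for constructor equivalence. -/
def LogRel : Kind → Ctx → Con → Con → Prop
  | .type, Γ, C, D => ConEq Γ C D .type ∧ TypeRel Γ C D
  | .baseType, Γ, C, D => ConEq Γ C D .baseType ∧ TypeRel Γ C D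
  | .row, Γ, C, D => ConEq Γ C D .row ∧ RowRel Γ C D
  | .baseRow, Γ, C, D => ConEq Γ C D .baseRow ∧ RowRel Γ C D
  | .arrow K₁ K₂, Γ, C, D => ConEq Γ C D (.arrow K₁ K₂) ∧
      ∀ {Γ' ξ E F}, Ren Γ Γ' ξ → LogRel K₁ Γ' E F →
        LogRel K₂ Γ' (.app (C.rename ξ) E) (.app (D.rename ξ) F)

namespace LogRel

variable {Γ Γ' : Ctx} {K K' K₁ K₂ : Kind} {C C' D D' E S S' : Con} {ξ : ℕ → ℕ} {l l' : Label}

theorem conEq (h : LogRel K Γ C D) : ConEq Γ C D K := by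
  cases K <;> exact h.1

theorem symm (h : LogRel K Γ C D) : LogRel K Γ D C := by
  induction K generalizing Γ C D with
  | arrow K₁ K₂ ih₁ ih₂ => exact ⟨h.1.symm, fun hξ e => ih₂ (h.2 hξ (ih₁ e))⟩
  | _ => exact ⟨h.1.symm, h.2.symm⟩

theorem trans (h : LogRel K Γ C D) (h' : LogRel K Γ D E) : LogRel K Γ C E := by
  induction K generalizing Γ C D E with
  | arrow K₁ K₂ ih₁ ih₂ =>
    exact ⟨h.1.trans h'.1, fun hξ e => ih₂ (h.2 hξ (ih₁ e e.symm)) (h'.2 hξ e)⟩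
  | _ => exact ⟨h.1.trans h'.1, h.2.trans h'.2⟩

theorem rename (h : LogRel K Γ C D) (hξ : Ren Γ Γ' ξ) :
    LogRel K Γ' (C.rename ξ) (D.rename ξ) := by
  cases K with
  | arrow K₁ K₂ =>
    refine ⟨h.1.rename hξ, fun hξ' e => ?_⟩
    rw [Con.rename_rename, Con.rename_rename]
    exact h.2 (hξ.comp hξ') e
  | _ => exact ⟨h.1.rename hξ, h.2.rename hξ⟩

theorem le (h : LogRel K Γ C D) (le : KindLe K K') : LogRel K' Γ C D := by
  cases le with
  | refl => exact h
  | single s => cases s <;> exact ⟨.sub h.1 (by constructor), h.2⟩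

theorem whr_left (w : Whr C C') (hC : ConKind Γ C K) (h : LogRel K Γ C' D) :
    LogRel K Γ C D := by
  have e : ConEq Γ C D K := (w.conEq hC h.conEq.regular.1).trans h.conEq
  induction K generalizing Γ C C' D with
  | type | baseType => exact ⟨e, h.2.expand (.single w) .refl⟩
  | row | baseRow => exact ⟨e, h.2.expand w⟩
  | arrow K₁ K₂ _ ih =>
    refine ⟨e, fun hξ r => ih (w.rename _).app ?_ (h.2 hξ r) ?_⟩
    · exact .app (hC.rename hξ) r.conEq.regular.1
    · exact .app (e.rename hξ) r.conEq

theorem whr_right (w : Whr D D') (hD : ConKind Γ D K) (h : LogRel K Γ C D') : LogRel K Γ C D :=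
  (h.symm.whr_left w hD).symm

theorem of_neutral (n : Neutral C) (n' : Neutral D) (e : ConEq Γ C D K) : LogRel K Γ C D := by
  induction K generalizing Γ C D with
  | type => exact ⟨e, .mk .refl .refl (.ne n n' e)⟩
  | baseType => exact ⟨e, .mk .refl .refl (.ne n n' (.sub e .base))⟩
  | row | baseRow => exact ⟨e, .mk (.ne n) (.ne n') fun _ => .none⟩
  | arrow K₁ K₂ _ ih =>
    exact ⟨e, fun hξ r => ih (n.rename _).app (n'.rename _).app (.app (e.rename hξ) r.conEq)⟩

theorem app (h : LogRel (.arrow K₁ K₂) Γ C C') (h' : LogRel K₁ Γ D D') :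
    LogRel K₂ Γ (.app C D) (.app C' D') := by
  have := h.2 (.id h.1.wf) h'
  rwa [Con.rename_id, Con.rename_id] at this

theorem iff_typeRel (t : TypeLike K) : LogRel K Γ C D ↔ ConEq Γ C D K ∧ TypeRel Γ C D := by
  cases t <;> rfl

theorem typeRel (h : LogRel K Γ C D) (t : TypeLike K) : TypeRel Γ C D :=
  ((iff_typeRel t).1 h).2

theorem iff_rowRel (r : RowOf K K') : LogRel K' Γ S S' ↔ ConEq Γ S S' K' ∧ RowRel Γ S S' := by
  cases r <;> rfl

theorem fieldRel (r : RowOf K K') (h : LogRel K Γ C D) : FieldRel Γ (some C) (some D) :=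
  let ⟨e, t⟩ := h.le r.field_le
  .some e t

theorem rcons (r : RowOf K K') (h : LogRel K Γ C D) (h' : LogRel K' Γ S S') :
    LogRel K' Γ (.rcons l C S) (.rcons l D S') := by
  refine (iff_rowRel r).2 ⟨.rcons r h.conEq h'.conEq, ?_⟩
  obtain ⟨v, v', p⟩ := ((iff_rowRel r).1 h').2
  exact .mk v.rcons v'.rcons (update_rel p (h.fieldRel r) l)

open Classical in
theorem swap (r : RowOf K K') (n : l ≠ l') (h : LogRel K Γ C C') (h' : LogRel K Γ D D')
    (hS : LogRel K' Γ S S') :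
    LogRel K' Γ (.rcons l C (.rcons l' D S)) (.rcons l' D' (.rcons l C' S')) := by
  have e : ConEq Γ (.rcons l C (.rcons l' D S)) (.rcons l C' (.rcons l' D' S')) K' :=
    .rcons r h.conEq (.rcons r h'.conEq hS.conEq)
  refine (iff_rowRel r).2 ⟨e.trans (.swap r n h.conEq.regular.2 h'.conEq.regular.2
    hS.conEq.regular.2), ?_⟩
  obtain ⟨v, v', p⟩ := ((iff_rowRel r).1 hS).2
  refine .mk v.rcons.rcons v'.rcons.rcons ?_
  rw [Function.update_comm n.symm]
  exact update_rel (update_rel p (h.fieldRel r) l) (h'.fieldRel r) l'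

theorem rmap (h : LogRel (.arrow .type .type) Γ C D) (h' : LogRel .row Γ S S') :
    LogRel .row Γ (.rmap C S) (.rmap D S') := by
  obtain ⟨e, ⟨v, v', p⟩⟩ := h'
  refine ⟨.rmap h.1 e, .mk (v.rmap C) (v'.rmap D) fun l => ?_⟩
  exact (p l).map fun e t => h.app ⟨e, t⟩

end LogRel

/-- The arguments of `Typerec` other than the first, one for each head constructor. -/
structure Branches where
  (bool int string list record trace : Con)

/-- `Typerec` on a constructor with the given branches. -/
abbrev Branches.typerec (b : Branches) (C : Con) : Con :=
  .typerec C b.bool b.int b.string b.list b.record b.trace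

/-- `Typerec` with the given branches as a constructor function, which it maps over the fields of a
record. -/
abbrev Branches.typerecFun (b : Branches) : Con :=
  .lam .type (.typerec (.var 0) b.bool.shift b.int.shift b.string.shift b.list.shift b.record.shift
    b.trace.shift)

/-- Logically related branches of `Typerec`. -/
structure BranchesRel (K : Kind) (Γ : Ctx) (b b' : Branches) : Prop where
  bool : LogRel K Γ b.bool b'.bool
  int : LogRel K Γ b.int b'.int
  string : LogRel K Γ b.string b'.string
  list : LogRel (.arrow .type (.arrow K K)) Γ b.list b'.list
  record : LogRel (.arrow .row (.arrow .row K)) Γ b.record b'.record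
  trace : LogRel (.arrow .baseType (.arrow K K)) Γ b.trace b'.trace

section

variable {K : Kind} {Γ : Ctx} {b b' : Branches}

theorem Branches.whr_typerecFun (C : Con) : Whr (.app b.typerecFun C) (b.typerec C) := by
  have := Whr.beta (K := .type) (D := C) (C := .typerec (.var 0) b.bool.shift b.int.shift
    b.string.shift b.list.shift b.record.shift b.trace.shift)
  simpa only [Con.inst, Con.subst, Con.shift_subst_scons, Con.subst_var, scons] using this

theorem BranchesRel.conEq_typerec (h : BranchesRel K Γ b b') (t : TypeLike K) {C D : Con}
    (e : ConEq Γ C D .type) : ConEq Γ (b.typerec C) (b'.typerec D) K :=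
  .typerec t e h.bool.conEq h.int.conEq h.string.conEq h.list.conEq h.record.conEq h.trace.conEq

theorem BranchesRel.conEq_typerecFun (h : BranchesRel K Γ b b') (t : TypeLike K) :
    ConEq Γ b.typerecFun b'.typerecFun (.arrow .type .type) :=
  .lam <| .le (.typerec t (.refl (.var (.tvar h.bool.conEq.wf) .here)) h.bool.conEq.shift
    h.int.conEq.shift h.string.conEq.shift h.list.conEq.shift h.record.conEq.shift
    h.trace.conEq.shift) t.le

mutual

theorem TypeRel.typerec (t : TypeLike K) (h : BranchesRel K Γ b b') {C D : Con} :
    TypeRel Γ C D → TypeRel Γ (b.typerec C) (b'.typerec D)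
  | .mk v w r => (r.typerec t h).expand (v.lift b.typerec fun _ _ s => .typerec s)
      (w.lift b'.typerec fun _ _ s => .typerec s)

theorem ValueRel.typerec (t : TypeLike K) (h : BranchesRel K Γ b b') {V W : Con} :
    ValueRel Γ V W → TypeRel Γ (b.typerec V) (b'.typerec W)
  | .bool => (h.bool.typeRel t).expand (.single .typerec_bool) (.single .typerec_bool)
  | .int => (h.int.typeRel t).expand (.single .typerec_int) (.single .typerec_int)
  | .string => (h.string.typeRel t).expand (.single .typerec_string) (.single .typerec_string)
  | .list e r =>
    have rec_arg := (LogRel.iff_typeRel t).2 ⟨h.conEq_typerec t e, r.typerec t h⟩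
    (((h.list.app ⟨e, r⟩).app rec_arg).typeRel t).expand (.single .typerec_list)
      (.single .typerec_list)
  | .trace e r =>
    have rec_arg := (LogRel.iff_typeRel t).2 ⟨h.conEq_typerec t (.sub e .base), r.typerec t h⟩
    (((h.trace.app ⟨e, r⟩).app rec_arg).typeRel t).expand (.single .typerec_trace)
      (.single .typerec_trace)
  | .record e r =>
    (((h.record.app ⟨e, r⟩).app ⟨.rmap (h.conEq_typerecFun t) e, r.rmap_typerec t h⟩).typeRel
      t).expand (.single .typerec_record) (.single .typerec_record)
  | .ne n n' e => .mk .refl .refl (.ne n.typerec n'.typerec ((h.conEq_typerec t e).le t.le))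

theorem RowRel.rmap_typerec (t : TypeLike K) (h : BranchesRel K Γ b b') {S S' : Con} :
    RowRel Γ S S' → RowRel Γ (.rmap b.typerecFun S) (.rmap b'.typerecFun S')
  | .mk v v' r => .mk (v.rmap _) (v'.rmap _) fun l => (r l).map_typerec t h

theorem FieldRel.map_typerec (t : TypeLike K) (h : BranchesRel K Γ b b') {c d : Option Con} :
    FieldRel Γ c d → FieldRel Γ (c.map (Con.app b.typerecFun)) (d.map (Con.app b'.typerecFun))
  | .none => .none
  | .some e r => .some (.app (h.conEq_typerecFun t) e)
    ((r.typerec t h).expand (.single (b.whr_typerecFun _)) (.single (b'.whr_typerecFun _)))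

end

end

/-! ### The fundamental theorem of the logical relation -/

/-- Logically related substitutions. -/
structure SubRel (Γ Γ' : Ctx) (σ σ' : ℕ → Con) : Prop where
  wf : WfCtx Γ'
  tvar : ∀ {n K}, Γ.TVarAt n K → LogRel K Γ' (σ n) (σ' n)

namespace SubRel

variable {Γ Γ' Γ'' : Ctx} {σ σ' : ℕ → Con} {D D' : Con} {K : Kind} {ξ : ℕ → ℕ}

theorem scons (h : SubRel Γ Γ' σ σ') (hD : LogRel K Γ' D D') :
    SubRel (.tvar Γ K) Γ' (LinksT.scons D σ) (LinksT.scons D' σ') where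
  wf := h.wf
  tvar
    | .here => hD
    | .tvar hn => h.tvar hn

theorem rename (h : SubRel Γ Γ' σ σ') (hξ : Ren Γ' Γ'' ξ) :
    SubRel Γ Γ'' (Con.rename ξ ∘ σ) (Con.rename ξ ∘ σ') :=
  ⟨hξ.wf, fun hn => (h.tvar hn).rename hξ⟩

theorem up (h : SubRel Γ Γ' σ σ') : SubRel (.tvar Γ K) (.tvar Γ' K) (upCon σ) (upCon σ') :=
  (h.rename (.succ h.wf)).scons (.of_neutral .var .var (.refl (.var (.tvar h.wf) .here)))

theorem symm (h : SubRel Γ Γ' σ σ') : SubRel Γ Γ' σ' σ :=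
  ⟨h.wf, fun hn => (h.tvar hn).symm⟩

theorem refl_left (h : SubRel Γ Γ' σ σ') : SubRel Γ Γ' σ σ :=
  ⟨h.wf, fun hn => (h.tvar hn).trans (h.tvar hn).symm⟩

theorem id (h : WfCtx Γ) : SubRel Γ Γ Con.var Con.var :=
  ⟨h, fun hn => .of_neutral .var .var (.refl (.var h hn))⟩

theorem conSub_left (h : SubRel Γ Γ' σ σ') : ConSub Γ Γ' σ :=
  ⟨h.wf, fun hn => (h.tvar hn).conEq.regular.1⟩

end SubRel

/-- Semantic equality: related substitutions send the two constructors to related constructors. -/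
def ValidEq (Γ : Ctx) (C D : Con) (K : Kind) : Prop :=
  ∀ ⦃Γ' σ σ'⦄, SubRel Γ Γ' σ σ' → LogRel K Γ' (C.subst σ) (D.subst σ')

namespace ValidEq

variable {Γ : Ctx} {K K' K₁ K₂ : Kind} {l : Label}
  {C C' D D' S S' CB CB' CI CI' CS CS' CL CL' CR CR' CT CT' : Con}

theorem symm (h : ValidEq Γ C D K) : ValidEq Γ D C K := fun _ _ _ hσ => (h hσ.symm).symm

theorem trans (h : ValidEq Γ C D K) (h' : ValidEq Γ D C' K) : ValidEq Γ C C' K :=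
  fun _ _ _ hσ => (h hσ.refl_left).trans (h' hσ)

theorem le (h : ValidEq Γ C D K) (le : KindLe K K') : ValidEq Γ C D K' :=
  fun _ _ _ hσ => (h hσ).le le

theorem lam (h : ValidEq (.tvar Γ K₁) C D K₂) :
    ValidEq Γ (.lam K₁ C) (.lam K₁ D) (.arrow K₁ K₂) := by
  intro Γ' σ σ' hσ
  have e : ConEq Γ' ((Con.lam K₁ C).subst σ) ((Con.lam K₁ D).subst σ') (.arrow K₁ K₂) :=
    .lam (h hσ.up).conEq
  refine ⟨e, fun {Γ'' ξ E F} hξ r => ?_⟩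
  have red {C E : Con} {σ : ℕ → Con} : Whr (.app (((Con.lam K₁ C).subst σ).rename ξ) E)
      (C.subst (LinksT.scons E (Con.rename ξ ∘ σ))) := by
    rw [Con.subst_rename, ← Con.subst_upCon_inst]; exact .beta
  exact .whr_left red (.app (e.rename hξ).regular.1 r.conEq.regular.1) <|
    .whr_right red (.app (e.rename hξ).regular.2 r.conEq.regular.2) <|
    h ((hσ.rename hξ).scons r)

theorem app (h : ValidEq Γ C C' (.arrow K₁ K₂)) (h' : ValidEq Γ D D' K₁) :
    ValidEq Γ (.app C D) (.app C' D') K₂ := fun _ _ _ hσ => (h hσ).app (h' hσ)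

theorem list (h : ValidEq Γ C D .type) : ValidEq Γ (.list C) (.list D) .type := fun _ _ _ hσ =>
  let ⟨e, r⟩ := h hσ
  ⟨.list e, .mk .refl .refl (.list e r)⟩

theorem record (h : ValidEq Γ S S' .row) : ValidEq Γ (.record S) (.record S') .type :=
  fun _ _ _ hσ =>
    let ⟨e, r⟩ := h hσ
    ⟨.record e, .mk .refl .refl (.record e r)⟩

theorem trace (h : ValidEq Γ C D .baseType) : ValidEq Γ (.trace C) (.trace D) .type :=
  fun _ _ _ hσ =>
    let ⟨e, r⟩ := h hσ
    ⟨.trace e, .mk .refl .refl (.trace e r)⟩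

theorem rnil (r : RowOf K K') : ValidEq Γ .rnil .rnil K' := fun _ _ _ hσ =>
  (LogRel.iff_rowRel r).2 ⟨.rnil r hσ.wf, .mk .rnil .rnil fun _ => .none⟩

theorem rcons (r : RowOf K K') (h : ValidEq Γ C D K) (h' : ValidEq Γ S S' K') :
    ValidEq Γ (.rcons l C S) (.rcons l D S') K' := fun _ _ _ hσ => (h hσ).rcons r (h' hσ)

theorem rmap (h : ValidEq Γ C D (.arrow .type .type)) (h' : ValidEq Γ S S' .row) :
    ValidEq Γ (.rmap C S) (.rmap D S') .row := fun _ _ _ hσ => (h hσ).rmap (h' hσ)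

theorem typerec (t : TypeLike K) (h : ValidEq Γ C C' .type) (hB : ValidEq Γ CB CB' K)
    (hI : ValidEq Γ CI CI' K) (hS : ValidEq Γ CS CS' K)
    (hL : ValidEq Γ CL CL' (.arrow .type (.arrow K K)))
    (hR : ValidEq Γ CR CR' (.arrow .row (.arrow .row K)))
    (hT : ValidEq Γ CT CT' (.arrow .baseType (.arrow K K))) :
    ValidEq Γ (.typerec C CB CI CS CL CR CT) (.typerec C' CB' CI' CS' CL' CR' CT') K :=
  fun Γ' _ _ hσ =>
    let ⟨e, r⟩ := h hσ
    have b : BranchesRel K Γ' ⟨_, _, _, _, _, _⟩ ⟨_, _, _, _, _, _⟩ :=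
      ⟨hB hσ, hI hσ, hS hσ, hL hσ, hR hσ, hT hσ⟩
    (LogRel.iff_typeRel t).2 ⟨b.conEq_typerec t e, r.typerec t b⟩

theorem eta (h : ValidEq Γ C C (.arrow K K')) :
    ValidEq Γ (.lam K (.app C.shift (.var 0))) C (.arrow K K') := by
  intro Γ' σ σ' hσ
  have r := h hσ
  have e : ConEq Γ' (.lam K (.app (C.subst σ).shift (.var 0))) (C.subst σ) (.arrow K K') :=
    .eta r.conEq.regular.1
  simp only [Con.subst, Con.shift_subst_upCon]
  refine ⟨e.trans r.conEq, fun {Γ'' ξ E F} hξ q => ?_⟩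
  refine .whr_left .beta (.app (e.rename hξ).regular.1 q.conEq.regular.1) ?_
  simp only [Con.inst, Con.rename, Con.subst, Con.shift_rename_upRen, Con.shift_subst_scons,
    Con.subst_var]
  exact r.2 hξ q

theorem whr (w : Whr C D) (hC : ConKind Γ C K) (h : ValidEq Γ D D K) : ValidEq Γ C D K :=
  fun _ σ _ hσ => .whr_left (w.subst σ) (hC.subst hσ.conSub_left) (h hσ)

end ValidEq

theorem ConKind.valid {Γ C K} : ConKind Γ C K → ValidEq Γ C C K
  | .bool _ => fun _ _ _ hσ => ⟨.refl (.bool hσ.wf), .mk .refl .refl .bool⟩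
  | .int _ => fun _ _ _ hσ => ⟨.refl (.int hσ.wf), .mk .refl .refl .int⟩
  | .string _ => fun _ _ _ hσ => ⟨.refl (.string hσ.wf), .mk .refl .refl .string⟩
  | .var _ hn => fun _ _ _ hσ => hσ.tvar hn
  | .lam h => .lam h.valid
  | .app h h' => .app h.valid h'.valid
  | .list h => .list h.valid
  | .record h => .record h.valid
  | .trace h => .trace h.valid
  | .typerec t h hB hI hS hL hR hT =>
    .typerec t h.valid hB.valid hI.valid hS.valid hL.valid hR.valid hT.valid
  | .rnil r _ => .rnil r
  | .rcons r h h' => .rcons r h.valid h'.valid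
  | .rmap h h' => .rmap h.valid h'.valid
  | .sub h s => .le h.valid (.single s)

section

variable {Γ Γ' : Ctx} {C D : Con} {K : Kind} {σ : ℕ → Con}

theorem Branches.kind_typerecFun {b : Branches} (t : TypeLike K) (hB : ConKind Γ b.bool K)
    (hI : ConKind Γ b.int K) (hS : ConKind Γ b.string K)
    (hL : ConKind Γ b.list (.arrow .type (.arrow K K)))
    (hR : ConKind Γ b.record (.arrow .row (.arrow .row K)))
    (hT : ConKind Γ b.trace (.arrow .baseType (.arrow K K))) :
    ConKind Γ b.typerecFun (.arrow .type .type) :=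
  .lam <| .le (.typerec t (.var (.tvar hB.wf) .here) hB.shift hI.shift hS.shift hL.shift hR.shift
    hT.shift) t.le

theorem Whr.kind (w : Whr C D) (h : ConKind Γ C K) : ConKind Γ D K := by
  induction w generalizing K with
  | app _ ih =>
    obtain ⟨_, le, _, h, h'⟩ := h.generation
    exact .le (.app (ih h) h') le
  | beta =>
    obtain ⟨_, le, _, h, h'⟩ := h.generation
    obtain ⟨_, ⟨⟩ | ⟨⟨⟩⟩, _, ⟨⟩, h⟩ := h.generation
    exact .le (h.inst h') le
  | rmap _ ih =>
    obtain ⟨_, le, rfl, h, h'⟩ := h.generation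
    exact .le (.rmap h (ih h')) le
  | rmap_rnil =>
    obtain ⟨_, le, rfl, h, _⟩ := h.generation
    exact .le (.rnil .row h.wf) le
  | rmap_rcons =>
    obtain ⟨_, le, rfl, h, h'⟩ := h.generation
    obtain ⟨_, _, _, r, hD, hS⟩ := h'.generation
    exact .le (.rcons .row (.app h (hD.le r.field_le)) (.rmap h (hS.le r.row_le))) le
  | typerec _ ih =>
    obtain ⟨_, le, t, h, hB, hI, hS, hL, hR, hT⟩ := h.generation
    exact .le (.typerec t (ih h) hB hI hS hL hR hT) le
  | typerec_bool | typerec_int | typerec_string =>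
    obtain ⟨_, le, _, _, hB, hI, hS, _⟩ := h.generation
    exact .le ‹_› le
  | typerec_list =>
    obtain ⟨_, le, t, h, hB, hI, hS, hL, hR, hT⟩ := h.generation
    obtain ⟨_, _, _, hD⟩ := h.generation
    exact .le (.app (.app hL hD) (.typerec t hD hB hI hS hL hR hT)) le
  | @typerec_record S CB CI CS CL CR CT =>
    obtain ⟨_, le, t, h, hB, hI, hS, hL, hR, hT⟩ := h.generation
    obtain ⟨_, _, _, hS'⟩ := h.generation
    let b : Branches := ⟨CB, CI, CS, CL, CR, CT⟩
    exact .le (.app (.app hR hS') (.rmap (b.kind_typerecFun t hB hI hS hL hR hT) hS')) le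
  | typerec_trace =>
    obtain ⟨_, le, t, h, hB, hI, hS, hL, hR, hT⟩ := h.generation
    obtain ⟨_, _, _, hD⟩ := h.generation
    exact .le (.app (.app hT hD) (.typerec t (.sub hD .base) hB hI hS hL hR hT)) le

theorem ConStep.kind (s : ConStep C D) (h : ConKind Γ C K) : ConKind Γ D K := by
  induction s generalizing Γ K with
  | lam _ ih =>
    obtain ⟨_, le, _, rfl, h⟩ := h.generation
    exact .le (.lam (ih h)) le
  | app_fun _ ih | app_arg _ ih =>
    obtain ⟨_, le, K₁, h, h'⟩ := h.generation
    refine .le (.app (K₁ := K₁) ?_ ?_) le <;> solve_by_elim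
  | list _ ih | trace _ ih | record _ ih =>
    obtain ⟨_, le, rfl, h⟩ := h.generation
    exact .le (by constructor; exact ih h) le
  | rcons_head _ ih | rcons_tail _ ih =>
    obtain ⟨_, le, _, r, h, h'⟩ := h.generation
    refine .le (.rcons r ?_ ?_) le <;> solve_by_elim
  | rmap_fun _ ih | rmap_row _ ih =>
    obtain ⟨_, le, rfl, h, h'⟩ := h.generation
    refine .le (.rmap ?_ ?_) le <;> solve_by_elim
  | typerec_scrut _ ih | typerec_B _ ih | typerec_I _ ih | typerec_S _ ih | typerec_L _ ih
  | typerec_R _ ih | typerec_T _ ih =>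
    obtain ⟨_, le, t, h, hB, hI, hS, hL, hR, hT⟩ := h.generation
    refine .le (.typerec t ?_ ?_ ?_ ?_ ?_ ?_ ?_) le <;> solve_by_elim
  | _ => exact Whr.kind (by constructor) h

theorem ConStep.valid (s : ConStep C D) (h : ConKind Γ C K) : ValidEq Γ C D K := by
  induction s generalizing Γ K with
  | lam _ ih =>
    obtain ⟨_, le, _, rfl, h⟩ := h.generation
    exact .le (.lam (ih h)) le
  | app_fun _ ih | app_arg _ ih =>
    obtain ⟨_, le, K₁, h, h'⟩ := h.generation
    refine .le (.app (K₁ := K₁) ?_ ?_) le <;> solve_by_elim [ConKind.valid]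
  | list _ ih =>
    obtain ⟨_, le, rfl, h⟩ := h.generation
    exact .le (.list (ih h)) le
  | trace _ ih =>
    obtain ⟨_, le, rfl, h⟩ := h.generation
    exact .le (.trace (ih h)) le
  | record _ ih =>
    obtain ⟨_, le, rfl, h⟩ := h.generation
    exact .le (.record (ih h)) le
  | rcons_head _ ih | rcons_tail _ ih =>
    obtain ⟨_, le, _, r, h, h'⟩ := h.generation
    refine .le (.rcons r ?_ ?_) le <;> solve_by_elim [ConKind.valid]
  | rmap_fun _ ih | rmap_row _ ih =>
    obtain ⟨_, le, rfl, h, h'⟩ := h.generation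
    refine .le (.rmap ?_ ?_) le <;> solve_by_elim [ConKind.valid]
  | typerec_scrut _ ih | typerec_B _ ih | typerec_I _ ih | typerec_S _ ih | typerec_L _ ih
  | typerec_R _ ih | typerec_T _ ih =>
    obtain ⟨_, le, t, h, hB, hI, hS, hL, hR, hT⟩ := h.generation
    refine .le (.typerec t ?_ ?_ ?_ ?_ ?_ ?_ ?_) le <;> solve_by_elim [ConKind.valid]
  | _ => exact .whr (by constructor) h (Whr.kind (by constructor) h).valid

theorem ConStep.conEq (s : ConStep C D) (h : ConKind Γ C K) : ConEq Γ C D K :=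
  .step h (s.kind h) s

theorem ConEq.valid (h : ConEq Γ C D K) : ValidEq Γ C D K := by
  induction h with
  | refl h => exact h.valid
  | symm _ ih => exact ih.symm
  | trans _ _ ih ih' => exact ih.trans ih'
  | sub _ s ih => exact ih.le (.single s)
  | eta h => exact .eta h.valid
  | lam _ ih => exact .lam ih
  | app _ _ ih ih' => exact .app ih ih'
  | list _ ih => exact .list ih
  | record _ ih => exact .record ih
  | trace _ ih => exact .trace ih
  | step h _ s => exact s.valid h
  | rnil r _ => exact .rnil r
  | rcons r _ _ ih ih' => exact .rcons r ih ih'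
  | swap r n h h' hS => exact fun _ _ _ hσ => .swap r n (h.valid hσ) (h'.valid hσ) (hS.valid hσ)
  | rmap _ _ ih ih' => exact .rmap ih ih'
  | typerec t _ _ _ _ _ _ _ h hB hI hS hL hR hT => exact .typerec t h hB hI hS hL hR hT

theorem ConEq.logRel (h : ConEq Γ C D K) : LogRel K Γ C D := by
  simpa only [Con.subst_var] using h.valid (.id h.wf)

theorem ConSub.subRel (h : ConSub Γ Γ' σ) : SubRel Γ Γ' σ σ :=
  ⟨h.wf, fun hn => (ConEq.refl (h.tvar hn)).logRel⟩

theorem ConEq.subst (h : ConEq Γ C D K) (hσ : ConSub Γ Γ' σ) :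
    ConEq Γ' (C.subst σ) (D.subst σ) K := (h.valid hσ.subRel).conEq

end

/-! ### Kinding and equivalence of types -/

section

variable {Γ Γ' : Ctx} {A B : Ty} {C D : Con} {K K' : Kind} {σ σ' : ℕ → Con} {ξ : ℕ → ℕ}

theorem TyKind.le (h : TyKind Γ A K) (le : KindLe K K') : TyKind Γ A K' := by
  cases le with
  | refl => exact h
  | single s => exact .sub h s

theorem TyEq.le (h : TyEq Γ A B K) (le : KindLe K K') : TyEq Γ A B K' := by
  cases le with
  | refl => exact h
  | single s => exact .sub h s

theorem RowOf.field_ground (r : RowOf K K') : Ground K := by cases r <;> constructor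

theorem RowOf.row_ground (r : RowOf K K') : Ground K' := by cases r <;> constructor

theorem TyEq.regular (h : TyEq Γ A B K) : TyKind Γ A K ∧ TyKind Γ B K := by
  induction h with
  | refl h => exact ⟨h, h⟩
  | symm _ ih => exact ih.symm
  | trans _ _ ih ih' => exact ⟨ih.1, ih'.2⟩
  | sub _ s ih => exact ⟨.sub ih.1 s, .sub ih.2 s⟩
  | T_bool w => exact ⟨.T .baseType (.bool w), .bool w⟩
  | T_int w => exact ⟨.T .baseType (.int w), .int w⟩
  | T_string w => exact ⟨.T .baseType (.string w), .string w⟩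
  | T_list h => exact ⟨.T .type (.list h), .list (.T .type h)⟩
  | T_record h => exact ⟨.T .type (.record h), .record (.T .row h)⟩
  | T_trace h => exact ⟨.T .type (.trace h), .trace (.T .baseType h)⟩
  | T_rnil r w => exact ⟨.T r.row_ground (.rnil r w), .rnil r w⟩
  | T_rcons r h h' =>
    exact ⟨.T r.row_ground (.rcons r h h'), .rcons r (.T r.field_ground h) (.T r.row_ground h')⟩
  | T_congr g e => exact ⟨.T g e.regular.1, .T g e.regular.2⟩
  | list _ ih => exact ⟨.list ih.1, .list ih.2⟩
  | record _ ih => exact ⟨.record ih.1, .record ih.2⟩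
  | trace _ ih => exact ⟨.trace ih.1, .trace ih.2⟩
  | fn _ _ ih ih' => exact ⟨.fn ih.1 ih'.1, .fn ih.2 ih'.2⟩
  | all _ ih => exact ⟨.all ih.1, .all ih.2⟩
  | rnil r w => exact ⟨.rnil r w, .rnil r w⟩
  | rcons r _ _ ih ih' => exact ⟨.rcons r ih.1 ih'.1, .rcons r ih.2 ih'.2⟩
  | swap r _ h h' hR => exact ⟨.rcons r h (.rcons r h' hR), .rcons r h' (.rcons r h hR)⟩

theorem TyEq.wf (h : TyEq Γ A B K) : WfCtx Γ := h.regular.1.wf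

theorem TyKind.subst_eq {Γ A K} : TyKind Γ A K →
    ∀ {Γ' σ σ'}, SubRel Γ Γ' σ σ' → TyEq Γ' (A.subst σ) (A.subst σ') K
  | .T g h, _, _, _, hσ => .T_congr g (h.valid hσ).conEq
  | .bool _, _, _, _, hσ => .refl (.bool hσ.wf)
  | .int _, _, _, _, hσ => .refl (.int hσ.wf)
  | .string _, _, _, _, hσ => .refl (.string hσ.wf)
  | .sub h s, _, _, _, hσ => .sub (h.subst_eq hσ) s
  | .all h, _, _, _, hσ => .all (h.subst_eq hσ.up)
  | .fn h h', _, _, _, hσ => .fn (h.subst_eq hσ) (h'.subst_eq hσ)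
  | .list h, _, _, _, hσ => .list (h.subst_eq hσ)
  | .record h, _, _, _, hσ => .record (h.subst_eq hσ)
  | .trace h, _, _, _, hσ => .trace (h.subst_eq hσ)
  | .rnil r _, _, _, _, hσ => .rnil r hσ.wf
  | .rcons r h h', _, _, _, hσ => .rcons r (h.subst_eq hσ) (h'.subst_eq hσ)

theorem TyKind.subst (h : TyKind Γ A K) (hσ : ConSub Γ Γ' σ) : TyKind Γ' (A.subst σ) K :=
  (h.subst_eq hσ.subRel).regular.1

theorem TyKind.rename (h : TyKind Γ A K) (hξ : Ren Γ Γ' ξ) : TyKind Γ' (A.rename ξ) K := by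
  rw [Ty.rename_eq_subst]; exact h.subst hξ.conSub

theorem TyKind.shift (h : TyKind Γ A K) : TyKind (.tvar Γ K') A.shift K := h.rename (.succ h.wf)

theorem TyKind.addVar (h : TyKind Γ A K) (hB : TyKind Γ B .type) : TyKind (.var Γ B) A K := by
  simpa only [Ty.rename_id] using h.rename (.addVar (.var hB))

theorem TyKind.dropVar (h : TyKind (.var Γ B) A K) : TyKind Γ A K := by
  simpa only [Ty.rename_id] using h.rename (.dropVar h.wf)

theorem TyKind.inst (h : TyKind (.tvar Γ K') A K) (hC : ConKind Γ C K') : TyKind Γ (A.inst C) K :=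
  h.subst ((ConSub.id hC.wf).scons hC)

theorem TyKind.inst_eq (h : TyKind (.tvar Γ K') A K) (e : ConEq Γ C D K') :
    TyEq Γ (A.inst C) (A.inst D) K :=
  h.subst_eq ((SubRel.id e.wf).scons e.logRel)

theorem TyEq.subst (h : TyEq Γ A B K) (hσ : ConSub Γ Γ' σ) :
    TyEq Γ' (A.subst σ) (B.subst σ) K := by
  induction h generalizing Γ' σ with
  | refl h => exact .refl (h.subst hσ)
  | symm _ ih => exact .symm (ih hσ)
  | trans _ _ ih ih' => exact .trans (ih hσ) (ih' hσ)
  | sub _ s ih => exact .sub (ih hσ) s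
  | T_bool _ => exact .T_bool hσ.wf
  | T_int _ => exact .T_int hσ.wf
  | T_string _ => exact .T_string hσ.wf
  | T_list h => exact .T_list (h.subst hσ)
  | T_record h => exact .T_record (h.subst hσ)
  | T_trace h => exact .T_trace (h.subst hσ)
  | T_rnil r _ => exact .T_rnil r hσ.wf
  | T_rcons r h h' => exact .T_rcons r (h.subst hσ) (h'.subst hσ)
  | T_congr g e => exact .T_congr g (e.subst hσ)
  | list _ ih => exact .list (ih hσ)
  | record _ ih => exact .record (ih hσ)
  | trace _ ih => exact .trace (ih hσ)
  | fn _ _ ih ih' => exact .fn (ih hσ) (ih' hσ)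
  | all _ ih => exact .all (ih hσ.up)
  | rnil r _ => exact .rnil r hσ.wf
  | rcons r _ _ ih ih' => exact .rcons r (ih hσ) (ih' hσ)
  | swap r n h h' hR => exact .swap r n (h.subst hσ) (h'.subst hσ) (hR.subst hσ)

theorem TyEq.addVar (h : TyEq Γ A B K) {A' : Ty} (hA' : TyKind Γ A' .type) :
    TyEq (.var Γ A') A B K := by
  simpa only [Function.comp_id, Ty.subst_var] using h.subst (Ren.addVar (.var hA')).conSub

theorem TyEq.inst (h : TyEq (.tvar Γ K') A B K) (hC : ConKind Γ C K') :
    TyEq Γ (A.inst C) (B.inst C) K :=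
  h.subst ((ConSub.id hC.wf).scons hC)

end

/-- The premises of the kinding rule for the head former of a type, up to subsumption. -/
def TyKind.Premises (Γ : Ctx) : Ty → Kind → Prop
  | .T C, K => ConKind Γ C K
  | .fn A B, _ => TyKind Γ A .type ∧ TyKind Γ B .type
  | .list A, _ => TyKind Γ A .type
  | .record R, _ => TyKind Γ R .row
  | .trace A, _ => TyKind Γ A .baseType
  | .all K A, _ => TyKind (.tvar Γ K) A .type
  | .rcons _ A R, _ => TyKind Γ A .type ∧ TyKind Γ R .row
  | .bool, _ | .int, _ | .string, _ | .rnil, _ => True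

theorem TyKind.premises {Γ A K} : TyKind Γ A K → Premises Γ A K
  | .T _ h | .all h | .list h | .record h | .trace h => h
  | .fn h h' => ⟨h, h'⟩
  | .rcons r h h' => ⟨h.le r.field_le, h'.le r.row_le⟩
  | .bool _ | .int _ | .string _ | .rnil _ _ => trivial
  | .sub h s => by
    have p := h.premises
    cases A with
    | T => exact .sub p s
    | _ => exact p

/-! ### Injectivity of type formers -/

section

variable {Γ : Ctx}

/-- The type equal to `T(C)` that exposes the head former of `C`, if `C` is headed by a former of
types. -/
def Con.pushT : Con → Ty
  | .bool => .bool
  | .int => .int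
  | .string => .string
  | .list C => .list (.T C)
  | .record S => .record (.T S)
  | .trace C => .trace (.T C)
  | C => .T C

/-- `Head A V`: the type `A` evaluates to `V` by computing the constructor below an outermost `T`
to weak head normal form and exposing its head former. -/
inductive Head : Ty → Ty → Prop
  | T {C V : Con} : Whrs C V → (∀ E, ¬ Whr V E) → Head (.T C) V.pushT
  | refl {A : Ty} : (∀ C, A ≠ .T C) → Head A A

theorem Head.deterministic {A V W : Ty} (h : Head A V) (h' : Head A W) : V = W := by
  cases h with
  | T v hv => cases h' with
    | T w hw => rw [v.deterministic w hv hw]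
    | refl n => exact (n _ rfl).elim
  | refl n => cases h' with
    | T => exact (n _ rfl).elim
    | refl => rfl

/-- The same head former with equal arguments, or two occurrences of `T`. -/
inductive HeadRel (Γ : Ctx) : Ty → Ty → Prop
  | T {C D : Con} : HeadRel Γ (.T C) (.T D)
  | bool : HeadRel Γ .bool .bool
  | int : HeadRel Γ .int .int
  | string : HeadRel Γ .string .string
  | fn {A A' B B' : Ty} : TyEq Γ A A' .type → TyEq Γ B B' .type → HeadRel Γ (.fn A B) (.fn A' B')
  | list {A B : Ty} : TyEq Γ A B .type → HeadRel Γ (.list A) (.list B)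
  | record {R R' : Ty} : TyEq Γ R R' .row → HeadRel Γ (.record R) (.record R')
  | trace {A B : Ty} : TyEq Γ A B .baseType → HeadRel Γ (.trace A) (.trace B)
  | all {K : Kind} {A B : Ty} : TyEq (.tvar Γ K) A B .type → HeadRel Γ (.all K A) (.all K B)

theorem HeadRel.symm {A B : Ty} : HeadRel Γ A B → HeadRel Γ B A
  | .T => .T
  | .bool => .bool
  | .int => .int
  | .string => .string
  | .fn e e' => .fn e.symm e'.symm
  | .list e => .list e.symm
  | .record e => .record e.symm
  | .trace e => .trace e.symm
  | .all e => .all e.symm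

theorem HeadRel.trans {A B C : Ty} : HeadRel Γ A B → HeadRel Γ B C → HeadRel Γ A C
  | .T, .T => .T
  | .bool, h => h
  | .int, h => h
  | .string, h => h
  | .fn e e', .fn f f' => .fn (e.trans f) (e'.trans f')
  | .list e, .list f => .list (e.trans f)
  | .record e, .record f => .record (e.trans f)
  | .trace e, .trace f => .trace (e.trans f)
  | .all e, .all f => .all (e.trans f)

theorem ValueRel.headRel {V W : Con} : ValueRel Γ V W → HeadRel Γ V.pushT W.pushT
  | .bool => .bool
  | .int => .int
  | .string => .string
  | .list e _ => .list (.T_congr .type e)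
  | .trace e _ => .trace (.T_congr .baseType e)
  | .record e _ => .record (.T_congr .row e)
  | .ne n n' _ => by cases n <;> cases n' <;> exact .T

/-- Both types evaluate to types with the same head former and equal arguments. -/
inductive SameHead (Γ : Ctx) : Ty → Ty → Prop
  | mk {A B V W : Ty} : Head A V → Head B W → HeadRel Γ V W → SameHead Γ A B

theorem SameHead.symm {A B : Ty} : SameHead Γ A B → SameHead Γ B A
  | .mk v w r => .mk w v r.symm

theorem SameHead.trans {A B C : Ty} : SameHead Γ A B → SameHead Γ B C → SameHead Γ A C
  | .mk v w r, .mk w' u r' => by cases w.deterministic w'; exact .mk v u (r.trans r')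

theorem HeadRel.sameHead {A B : Ty} (h : HeadRel Γ A B) (hA : ∀ C, A ≠ .T C) (hB : ∀ C, B ≠ .T C) :
    SameHead Γ A B := .mk (.refl hA) (.refl hB) h

theorem TypeRel.sameHead {C D : Con} : TypeRel Γ C D → SameHead Γ (.T C) (.T D)
  | .mk v w r => .mk (.T v fun _ => r.not_whr) (.T w fun _ => r.symm.not_whr) r.headRel

open Classical in
/-- `TyRowView R f`: the row type `R` evaluates to fields followed by `·` or a neutral row; `f`
assigns to each label its first field. -/
inductive TyRowView : Ty → (Label → Option Ty) → Prop
  | rnil : TyRowView .rnil (fun _ => none)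
  | rcons {l : Label} {A R : Ty} {f : Label → Option Ty} : TyRowView R f →
      TyRowView (.rcons l A R) (Function.update f l (some A))
  | T {S : Con} {f : Label → Option Con} : RowView S f → TyRowView (.T S) (Option.map Ty.T ∘ f)

theorem TyRowView.deterministic {R : Ty} {f g : Label → Option Ty} (h : TyRowView R f)
    (h' : TyRowView R g) : f = g := by
  induction h generalizing g with
  | rnil => cases h'; rfl
  | rcons _ ih => cases h' with | rcons h' => rw [ih h']
  | T h => cases h' with | T h' => rw [h.deterministic h']

theorem TyRowView.T_rnil {f : Label → Option Ty} : TyRowView (.T .rnil) f → TyRowView .rnil f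
  | .T .rnil => .rnil
  | .T (.ne n) => nomatch n
  | .T (.whr w _) => nomatch w

theorem TyRowView.T_rcons {l : Label} {C S : Con} {f : Label → Option Ty} :
    TyRowView (.T (.rcons l C S)) f → TyRowView (.rcons l (.T C) (.T S)) f
  | .T (.rcons h) => by rw [@Function.comp_update]; exact .rcons (.T h)
  | .T (.ne n) => nomatch n
  | .T (.whr w _) => nomatch w

open Classical in
theorem TyRowView.swap {l l' : Label} {A B R : Ty} {f : Label → Option Ty} (n : l ≠ l') :
    TyRowView (.rcons l A (.rcons l' B R)) f → TyRowView (.rcons l' B (.rcons l A R)) f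
  | .rcons (.rcons h) => by rw [Function.update_comm n.symm]; exact .rcons (.rcons h)

/-- Equal types, or no field on either side. -/
inductive SameField (Γ : Ctx) : Option Ty → Option Ty → Prop
  | none : SameField Γ none none
  | some {A B : Ty} : TyEq Γ A B .type → SameField Γ (some A) (some B)

theorem SameField.symm {a b : Option Ty} : SameField Γ a b → SameField Γ b a
  | .none => .none
  | .some e => .some e.symm

theorem SameField.trans {a b c : Option Ty} : SameField Γ a b → SameField Γ b c → SameField Γ a c
  | .none, .none => .none
  | .some e, .some e' => .some (e.trans e')

theorem FieldRel.sameField {c d : Option Con} :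
    FieldRel Γ c d → SameField Γ (c.map .T) (d.map .T)
  | .none => .none
  | .some e _ => .some (.T_congr .type e)

/-- Both row types evaluate to rows that have equal fields at each label. -/
inductive SameFields (Γ : Ctx) : Ty → Ty → Prop
  | mk {R R' : Ty} {f g : Label → Option Ty} : TyRowView R f → TyRowView R' g →
      (∀ l, SameField Γ (f l) (g l)) → SameFields Γ R R'

theorem SameFields.symm {R R' : Ty} : SameFields Γ R R' → SameFields Γ R' R
  | .mk v w r => .mk w v fun l => (r l).symm

theorem SameFields.trans {R R' R'' : Ty} :
    SameFields Γ R R' → SameFields Γ R' R'' → SameFields Γ R R''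
  | .mk v w r, .mk (f := g') w' u r' => by
    obtain rfl : _ = g' := w.deterministic w'
    exact .mk v u fun l => (r l).trans (r' l)

theorem SameFields.rnil : SameFields Γ .rnil .rnil := .mk .rnil .rnil fun _ => .none

theorem SameFields.rcons {l : Label} {A B R R' : Ty} (e : TyEq Γ A B .type) :
    SameFields Γ R R' → SameFields Γ (.rcons l A R) (.rcons l B R')
  | .mk v w r => .mk (.rcons v) (.rcons w) (update_rel r (.some e) l)

theorem SameFields.congr_right {R R' R'' : Ty} (h : ∀ {f}, TyRowView R' f → TyRowView R'' f) :
    SameFields Γ R R' → SameFields Γ R R''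
  | .mk v w r => .mk v (h w) r

theorem RowRel.sameFields {S S' : Con} : RowRel Γ S S' → SameFields Γ (.T S) (.T S')
  | .mk v w r => .mk (.T v) (.T w) fun l => (r l).sameField

/-- The invariant of type equivalence: the same head for types, the same fields for row types. -/
inductive SameShape (Γ : Ctx) : Kind → Ty → Ty → Prop
  | type {K : Kind} {A B : Ty} : TypeLike K → SameHead Γ A B → SameShape Γ K A B
  | row {κ ρ : Kind} {R R' : Ty} : RowOf κ ρ → SameFields Γ R R' → SameShape Γ ρ R R'

namespace SameShape

variable {K K' : Kind} {A B C : Ty}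

theorem symm : SameShape Γ K A B → SameShape Γ K B A
  | .type t h => .type t h.symm
  | .row r h => .row r h.symm

theorem sameHead (t : TypeLike K) : SameShape Γ K A B → SameHead Γ A B
  | .type _ h => h
  | .row r _ => by cases t <;> cases r

theorem sameFields (r : RowOf K K') : SameShape Γ K' A B → SameFields Γ A B
  | .type t _ => by cases t <;> cases r
  | .row _ h => h

theorem trans (h : SameShape Γ K A B) (h' : SameShape Γ K B C) : SameShape Γ K A C := by
  cases h with
  | type t h => exact .type t (h.trans (h'.sameHead t))
  | row r h => exact .row r (h.trans (h'.sameFields r))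

theorem sub (s : SubKind K K') : SameShape Γ K A B → SameShape Γ K' A B
  | .type t h => by cases s <;> cases t; exact .type .type h
  | .row r h => by cases s <;> cases r; exact .row .row h

end SameShape

theorem LogRel.sameShape {K : Kind} {C D : Con} (h : LogRel K Γ C D) :
    Ground K → SameShape Γ K (.T C) (.T D)
  | .type => .type .type h.2.sameHead
  | .baseType => .type .baseType h.2.sameHead
  | .row => .row .row h.2.sameFields
  | .baseRow => .row .baseRow h.2.sameFields

theorem TyKind.sameShape {A K} : TyKind Γ A K → SameShape Γ K A A
  | .T g h => (ConEq.refl h).logRel.sameShape g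
  | .bool _ => .type .baseType (HeadRel.bool.sameHead nofun nofun)
  | .int _ => .type .baseType (HeadRel.int.sameHead nofun nofun)
  | .string _ => .type .baseType (HeadRel.string.sameHead nofun nofun)
  | .sub h s => h.sameShape.sub s
  | .all h => .type .type ((HeadRel.all (.refl h)).sameHead nofun nofun)
  | .fn h h' => .type .type ((HeadRel.fn (.refl h) (.refl h')).sameHead nofun nofun)
  | .list h => .type .type ((HeadRel.list (.refl h)).sameHead nofun nofun)
  | .record h => .type .type ((HeadRel.record (.refl h)).sameHead nofun nofun)
  | .trace h => .type .type ((HeadRel.trace (.refl h)).sameHead nofun nofun)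
  | .rnil r _ => .row r .rnil
  | .rcons r h h' => .row r (.rcons (.refl (h.le r.field_le)) (h'.sameShape.sameFields r))

theorem Head.pushT {C : Con} (n : ∀ E, ¬ Whr C E) : Head (.T C) C.pushT := .T .refl n

theorem TyEq.sameShape {A B : Ty} {K : Kind} (h : TyEq Γ A B K) : SameShape Γ K A B := by
  induction h with
  | refl h => exact h.sameShape
  | symm _ ih => exact ih.symm
  | trans _ _ ih ih' => exact ih.trans ih'
  | sub _ s ih => exact ih.sub s
  | T_bool | T_int | T_string =>
    exact .type .baseType (.mk (.pushT nofun) (.refl nofun) (by constructor))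
  | T_list h => exact .type .type (.mk (.pushT nofun) (.refl nofun) (.list (.refl (.T .type h))))
  | T_record h =>
    exact .type .type (.mk (.pushT nofun) (.refl nofun) (.record (.refl (.T .row h))))
  | T_trace h =>
    exact .type .type (.mk (.pushT nofun) (.refl nofun) (.trace (.refl (.T .baseType h))))
  | T_rnil r w =>
    have h := TyKind.sameShape (.T r.row_ground (.rnil r w))
    exact .row r ((h.sameFields r).congr_right .T_rnil)
  | T_rcons r h h' =>
    exact .row r (((TyKind.sameShape (.T r.row_ground (.rcons r h h'))).sameFields r).congr_right
      .T_rcons)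
  | T_congr g e => exact e.logRel.sameShape g
  | list e => exact .type .type ((HeadRel.list e).sameHead nofun nofun)
  | record e => exact .type .type ((HeadRel.record e).sameHead nofun nofun)
  | trace e => exact .type .type ((HeadRel.trace e).sameHead nofun nofun)
  | fn e e' => exact .type .type ((HeadRel.fn e e').sameHead nofun nofun)
  | all e => exact .type .type ((HeadRel.all e).sameHead nofun nofun)
  | rnil r _ => exact .row r .rnil
  | rcons r e _ _ ih => exact .row r (.rcons (e.le r.field_le) (ih.sameFields r))
  | swap r n h h' hR =>
    exact .row r (((TyKind.sameShape (.rcons r h (.rcons r h' hR))).sameFields r).congr_right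
      (.swap n))

theorem TyEq.headRel {A B : Ty} (h : TyEq Γ A B .type) (hA : ∀ C, A ≠ .T C) (hB : ∀ C, B ≠ .T C) :
    HeadRel Γ A B := by
  obtain ⟨v, w, r⟩ := h.sameShape.sameHead .type
  rwa [v.deterministic (.refl hA), w.deterministic (.refl hB)] at r

theorem TyEq.fn_inj {A A' B B' : Ty} (h : TyEq Γ (.fn A B) (.fn A' B') .type) :
    TyEq Γ A A' .type ∧ TyEq Γ B B' .type := by
  cases h.headRel nofun nofun with
  | fn e e' => exact ⟨e, e'⟩

theorem TyEq.list_inj {A B : Ty} (h : TyEq Γ (.list A) (.list B) .type) : TyEq Γ A B .type := by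
  cases h.headRel nofun nofun with
  | list e => exact e

theorem TyEq.record_inj {R R' : Ty} (h : TyEq Γ (.record R) (.record R') .type) :
    TyEq Γ R R' .row := by
  cases h.headRel nofun nofun with
  | record e => exact e

theorem TyEq.trace_inj {A B : Ty} (h : TyEq Γ (.trace A) (.trace B) .type) :
    TyEq Γ A B .baseType := by
  cases h.headRel nofun nofun with
  | trace e => exact e

theorem TyEq.all_inj {K K' : Kind} {A B : Ty} (h : TyEq Γ (.all K A) (.all K' B) .type) :
    K = K' ∧ TyEq (.tvar Γ K) A B .type := by
  cases h.headRel nofun nofun with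
  | all e => exact ⟨rfl, e⟩

end

/-! ### Typing -/

section

variable {Γ : Ctx} {A B : Ty} {C D S : Con} {K : Kind} {M : Term}

theorem TRACE_kind (w : WfCtx Γ) : ConKind Γ TRACE (.arrow .type .type) := by
  have ext {Γ K} (w : WfCtx Γ) : WfCtx (.tvar Γ K) := .tvar w
  refine .lam (.typerec .type (.var (ext w) .here) (.trace (.bool (ext w)))
    (.trace (.int (ext w))) (.trace (.string (ext w))) (.lam (.lam (.list ?_)))
    (.lam (.lam (.record ?_))) (.lam (.lam ?_))) <;> exact .var (ext (ext (ext w))) .here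

theorem traced_eq (e : ConEq Γ C D .type) : TyEq Γ (traced C) (traced D) .type :=
  .T_congr .type (.app (.refl (TRACE_kind e.wf)) e)

theorem ifTy_eq (e : TyEq Γ A B .baseType) : TyEq Γ (ifTy A) (ifTy B) .type :=
  .record (.rcons .row (.refl (.trace (.bool e.wf))) (.rcons .row (.trace e) (.rnil .row e.wf)))

theorem forTy_eq (e : ConEq Γ C D .type) (e' : TyEq Γ A B .baseType) :
    TyEq Γ (forTy C A) (forTy D B) .type :=
  .record (.rcons .row (traced_eq e) (.rcons .row (.trace e') (.rnil .row e.wf)))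

theorem cellTy_eq (e : TyEq Γ A B .type) : TyEq Γ (cellTy A) (cellTy B) .type :=
  have string : TyEq Γ .string .string .type := .refl (.sub (.string e.wf) .base)
  have int : TyEq Γ .int .int .type := .refl (.sub (.int e.wf) .base)
  .record (.rcons .row string (.rcons .row string (.rcons .row int
    (.rcons .row e (.rnil .row e.wf)))))

theorem opEqTy_eq (e : ConEq Γ C D .type) : TyEq Γ (opEqTy C) (opEqTy D) .type :=
  .record (.rcons .row (traced_eq e) (.rcons .row (traced_eq e) (.rnil .row e.wf)))

theorem forTy_inst (C : Con) (A : Ty) : (forTy (.var 0) A.shift).inst C = forTy C A := by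
  change forTy C (A.shift.inst C) = _
  rw [Ty.shift_inst]

theorem forTy_subst (A : Ty) (σ : ℕ → Con) :
    (forTy (.var 0) A.shift).subst (upCon σ) = forTy (.var 0) (A.subst σ).shift := by
  rw [← Ty.shift_subst_upCon]; rfl

theorem ConKind.record_row (h : ConKind Γ (.record S) K) : ConKind Γ S .row :=
  let ⟨_, _, _, hS⟩ := h.generation
  hS

theorem Const.ty_kind {c : Const} (w : WfCtx Γ) : TyKind Γ c.ty .type := by
  cases c
  exacts [.sub (.bool w) .base, .sub (.int w) .base, .sub (.string w) .base]

theorem TyKind.of_closed (h : TyKind .nil A K) (w : WfCtx Γ) : TyKind Γ A K := by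
  simpa only [Ty.subst_var] using h.subst (σ := Con.var) ⟨w, nofun⟩

theorem Ctx.VarAt.kind {n : ℕ} (h : Γ.VarAt n A) (w : WfCtx Γ) : TyKind Γ A .type := by
  induction h with
  | here => exact w.of_var.addVar w.of_var
  | var _ ih => exact (ih w.of_var.wf).addVar w.of_var
  | tvar _ ih => cases w with | tvar w => exact (ih w).shift

theorem Typed.regular {Γ M A} : Typed Γ M A → TyKind Γ A .type
  | .const w => Const.ty_kind w
  | .var w h => h.kind w
  | .lam hA hM => .fn hA hM.regular.dropVar
  | .app hM _ => hM.regular.premises.2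
  | .tlam hM => .all hM.regular
  | .tapp hM hC => hM.regular.premises.inst hC
  | .fix hA _ => hA
  | .ite _ hM _ | .plus hM _ | .append hM _ | .rfold _ hM _ => hM.regular
  | .eq hM _ _ => .sub (.bool hM.regular.wf) .base
  | .table w hR =>
      .list (.record (.rcons .row (.sub (.int w) .base) (.sub (hR.of_closed w) .baseRow)))
  | .nil hA => .list hA
  | .single hM => .list hM.regular
  | .comp _ hN => hN.regular.dropVar
  | .rnil w => .record (.rnil .row w)
  | .rcons hM hN => .record (.rcons .row hM.regular hN.regular.premises)
  | .proj hM => hM.regular.premises.premises.1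
  | .conv _ e => e.regular.1
  | .rmap hC _ hN => .T .type (.record (.rmap hC hN.regular.premises.record_row))
  | .typecase hC hB .. => hB.inst hC
  | .trLit_bool h => .trace (.bool h.regular.wf)
  | .trLit_int h => .trace (.int h.regular.wf)
  | .trLit_string h => .trace (.string h.regular.wf)
  | .trIf hM | .trFor _ hM => hM.regular.premises.premises.2.premises.1
  | .trCell hA _ => .trace hA
  | .trOpEq hC _ => .trace (.bool hC.wf)
  | .trOpPlus hM => .trace (.int hM.regular.wf)
  | .tracecase _ hL .. => hL.regular.dropVar

theorem Typed.wf (h : Typed Γ M A) : WfCtx Γ := h.regular.wf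

theorem Typed.cast (h : Typed Γ M A) (e : A = B) : Typed Γ M B := e ▸ h

end

/-! ### Substitution in terms -/

section

variable {Γ Γ' : Ctx} {A A' B : Ty} {C : Con} {K : Kind} {M N : Term} {σ : ℕ → Con}
  {τ : ℕ → Term} {ξ ζ : ℕ → ℕ}

theorem upTm_var_comp (ζ : ℕ → ℕ) : upTm (Term.var ∘ ζ) = Term.var ∘ upRen ζ := by
  funext n; cases n <;> rfl

theorem wkTm_var_comp (ζ : ℕ → ℕ) : wkTm (Term.var ∘ ζ) = Term.var ∘ ζ := rfl

theorem Term.rename_eq_subst (M : Term) (ξ ζ : ℕ → ℕ) :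
    M.rename ξ ζ = M.subst (Con.var ∘ ξ) (Term.var ∘ ζ) := by
  induction M generalizing ξ ζ <;>
    simp_all [Term.rename, Term.subst, upCon_var_comp, upTm_var_comp, wkTm_var_comp,
      Con.rename_eq_subst, Ty.rename_eq_subst]

/-- A class of simultaneous substitutions that is closed under binders and whose members preserve
the kinds of type variables and the types of term variables. Typing is stable first under the class
of renamings, and the weakening this provides makes all well-typed substitutions a class too. -/
structure SubstClass (E : Ctx → Ctx → (ℕ → Con) → (ℕ → Term) → Prop) : Prop where
  con : ∀ {Γ Γ' σ τ}, E Γ Γ' σ τ → ConSub Γ Γ' σ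
  tm : ∀ {Γ Γ' σ τ n A}, E Γ Γ' σ τ → Γ.VarAt n A → Typed Γ' (τ n) (A.subst σ)
  upVar : ∀ {Γ Γ' σ τ A}, E Γ Γ' σ τ → TyKind Γ A .type →
    E (.var Γ A) (.var Γ' (A.subst σ)) σ (upTm τ)
  upTVar : ∀ {Γ Γ' σ τ K}, E Γ Γ' σ τ → E (.tvar Γ K) (.tvar Γ' K) (upCon σ) (wkTm τ)

theorem Typed.substOf {E} (hE : SubstClass E) (h : Typed Γ M A) (e : E Γ Γ' σ τ) :
    Typed Γ' (M.subst σ τ) (A.subst σ) := by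
  induction h generalizing Γ' σ τ with
  | @const _ c => cases c <;> exact .const (hE.con e).wf
  | var _ hn => exact hE.tm e hn
  | lam hA _ ih => exact .lam (hA.subst (hE.con e)) (ih (hE.upVar e hA))
  | app _ _ ih ih' => exact .app (ih e) (ih' e)
  | tlam _ ih => exact .tlam (ih (hE.upTVar e))
  | tapp _ hC ih => exact (Typed.tapp (ih e) (hC.subst (hE.con e))).cast (Ty.inst_subst ..).symm
  | fix hA _ ih => exact .fix (hA.subst (hE.con e)) (ih (hE.upVar e hA))
  | ite _ _ _ ih ih' ih'' => exact .ite (ih e) (ih' e) (ih'' e)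
  | plus _ _ ih ih' => exact .plus (ih e) (ih' e)
  | eq _ _ hA ih ih' => exact .eq (ih e) (ih' e) (hA.subst (hE.con e))
  | table _ hR => exact .table (hE.con e).wf (hR.subst ⟨.nil, nofun⟩)
  | nil hA => exact .nil (hA.subst (hE.con e))
  | single _ ih => exact .single (ih e)
  | append _ _ ih ih' => exact .append (ih e) (ih' e)
  | comp _ hN ih ih' => exact .comp (ih e) (ih' (hE.upVar e hN.wf.of_var))
  | rnil => exact .rnil (hE.con e).wf
  | rcons _ _ ih ih' => exact .rcons (ih e) (ih' e)
  | proj _ ih => exact .proj (ih e)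
  | conv _ q ih => exact .conv (ih e) (q.subst (hE.con e))
  | rmap hC _ _ ih ih' =>
    exact .rmap (hC.subst (hE.con e))
      ((ih e).cast (by simp only [Ty.subst, Con.subst, Con.shift_subst_upCon]; rfl)) (ih' e)
  | rfold _ _ _ ih ih' ih'' =>
    exact .rfold (ih e) (ih' e)
      ((ih'' e).cast (by simp only [Ty.subst, Con.subst, Con.shift_subst_upCon]))
  | typecase hC hB _ _ _ _ _ _ iB iI iS iL iR iT =>
    exact (Typed.typecase (hC.subst (hE.con e)) (hB.subst (hE.con e).up)
      ((iB e).cast (Ty.inst_subst ..)) ((iI e).cast (Ty.inst_subst ..))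
      ((iS e).cast (Ty.inst_subst ..)) ((iL (hE.upTVar e)).cast (Ty.instUnder_subst ..))
      ((iR (hE.upTVar e)).cast (Ty.instUnder_subst ..))
      ((iT (hE.upTVar e)).cast (Ty.instUnder_subst ..))).cast (Ty.inst_subst ..).symm
  | trLit_bool _ ih => exact .trLit_bool (ih e)
  | trLit_int _ ih => exact .trLit_int (ih e)
  | trLit_string _ ih => exact .trLit_string (ih e)
  | trIf _ ih => exact .trIf (ih e)
  | trFor hC _ ih => exact .trFor (hC.subst (hE.con e)) (ih e)
  | trCell hA _ ih => exact .trCell (hA.subst (hE.con e)) (ih e)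
  | trOpEq hC _ ih => exact .trOpEq (hC.subst (hE.con e)) (ih e)
  | trOpPlus _ ih => exact .trOpPlus (ih e)
  | tracecase _ hL hI hF hC hE' hP ih iL iI iF iC iE iP =>
    have iF := iF (hE.upVar (hE.upTVar e) hF.wf.of_var)
    have iE := iE (hE.upVar (hE.upTVar e) hE'.wf.of_var)
    rw [forTy_subst, Ty.shift_subst_upCon] at iF
    rw [Ty.shift_subst_upCon] at iE
    exact .tracecase (ih e) (iL (hE.upVar e hL.wf.of_var)) (iI (hE.upVar e hI.wf.of_var)) iF
      (iC (hE.upVar e hC.wf.of_var)) iE (iP (hE.upVar e hP.wf.of_var))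

/-- Variables of `Γ` are renamed by `ξ` and `ζ` to variables of `Γ'` of the same kind or type. -/
structure TmRen (Γ Γ' : Ctx) (ξ ζ : ℕ → ℕ) : Prop where
  con : Ren Γ Γ' ξ
  var : ∀ {n A}, Γ.VarAt n A → Γ'.VarAt (ζ n) (A.rename ξ)

theorem Ren.upVar (h : Ren Γ Γ' ξ) (hA : TyKind Γ A .type) (hB : TyKind Γ' B .type) :
    Ren (.var Γ A) (.var Γ' B) ξ :=
  ((dropVar (.var hA)).comp h).comp (addVar (.var hB))

theorem TmRen.upVar (h : TmRen Γ Γ' ξ ζ) (hA : TyKind Γ A .type) :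
    TmRen (.var Γ A) (.var Γ' (A.rename ξ)) ξ (upRen ζ) where
  con := h.con.upVar hA (hA.rename h.con)
  var
    | .here => .here
    | .var hn => .var (h.var hn)

theorem TmRen.upTVar (h : TmRen Γ Γ' ξ ζ) : TmRen (.tvar Γ K) (.tvar Γ' K) (upRen ξ) ζ where
  con := h.con.up
  var
    | .tvar (A := A) hn => by
      have : A.shift.rename (upRen ξ) = (A.rename ξ).shift := by
        simp only [Ty.rename_eq_subst, ← upCon_var_comp, Ty.shift_subst_upCon]
      rw [this]
      exact .tvar (h.var hn)

theorem TmRen.succ (hA : TyKind Γ A .type) : TmRen Γ (.var Γ A) id Nat.succ :=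
  ⟨.addVar (.var hA), fun hn => by rw [Ty.rename_id]; exact .var hn⟩

theorem TmRen.substClass : SubstClass fun Γ Γ' σ τ =>
    ∃ ξ ζ : ℕ → ℕ, σ = Con.var ∘ ξ ∧ τ = Term.var ∘ ζ ∧ TmRen Γ Γ' ξ ζ where
  con := fun ⟨_, _, hσ, _, h⟩ => hσ ▸ h.con.conSub
  tm := by
    rintro _ _ _ _ _ _ ⟨ξ, ζ, rfl, rfl, h⟩ hn
    rw [← Ty.rename_eq_subst]
    exact .var h.con.wf (h.var hn)
  upVar := by
    rintro _ _ _ _ _ ⟨ξ, ζ, rfl, rfl, h⟩ hA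
    rw [← Ty.rename_eq_subst]
    exact ⟨ξ, upRen ζ, rfl, upTm_var_comp ζ, h.upVar hA⟩
  upTVar := by
    rintro _ _ _ _ _ ⟨ξ, ζ, rfl, rfl, h⟩
    exact ⟨upRen ξ, ζ, upCon_var_comp ξ, wkTm_var_comp ζ, h.upTVar⟩

theorem Typed.rename (h : Typed Γ M A) (hζ : TmRen Γ Γ' ξ ζ) :
    Typed Γ' (M.rename ξ ζ) (A.rename ξ) := by
  rw [Term.rename_eq_subst, Ty.rename_eq_subst]
  exact h.substOf TmRen.substClass ⟨ξ, ζ, rfl, rfl, hζ⟩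

theorem Typed.addVar (h : Typed Γ M A) (hB : TyKind Γ B .type) :
    Typed (.var Γ B) (M.rename id Nat.succ) A :=
  (h.rename (.succ hB)).cast A.rename_id

theorem Typed.shift (h : Typed Γ M A) : Typed (.tvar Γ K) (M.rename Nat.succ id) A.shift :=
  h.rename ⟨.succ h.wf, .tvar⟩

theorem Typed.shiftUnder (h : Typed (.var Γ A) M B) (hA' : TyKind Γ A' .type) :
    Typed (.var (.var Γ A') A) M.shiftUnder B := by
  have hM := h.rename ((TmRen.succ hA').upVar h.wf.of_var)
  rwa [Ty.rename_id, Ty.rename_id] at hM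

theorem ConSub.dropVar (h : ConSub Γ Γ' σ) : ConSub (.var Γ A) Γ' σ :=
  ⟨h.wf, fun | .var hn => h.tvar hn⟩

theorem ConSub.addVar (h : ConSub Γ Γ' σ) (hA : TyKind Γ' A .type) : ConSub Γ (.var Γ' A) σ :=
  ⟨.var hA, fun hn => by simpa only [Con.rename_id] using (h.tvar hn).rename (.addVar (.var hA))⟩

/-- `σ` and `τ` map the variables of `Γ` to constructors and terms over `Γ'` of the same kind or
type. -/
structure TmSub (Γ Γ' : Ctx) (σ : ℕ → Con) (τ : ℕ → Term) : Prop where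
  con : ConSub Γ Γ' σ
  tm : ∀ {n A}, Γ.VarAt n A → Typed Γ' (τ n) (A.subst σ)

theorem TmSub.id (w : WfCtx Γ) : TmSub Γ Γ Con.var Term.var :=
  ⟨.id w, fun hn => (Typed.var w hn).cast (Ty.subst_var _).symm⟩

theorem TmSub.scons (h : TmSub Γ Γ' σ τ) (hN : Typed Γ' N (A.subst σ)) :
    TmSub (.var Γ A) Γ' σ (LinksT.scons N τ) where
  con := h.con.dropVar
  tm
    | .here => hN
    | .var hn => h.tm hn

theorem TmSub.sconsCon (h : TmSub Γ Γ' σ τ) (hC : ConKind Γ' C K) :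
    TmSub (.tvar Γ K) Γ' (LinksT.scons C σ) τ where
  con := h.con.scons hC
  tm
    | .tvar hn => (h.tm hn).cast (Ty.shift_subst_scons ..).symm

theorem TmSub.substClass : SubstClass TmSub where
  con h := h.con
  tm h hn := h.tm hn
  upVar {Γ Γ' σ τ A} h hA :=
    have hA' := hA.subst h.con
    have h' : TmSub Γ (.var Γ' (A.subst σ)) σ fun n => (τ n).rename _root_.id Nat.succ :=
      ⟨h.con.addVar hA', fun hn => (h.tm hn).addVar hA'⟩
    h'.scons (.var (.var hA') .here)
  upTVar h :=
    { con := h.con.up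
      tm := fun | .tvar hn => (h.tm hn).shift.cast (Ty.shift_subst_upCon ..).symm }

theorem Typed.subst (h : Typed Γ M A) (hτ : TmSub Γ Γ' σ τ) :
    Typed Γ' (M.subst σ τ) (A.subst σ) :=
  h.substOf TmSub.substClass hτ

theorem Typed.instTm (h : Typed (.var Γ A) M B) (hN : Typed Γ N A) : Typed Γ (M.instTm N) B :=
  (h.subst ((TmSub.id hN.wf).scons (hN.cast A.subst_var.symm))).cast B.subst_var

theorem Typed.instTy (h : Typed (.tvar Γ K) M B) (hC : ConKind Γ C K) :
    Typed Γ (M.instTy C) (B.inst C) :=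
  h.subst ((TmSub.id hC.wf).sconsCon hC)

theorem Typed.instBoth (h : Typed (.var (.tvar Γ K) A) M B.shift) (hC : ConKind Γ C K)
    (hN : Typed Γ N (A.inst C)) : Typed Γ (M.instBoth C N) B :=
  (h.subst (((TmSub.id hC.wf).sconsCon hC).scons hN)).cast (B.shift_inst C)

end

/-! ### Generation -/

section

variable {Γ : Ctx} {A B : Ty} {M : Term}

/-- The premises of the typing rule for the head former of a term, together with the equivalence of
the given type to the one in the conclusion of the rule where this says more than the premises.
Only formers whose subterms are taken apart by some reduction rule are covered. -/
def Typed.Premises (Γ : Ctx) : Term → Ty → Prop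
  | .lam A M, C => ∃ B, TyEq Γ C (.fn A B) .type ∧ Typed (.var Γ A) M B
  | .tlam K M, C => ∃ A, TyEq Γ C (.all K A) .type ∧ Typed (.tvar Γ K) M A
  | .ite L M N, C => Typed Γ L .bool ∧ Typed Γ M C ∧ Typed Γ N C
  | .single M, C => ∃ A, TyEq Γ C (.list A) .type ∧ Typed Γ M A
  | .append M N, C => Typed Γ M C ∧ Typed Γ N C
  | .comp M N, C => ∃ A B, TyEq Γ C (.list B) .type ∧ Typed Γ M (.list A) ∧
      Typed (.var Γ A) N (.list B)
  | .rcons l M N, C => ∃ A R, TyEq Γ C (.record (.rcons l A R)) .type ∧ Typed Γ M A ∧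
      Typed Γ N (.record R)
  | .trLit M, C => ∃ A, TyEq Γ C (.trace A) .type ∧ Typed Γ M A
  | .trIf M, C => ∃ A, TyEq Γ C (.trace A) .type ∧ Typed Γ M (ifTy A)
  | .trFor D M, C => ∃ A, TyEq Γ C (.trace A) .type ∧ ConKind Γ D .type ∧ Typed Γ M (forTy D A)
  | .trCell M, C => ∃ A, TyEq Γ C (.trace A) .type ∧ Typed Γ M (cellTy A)
  | .trOpEq D M, _ => ConKind Γ D .baseType ∧ Typed Γ M (opEqTy D)
  | .trOpPlus M, _ => Typed Γ M opPlusTy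
  | _, _ => True

theorem Typed.Premises.conv (h : Premises Γ M B) (e : TyEq Γ A B .type) : Premises Γ M A := by
  cases M with
  | lam | tlam | single | trLit | trIf | trFor | trCell =>
    obtain ⟨A, e', h⟩ := h
    exact ⟨A, e.trans e', h⟩
  | comp | rcons =>
    obtain ⟨A, B, e', h⟩ := h
    exact ⟨A, B, e.trans e', h⟩
  | ite => exact ⟨h.1, .conv h.2.1 e, .conv h.2.2 e⟩
  | append => exact ⟨.conv h.1 e, .conv h.2 e⟩
  | trOpEq | trOpPlus => exact h
  | _ => trivial

theorem Typed.premises (h : Typed Γ M A) : Premises Γ M A := by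
  have e : TyEq Γ A A .type := .refl h.regular
  induction h with
  | lam _ hM => exact ⟨_, e, hM⟩
  | tlam hM => exact ⟨_, e, hM⟩
  | ite hL hM hN => exact ⟨hL, hM, hN⟩
  | single hM => exact ⟨_, e, hM⟩
  | append hM hN => exact ⟨hM, hN⟩
  | comp hM hN => exact ⟨_, _, e, hM, hN⟩
  | rcons hM hN => exact ⟨_, _, e, hM, hN⟩
  | trLit_bool h | trLit_int h | trLit_string h => exact ⟨_, e, h⟩
  | trIf hM => exact ⟨_, e, hM⟩
  | trFor hC hM => exact ⟨_, e, hC, hM⟩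
  | trCell _ hM => exact ⟨_, e, hM⟩
  | trOpEq hC hM => exact ⟨hC, hM⟩
  | trOpPlus hM => exact hM
  | conv hM q ih => exact (ih (.refl hM.regular)).conv q
  | _ => trivial

end

/-! ### Records -/

section

variable {Γ : Ctx} {A R R' : Ty} {C F S : Con} {K : Kind} {L M N P : Term} {l : Label}
  {f : Label → Option Ty} {fs : List (Label × Con)}

theorem SameFields.exists_field (h : SameFields Γ R R') (v : TyRowView R f) (hf : f l = some A) :
    ∃ g B, TyRowView R' g ∧ g l = some B ∧ TyEq Γ A B .type := by
  obtain @⟨_, g, v', w, same⟩ := h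
  have same_l := same l
  rw [v'.deterministic v, hf] at same_l
  generalize hg : g l = b at same_l
  cases same_l with
  | some e => exact ⟨_, _, w, hg, e⟩

open Classical in
theorem Typed.field (h : FieldOf l P M) (hP : Typed Γ P (.record R)) (v : TyRowView R f)
    (hf : f l = some A) : Typed Γ M A := by
  induction h generalizing R f A with
  | here =>
    obtain ⟨_, _, q, hM, _⟩ := hP.premises
    obtain ⟨_, _, w, hg, e⟩ := (q.record_inj.sameShape.sameFields .row).exists_field v hf
    cases w
    rw [Function.update_self] at hg
    cases hg
    exact hM.conv e
  | there n _ ih =>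
    obtain ⟨_, _, q, _, hN⟩ := hP.premises
    obtain ⟨_, _, w, hg, e⟩ := (q.record_inj.sameShape.sameFields .row).exists_field v hf
    cases w with | rcons w =>
    rw [Function.update_of_ne n.symm] at hg
    exact (ih hN w hg).conv e

open Classical in
theorem Typed.proj_field (h : FieldOf l P M) (hP : Typed Γ P (.record (.rcons l A R))) :
    Typed Γ M A := by
  obtain ⟨v, _, _⟩ := hP.regular.premises.sameShape.sameFields .row
  refine hP.field h v ?_
  cases v
  exact Function.update_self ..

theorem ConKind.rcons_parts (h : ConKind Γ (.rcons l C S) K) :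
    ConKind Γ C .type ∧ ConKind Γ S .row :=
  let ⟨_, _, _, r, hC, hS⟩ := h.generation
  ⟨hC.le r.field_le, hS.le r.row_le⟩

theorem ConKind.rmap_parts (h : ConKind Γ (.rmap C S) K) :
    ConKind Γ C (.arrow .type .type) ∧ ConKind Γ S .row :=
  let ⟨_, _, _, hC, hS⟩ := h.generation
  ⟨hC, hS⟩

theorem ConKind.of_mem_fields {p : Label × Con} (h : ConKind Γ (Con.ofFields fs) .row)
    (m : p ∈ fs) : ConKind Γ p.2 .type := by
  induction fs with
  | nil => cases m
  | cons q fs ih =>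
    rcases List.mem_cons.1 m with rfl | m
    · exact (ConKind.rcons_parts h).1
    · exact ih (ConKind.rcons_parts h).2 m

theorem ConEq.exists_rcons_of_mem (h : ConKind Γ (Con.ofFields fs) .row)
    (d : (fs.map Prod.fst).Nodup) (m : (l, C) ∈ fs) :
    ∃ S, ConEq Γ (Con.ofFields fs) (.rcons l C S) .row := by
  induction fs with
  | nil => cases m
  | cons p fs ih =>
    rw [List.map_cons, List.nodup_cons] at d
    rcases List.mem_cons.1 m with rfl | m
    · exact ⟨_, .refl h⟩
    · obtain ⟨hD, hS⟩ := ConKind.rcons_parts h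
      obtain ⟨S, e⟩ := ih hS d.2 m
      obtain ⟨hC, hS'⟩ := e.regular.2.rcons_parts
      have n : p.1 ≠ l := fun eq => d.1 (eq ▸ List.mem_map_of_mem m)
      exact ⟨_, (ConEq.rcons .row (.refl hD) e).trans (.swap .row n hD hC hS')⟩

theorem Typed.proj_ofFields (hN : Typed Γ N (.T (.record S)))
    (e : ConEq Γ S (Con.ofFields fs) .row) (d : (fs.map Prod.fst).Nodup) (m : (l, C) ∈ fs) :
    Typed Γ (.proj N l) (.T C) := by
  obtain ⟨S', e'⟩ := ConEq.exists_rcons_of_mem e.regular.2 d m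
  obtain ⟨hC, hS'⟩ := e'.regular.2.rcons_parts
  have q : TyEq Γ (.T (.record S)) (.record (.rcons l (.T C) (.T S'))) .type :=
    (TyEq.T_congr .type (.record (e.trans e'))).trans <|
      (TyEq.T_record e'.regular.2).trans (.record (.T_rcons .row hC hS'))
  exact .proj (hN.conv q.symm)

/-- The fields of `Rmap F S` for the closed row `S` with fields `fs`. -/
def mapFields (F : Con) (fs : List (Label × Con)) : List (Label × Con) :=
  fs.map fun p => (p.1, .app F p.2)

theorem mapFields_labels : (mapFields F fs).map Prod.fst = fs.map Prod.fst := by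
  simp [mapFields]

theorem ConEq.rmap_ofFields (hF : ConKind Γ F (.arrow .type .type))
    (h : ConKind Γ (Con.ofFields fs) .row) :
    ConEq Γ (.rmap F (Con.ofFields fs)) (Con.ofFields (mapFields F fs)) .row := by
  induction fs with
  | nil => exact ConStep.rmap_rnil.conEq (.rmap hF h)
  | cons p fs ih =>
    obtain ⟨hC, hS⟩ := ConKind.rcons_parts h
    exact (ConStep.rmap_rcons.conEq (.rmap hF h)).trans
      (.rcons .row (.refl (.app hF hC)) (ih hS))

theorem Typed.unrollMap (hF : ConKind Γ F (.arrow .type .type))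
    (hM : Typed Γ M (.all .type (.fn (.T (.var 0)) (.T (.app F.shift (.var 0))))))
    (h : ∀ p ∈ fs, ConKind Γ p.2 .type ∧ Typed Γ (.proj N p.1) (.T p.2)) :
    Typed Γ (LinksT.unrollMap M N fs) (.record (.T (Con.ofFields (mapFields F fs)))) := by
  induction fs with
  | nil => exact .conv (.rnil hF.wf) (.record (.T_rnil .row hF.wf))
  | cons p fs ih =>
    obtain ⟨hC, hN⟩ := h p List.mem_cons_self
    have tail := ih fun q m => h q (List.mem_cons_of_mem _ m)
    have hM : Typed Γ _ (.fn (.T p.2) (.T (.app (F.shift.inst p.2) p.2))) := hM.tapp hC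
    rw [Con.shift_inst] at hM
    exact .conv (.rcons (.app hM hN) tail)
      (.record (.T_rcons .row (.app hF hC) tail.regular.premises.premises))

theorem Typed.unrollFold (hL : Typed Γ L (.fn A (.fn A A))) (hM : Typed Γ M A)
    (h : ∀ p ∈ fs, Typed Γ (.proj N p.1) A) : Typed Γ (LinksT.unrollFold L M N fs) A := by
  induction fs with
  | nil => exact hM
  | cons p fs ih =>
    exact .app (.app hL (h p List.mem_cons_self)) (ih fun q m => h q (List.mem_cons_of_mem _ m))

theorem Typed.rmap_unroll (d : (fs.map Prod.fst).Nodup) (hF : ConKind Γ F (.arrow .type .type))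
    (hM : Typed Γ M (.all .type (.fn (.T (.var 0)) (.T (.app F.shift (.var 0))))))
    (hN : Typed Γ N (.T (.record (Con.ofFields fs)))) :
    Typed Γ (LinksT.unrollMap M N fs) (.T (.record (.rmap F (Con.ofFields fs)))) := by
  have hS := hN.regular.premises.record_row
  have e := ConEq.rmap_ofFields hF hS
  have hM := hM.unrollMap hF fun p m => ⟨hS.of_mem_fields m, hN.proj_ofFields (.refl hS) d m⟩
  exact hM.conv ((TyEq.T_congr .type (.record e)).trans (.T_record e.regular.2))

theorem Typed.rfold_unroll (d : (fs.map Prod.fst).Nodup)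
    (hL : Typed Γ L (.fn (.T C) (.fn (.T C) (.T C)))) (hM : Typed Γ M (.T C))
    (hN : Typed Γ N (.T (.record (.rmap (.lam .type C.shift) (Con.ofFields fs))))) :
    Typed Γ (LinksT.unrollFold L M N fs) (.T C) := by
  obtain ⟨hF, hS⟩ := hN.regular.premises.record_row.rmap_parts
  refine hL.unrollFold hM fun p m => ?_
  have hp := hN.proj_ofFields (ConEq.rmap_ofFields hF hS) (mapFields_labels.symm ▸ d)
    (List.mem_map_of_mem m)
  have e := (ConStep.beta (K := .type) (C := C.shift) (D := p.2)).conEq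
    (.app hF (hS.of_mem_fields m))
  rw [Con.shift_inst] at e
  exact hp.conv (.symm (.T_congr .type e))

end

/-! ### Preservation -/

section

variable {Γ : Ctx} {A B : Ty} {C S : Con} {K : Kind} {l : Label}
  {L M N MB MI MS ML MR MT MF MC ME MP : Term}

/-- Every term that `M` reduces to in one step has type `A` in `Γ`. -/
def Preserves (Γ : Ctx) (M : Term) (A : Ty) : Prop :=
  ∀ ⦃M'⦄, Step M M' → Typed Γ M' A

theorem Preserves.app (hM : Typed Γ M (.fn A B)) (hN : Typed Γ N A)
    (pM : Preserves Γ M (.fn A B)) (pN : Preserves Γ N A) : Preserves Γ (.app M N) B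
  | _, .beta =>
    let ⟨_, q, hM⟩ := hM.premises
    (hM.instTm (hN.conv q.fn_inj.1.symm)).conv q.fn_inj.2
  | _, .app_ite =>
    let ⟨hL, h₁, h₂⟩ := hM.premises
    .ite hL (.app h₁ hN) (.app h₂ hN)
  | _, .app_fun s => .app (pM s) hN
  | _, .app_arg s => .app hM (pN s)

theorem Preserves.tapp (hM : Typed Γ M (.all K A)) (hC : ConKind Γ C K)
    (pM : Preserves Γ M (.all K A)) : Preserves Γ (.tapp M C) (A.inst C)
  | _, .tbeta => by
    obtain ⟨_, e, hM⟩ := hM.premises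
    obtain ⟨rfl, q⟩ := e.all_inj
    exact (hM.instTy hC).conv (q.inst hC)
  | _, .tapp_ite =>
    let ⟨hL, h₁, h₂⟩ := hM.premises
    .ite hL (.tapp h₁ hC) (.tapp h₂ hC)
  | _, .tapp_fun s => .tapp (pM s) hC
  | _, .tapp_arg s => .conv (.tapp hM (s.kind hC)) (hM.regular.premises.inst_eq (s.conEq hC))

theorem Preserves.ite (hL : Typed Γ L .bool) (hM : Typed Γ M A) (hN : Typed Γ N A)
    (pL : Preserves Γ L .bool) (pM : Preserves Γ M A) (pN : Preserves Γ N A) :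
    Preserves Γ (.ite L M N) A
  | _, .ite_true => hM
  | _, .ite_false => hN
  | _, .ite_ite =>
    let ⟨hL, h₁, h₂⟩ := hL.premises
    .ite hL (.ite h₁ hM hN) (.ite h₂ hM hN)
  | _, .ite_cond s => .ite (pL s) hM hN
  | _, .ite_then s => .ite hL (pM s) hN
  | _, .ite_else s => .ite hL hM (pN s)

theorem Preserves.comp (hM : Typed Γ M (.list A)) (hN : Typed (.var Γ A) N (.list B))
    (pM : Preserves Γ M (.list A)) (pN : Preserves (.var Γ A) N (.list B)) :
    Preserves Γ (.comp M N) (.list B)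
  | _, .comp_nil => .nil hN.regular.dropVar.premises
  | _, .comp_single =>
    let ⟨_, q, hM⟩ := hM.premises
    hN.instTm (hM.conv q.list_inj)
  | _, .comp_append =>
    let ⟨h₁, h₂⟩ := hM.premises
    .append (.comp h₁ hN) (.comp h₂ hN)
  | _, .comp_comp =>
    let ⟨_, _, q, hL, hM⟩ := hM.premises
    .comp hL (.comp (hM.conv (q.addVar hM.wf.of_var)) (hN.shiftUnder hM.wf.of_var))
  | _, .comp_ite =>
    let ⟨hL, h₁, h₂⟩ := hM.premises
    .ite hL (.comp h₁ hN) (.comp h₂ hN)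
  | _, .comp_src s => .comp (pM s) hN
  | _, .comp_body s => .comp hM (pN s)

theorem Preserves.proj {R : Ty} (hM : Typed Γ M (.record (.rcons l A R)))
    (pM : Preserves Γ M (.record (.rcons l A R))) : Preserves Γ (.proj M l) A
  | _, .proj_record f => hM.proj_field f
  | _, .proj_ite =>
    let ⟨hL, h₁, h₂⟩ := hM.premises
    .ite hL (.proj h₁) (.proj h₂)
  | _, .proj s => .proj (pM s)

theorem Preserves.rmap (hC : ConKind Γ C (.arrow .type .type))
    (hM : Typed Γ M (.all .type (.fn (.T (.var 0)) (.T (.app C.shift (.var 0))))))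
    (hN : Typed Γ N (.T (.record S)))
    (pM : Preserves Γ M (.all .type (.fn (.T (.var 0)) (.T (.app C.shift (.var 0))))))
    (pN : Preserves Γ N (.T (.record S))) :
    Preserves Γ (.rmap S M N) (.T (.record (.rmap C S)))
  | _, .rmap_unroll d => hM.rmap_unroll d hC hN
  | _, .rmap_row s =>
    have e := s.conEq hN.regular.premises.record_row
    .conv (.rmap hC hM (hN.conv (.T_congr .type (.record e.symm))))
      (.T_congr .type (.record (.rmap (.refl hC) e)))
  | _, .rmap_fun s => .rmap hC (pM s) hN
  | _, .rmap_arg s => .rmap hC hM (pN s)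

theorem Preserves.rfold (hL : Typed Γ L (.fn (.T C) (.fn (.T C) (.T C))))
    (hM : Typed Γ M (.T C)) (hN : Typed Γ N (.T (.record (.rmap (.lam .type C.shift) S))))
    (pL : Preserves Γ L (.fn (.T C) (.fn (.T C) (.T C)))) (pM : Preserves Γ M (.T C))
    (pN : Preserves Γ N (.T (.record (.rmap (.lam .type C.shift) S)))) :
    Preserves Γ (.rfold S L M N) (.T C)
  | _, .rfold_unroll d => hL.rfold_unroll d hM hN
  | _, .rfold_row s =>
    let ⟨hF, hS⟩ := hN.regular.premises.record_row.rmap_parts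
    .rfold hL hM (hN.conv (.T_congr .type (.record (.rmap (.refl hF) (s.conEq hS).symm))))
  | _, .rfold_fun s => .rfold (pL s) hM hN
  | _, .rfold_init s => .rfold hL (pM s) hN
  | _, .rfold_arg s => .rfold hL hM (pN s)

theorem Preserves.typecase (hC : ConKind Γ C .type) (hB : TyKind (.tvar Γ .type) B .type)
    (hMB : Typed Γ MB (B.inst .bool)) (hMI : Typed Γ MI (B.inst .int))
    (hMS : Typed Γ MS (B.inst .string))
    (hML : Typed (.tvar Γ .type) ML (B.instUnder (.list (.var 0))))
    (hMR : Typed (.tvar Γ .row) MR (B.instUnder (.record (.var 0))))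
    (hMT : Typed (.tvar Γ .baseType) MT (B.instUnder (.trace (.var 0))))
    (pB : Preserves Γ MB (B.inst .bool)) (pI : Preserves Γ MI (B.inst .int))
    (pS : Preserves Γ MS (B.inst .string))
    (pL : Preserves (.tvar Γ .type) ML (B.instUnder (.list (.var 0))))
    (pR : Preserves (.tvar Γ .row) MR (B.instUnder (.record (.var 0))))
    (pT : Preserves (.tvar Γ .baseType) MT (B.instUnder (.trace (.var 0)))) :
    Preserves Γ (.typecase C MB MI MS ML MR MT) (B.inst C)
  | _, .typecase_bool => hMB
  | _, .typecase_int => hMI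
  | _, .typecase_string => hMS
  | _, .typecase_list =>
    let ⟨_, _, _, hC⟩ := hC.generation
    (hML.instTy hC).cast (Ty.instUnder_inst ..)
  | _, .typecase_record => (hMR.instTy hC.record_row).cast (Ty.instUnder_inst ..)
  | _, .typecase_trace =>
    let ⟨_, _, _, hC⟩ := hC.generation
    (hMT.instTy hC).cast (Ty.instUnder_inst ..)
  | _, .typecase_scrut s =>
    .conv (.typecase (s.kind hC) hB hMB hMI hMS hML hMR hMT) (hB.inst_eq (s.conEq hC))
  | _, .typecase_B s => .typecase hC hB (pB s) hMI hMS hML hMR hMT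
  | _, .typecase_I s => .typecase hC hB hMB (pI s) hMS hML hMR hMT
  | _, .typecase_S s => .typecase hC hB hMB hMI (pS s) hML hMR hMT
  | _, .typecase_L s => .typecase hC hB hMB hMI hMS (pL s) hMR hMT
  | _, .typecase_R s => .typecase hC hB hMB hMI hMS hML (pR s) hMT
  | _, .typecase_T s => .typecase hC hB hMB hMI hMS hML hMR (pT s)

theorem Preserves.trFor (hC : ConKind Γ C .type) (hM : Typed Γ M (forTy C A))
    (pM : Preserves Γ M (forTy C A)) : Preserves Γ (.trFor C M) (.trace A)
  | _, .trFor_con s =>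
    have hA : TyKind Γ A .baseType := (Typed.trFor hC hM).regular.premises
    .trFor (s.kind hC) (hM.conv (forTy_eq (s.conEq hC).symm (.refl hA)))
  | _, .trFor s => .trFor hC (pM s)

theorem Preserves.trOpEq (hC : ConKind Γ C .baseType) (hM : Typed Γ M (opEqTy C))
    (pM : Preserves Γ M (opEqTy C)) : Preserves Γ (.trOpEq C M) (.trace .bool)
  | _, .trOpEq_con s =>
    .trOpEq (s.kind hC) (hM.conv (opEqTy_eq (.sub (s.conEq hC).symm .base)))
  | _, .trOpEq s => .trOpEq hC (pM s)

theorem Preserves.tracecase (hM : Typed Γ M (.trace A)) (hL : Typed (.var Γ A) ML B)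
    (hI : Typed (.var Γ (ifTy A)) MI B)
    (hF : Typed (.var (.tvar Γ .type) (forTy (.var 0) A.shift)) MF B.shift)
    (hC : Typed (.var Γ (cellTy A)) MC B)
    (hE : Typed (.var (.tvar Γ .baseType) (opEqTy (.var 0))) ME B.shift)
    (hP : Typed (.var Γ opPlusTy) MP B) (pM : Preserves Γ M (.trace A))
    (pL : Preserves (.var Γ A) ML B) (pI : Preserves (.var Γ (ifTy A)) MI B)
    (pF : Preserves (.var (.tvar Γ .type) (forTy (.var 0) A.shift)) MF B.shift)
    (pC : Preserves (.var Γ (cellTy A)) MC B)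
    (pE : Preserves (.var (.tvar Γ .baseType) (opEqTy (.var 0))) ME B.shift)
    (pP : Preserves (.var Γ opPlusTy) MP B) :
    Preserves Γ (.tracecase M ML MI MF MC ME MP) B
  | _, .tracecase_lit =>
    let ⟨_, q, hM⟩ := hM.premises
    hL.instTm (hM.conv (.sub q.trace_inj .base))
  | _, .tracecase_if =>
    let ⟨_, q, hM⟩ := hM.premises
    hI.instTm (hM.conv (ifTy_eq q.trace_inj))
  | _, .tracecase_for =>
    let ⟨_, q, hD, hM⟩ := hM.premises
    hF.instBoth hD ((hM.conv (forTy_eq (.refl hD) q.trace_inj)).cast (forTy_inst ..).symm)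
  | _, .tracecase_cell =>
    let ⟨_, q, hM⟩ := hM.premises
    hC.instTm (hM.conv (cellTy_eq (.sub q.trace_inj .base)))
  | _, .tracecase_opEq =>
    let ⟨hD, hM⟩ := hM.premises
    hE.instBoth hD hM
  | _, .tracecase_opPlus => hP.instTm hM.premises
  | _, .tracecase_ite =>
    let ⟨hL', h₁, h₂⟩ := hM.premises
    .ite hL' (.tracecase h₁ hL hI hF hC hE hP) (.tracecase h₂ hL hI hF hC hE hP)
  | _, .tracecase_scrut s => .tracecase (pM s) hL hI hF hC hE hP
  | _, .tracecase_L s => .tracecase hM (pL s) hI hF hC hE hP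
  | _, .tracecase_I s => .tracecase hM hL (pI s) hF hC hE hP
  | _, .tracecase_F s => .tracecase hM hL hI (pF s) hC hE hP
  | _, .tracecase_C s => .tracecase hM hL hI hF (pC s) hE hP
  | _, .tracecase_E s => .tracecase hM hL hI hF hC (pE s) hP
  | _, .tracecase_P s => .tracecase hM hL hI hF hC hE (pP s)

theorem Typed.preservation (h : Typed Γ M A) : Preserves Γ M A := by
  induction h with
  | const | var | table | nil | rnil => exact nofun
  | lam hA _ ih => exact fun | _, .lam s => .lam hA (ih s)
  | app hM hN ih ih' => exact .app hM hN ih ih'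
  | tlam _ ih => exact fun | _, .tlam s => .tlam (ih s)
  | tapp hM hC ih => exact .tapp hM hC ih
  | fix hA hM => exact fun | _, .fix => hM.instTm (.fix hA hM)
  | ite hL hM hN ih ih' ih'' => exact .ite hL hM hN ih ih' ih''
  | plus hM hN ih ih' => exact fun
    | _, .plus_left s => .plus (ih s) hN
    | _, .plus_right s => .plus hM (ih' s)
  | eq hM hN hA ih ih' => exact fun
    | _, .eq_left s => .eq (ih s) hN hA
    | _, .eq_right s => .eq hM (ih' s) hA
  | single _ ih => exact fun | _, .single s => .single (ih s)
  | append hM hN ih ih' => exact fun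
    | _, .append_left s => .append (ih s) hN
    | _, .append_right s => .append hM (ih' s)
  | comp hM hN ih ih' => exact .comp hM hN ih ih'
  | rcons hM hN ih ih' => exact fun
    | _, .rcons_head s => .rcons (ih s) hN
    | _, .rcons_tail s => .rcons hM (ih' s)
  | proj hM ih => exact .proj hM ih
  | conv _ e ih => exact fun _ s => (ih s).conv e
  | rmap hC hM hN ih ih' => exact .rmap hC hM hN ih ih'
  | rfold hL hM hN ih ih' ih'' => exact .rfold hL hM hN ih ih' ih''
  | typecase hC hB hMB hMI hMS hML hMR hMT iB iI iS iL iR iT =>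
    exact .typecase hC hB hMB hMI hMS hML hMR hMT iB iI iS iL iR iT
  | trLit_bool | trLit_int | trLit_string => exact fun | _, .trLit s => nomatch s
  | trIf _ ih => exact fun | _, .trIf s => .trIf (ih s)
  | trFor hC hM ih => exact .trFor hC hM ih
  | trCell hA _ ih => exact fun | _, .trCell s => .trCell hA (ih s)
  | trOpEq hC hM ih => exact .trOpEq hC hM ih
  | trOpPlus _ ih => exact fun | _, .trOpPlus s => .trOpPlus (ih s)
  | tracecase hM hL hI hF hC hE hP ih iL iI iF iC iE iP =>
    exact .tracecase hM hL hI hF hC hE hP ih iL iI iF iC iE iP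

end

end LinksT

/-- Preservation: reduction preserves typing. -/
theorem mainTheorem2 (Γ : LinksT.Ctx) (M M' : LinksT.Term) (A : LinksT.Ty)
    (hM : LinksT.Typed Γ M A) (hstep : LinksT.Step M M') : LinksT.Typed Γ M' A :=
  hM.preservation hstep
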